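/- **Setting.** Let $m,n\ge 1$, $p=2^m-1$, and let $\Omega=[0,1]$ be divided into $K$ elements $\Omega^e=[e/K,(e+1)/K]$, $0\le e<K$, where $2^n=Kp+1$ (so there are $2^n$ nodes in total and $2^m$ nodes per element). Let $N_j^e$ ($0\le j\le p$) be the Lagrange basis function of degree $p$ on $\Omega^e$ for $p+1$ equispaced nodes, extended by zero, and let $\mathrm{IX}(j,e)=ep+j$ be the global number of local node $j$ of element $e$. Let $B$ be a bilinear map from a real vector space of functions containing all $N_j^e$ to functions on $\mathbb R$, let $f\in L^\infty(\Omega)$ be real, and let $$F=\sum_{e}\sum_{j,k}\Big(\int_{\Omega^e} f(x)\,B[N_j^e,N_k^e](x)\,dx\Big)\,|\mathrm{IX}(j,e)\rangle\langle \mathrm{IX}(k,e)|\in\mathbb R^{2^n\times 2^n}.$$ Assume, for integers $D,r\ge 0$ and $G\ge 1$ with $D+r\le 2G-1$, and for some $\varepsilon\ge 0$: * on the interior of each element, $B[N_j^e,N_k^e]$ is a polynomial of degree at most $r$ (so the $G$-point Gauss–Legendre rule is exact for its products with polynomials of degree at most $D$); * the values $B[N_j^e,N_k^e](x_\ell^e)$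 do not depend on $e$, where $x_\ell^e=\frac1K\big(\frac{x_\ell+1}{2}+e\big)$ and $x_\ell$ are the $G$ roots of the Legendre polynomial of degree $G$; * $\|f-q\|_{L^\infty(\Omega)}\le\varepsilon$ for some real polynomial $q$ of degree at most $D$; * $\beta_e:=\|f\|_{L^\infty(\Omega)}\sum_{j,k}\int_{\Omega^e}|B[N_j^e,N_k^e](x)|\,dx>0$ for every $e$. **Circuits and cost.** "Toffoli or simpler" gates are arbitrary one-qubit gates, CNOT gates and Toffoli gates. A circuit may use work qubits that start in, and for every input on the remaining qubits are returned to, $|0\rangle$; these are not counted as ancillas. It has oracle access to one state-preparation pair $(P_L,P_R)$ for precomputed coefficients, that is, two unitaries on $\lceil\log_2 2G\rceil+\lceil 2\log_2(p+1)\rceil$ of the ancilla qubits; $P_R$ is applied once at the start and $P_L^\dagger$ once at the end, and these two queries are not counted as gates. An $(\alpha,a,\delta)$-block-encoding of $A\in\mathbb C^{2^n\times 2^n}$, $\alpha>0$, is a unitary $V$ on $n+a$ qubits with $\|A-\alpha(\langle 0^a|\otimes I)V(|0^a\rangle\otimes I)\|\le\delta$ in the spectral norm. **Theorem 4.1.**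 There is a universal constant $C$ such that, in every such situation, there exist $\alpha>0$ and an $(\alpha,a,\delta)$-block-encoding of $F$ with $$\alpha\le \|f\|_{L^\infty(\Omega)}\sum_{j,k}\int_{\Omega^e}\big|B[N_j^e,N_k^e](x)\big|\,dx\quad\text{for every element }e,$$ $$a=\lceil\log_2 n\rceil+\lceil\log_2 G\rceil+\lceil 2\log_2(p+1)\rceil+3,\qquad \delta=2\varepsilon\sum_{j,k}\max_e\int_{\Omega^e}\big|B[N_j^e,N_k^e](x)\big|\,dx,$$ which can be implemented with at most $C\,n\,(DG+p^2m)$ Toffoli or simpler gates. In particular, if $f$ is a polynomial of degree at most $D$ (i.e. $\varepsilon=0$), this is an exact $(\alpha,a)$-block-encoding of $F$. -/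

import Mathlib

open MeasureTheory Polynomial

noncomputable section

namespace QuFEM

/-! ### Qubit registers, gates and circuits -/

/-- Computational basis states of the qubits labelled by `W`. -/
abbrev Basis (W : Type) : Type := W → Fin 2

/-- Complex matrices acting on the qubits labelled by `W`. -/
abbrev Op (W : Type) : Type := Matrix (Basis W) (Basis W) ℂ

open Classical in
/-- The operator `M` on the qubits `κ`, placed on the wires `ι`, tensored with the identity on all
the other wires. -/
def onWires {κ W : Type} (ι : κ ↪ W) (M : Op κ) : Op W :=
  fun x y => if ∀ v, v ∉ Set.range ι → x v = y v then M (x ∘ ι) (y ∘ ι) else 0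

/-- A one-qubit matrix as an operator on the register `Fin 1`. -/
def singleOp (u : Matrix (Fin 2) (Fin 2) ℂ) : Op (Fin 1) :=
  fun x y => u (x 0) (y 0)

/-- CNOT: qubit `0` is the control, qubit `1` is the target. -/
def cnotOp : Op (Fin 2) :=
  fun x y => if x 0 = y 0 ∧ x 1 = y 1 + y 0 then 1 else 0

/-- Toffoli: qubits `0` and `1` are the controls, qubit `2` is the target. -/
def toffoliOp : Op (Fin 3) :=
  fun x y => if x 0 = y 0 ∧ x 1 = y 1 ∧ x 2 = y 2 + y 0 * y 1 then 1 else 0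

/-- "Toffoli or simpler" gates: one-qubit gates, CNOT gates and Toffoli gates. -/
inductive Gate (W : Type) : Type
  | single (q : Fin 1 ↪ W) (u : Matrix.unitaryGroup (Fin 2) ℂ) : Gate W
  | cnot (q : Fin 2 ↪ W) : Gate W
  | toffoli (q : Fin 3 ↪ W) : Gate W

/-- The unitary matrix of a gate. -/
def Gate.op {W : Type} : Gate W → Op W
  | .single q u => onWires q (singleOp u)
  | .cnot q => onWires q cnotOp
  | .toffoli q => onWires q toffoliOp

/-- The matrix of a circuit; the head of the list is applied first. -/
def circuitOp {W : Type} [Fintype W] [DecidableEq W] : List (Gate W) → Op W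
  | [] => 1
  | g :: gs => circuitOp gs * g.op

/-- `T`, which acts on the qubits `Q` and `w` work qubits, implements the operator `V` on `Q`:
started with the work qubits in the zero state, it applies `V` and returns the work qubits to the
zero state. -/
def Implements {Q : Type} {w : ℕ} (T : Op (Q ⊕ Fin w)) (V : Op Q) : Prop :=
  ∀ (x y : Basis Q) (z : Basis (Fin w)),
    T (Sum.elim x z) (Sum.elim y 0) = if z = 0 then V x y else 0

/-- The unitary `V` on `n` data qubits and `a` ancilla qubits can be implemented by at most `N`
Toffoli or simpler gates with oracle access to a state-preparation pair `(PL, PR)` on `b` of the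
ancilla qubits: `PR` is queried once, at the start, and the adjoint of `PL` once, at the end.
These two queries are not counted as gates. Any number of work qubits may be used, provided that
they start in the zero state and are returned to it. -/
def ImplementableWith (n a b N : ℕ) (V : Op (Fin n ⊕ Fin a)) : Prop :=
  ∃ (w : ℕ) (reg : Fin b ↪ Fin a) (PL PR : Matrix.unitaryGroup (Basis (Fin b)) ℂ)
    (gates : List (Gate ((Fin n ⊕ Fin a) ⊕ Fin w))),
    gates.length ≤ N ∧
    Implements
      (onWires (reg.trans (Function.Embedding.inr.trans Function.Embedding.inl))
          ((PL : Op (Fin b)).conjTranspose)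
        * circuitOp gates
        * onWires (reg.trans (Function.Embedding.inr.trans Function.Embedding.inl))
          (PR : Op (Fin b)))
      V

/-- Spectral norm of an `n`-qubit matrix. -/
def specNorm {n : ℕ} (A : Op (Fin n)) : ℝ :=
  ‖Matrix.toEuclideanCLM (n := Basis (Fin n)) (𝕜 := ℂ) A‖

/-- `V` is an `(α, a, δ)`-block-encoding of the `n`-qubit matrix `A`. -/
def IsBlockEncoding {n : ℕ} (α : ℝ) (a : ℕ) (δ : ℝ) (A : Op (Fin n))
    (V : Op (Fin n ⊕ Fin a)) : Prop :=
  0 < α ∧ V ∈ Matrix.unitaryGroup (Basis (Fin n ⊕ Fin a)) ℂ ∧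
    specNorm (A - (α : ℂ) • (Matrix.of fun i j : Basis (Fin n) =>
      V (Sum.elim i 0) (Sum.elim j 0))) ≤ δ

/-- A real `2 ^ n × 2 ^ n` matrix as an `n`-qubit matrix; basis states are the binary expansions
of the row and column numbers, qubit `i` carrying the digit of weight `2 ^ i`. -/
def toQubits {n : ℕ} (A : Matrix (Fin (2 ^ n)) (Fin (2 ^ n)) ℝ) : Op (Fin n) :=
  fun x y => ((A (finFunctionFinEquiv x) (finFunctionFinEquiv y) : ℝ) : ℂ)

/-! ### The uniform mesh of `[0, 1]` with Lagrange elements of order `p` -/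

/-- The element with number `e` of the uniform mesh of `[0, 1]` with `K` elements. -/
def element (K e : ℕ) : Set ℝ := Set.Icc ((e : ℝ) / K) (((e : ℝ) + 1) / K)

/-- Standard Lagrange basis polynomial of order `p` on `[0, 1]`, for the nodes `i / p`. -/
def stdBasis (p : ℕ) (j : Fin (p + 1)) : ℝ[X] :=
  Lagrange.basis Finset.univ (fun i : Fin (p + 1) => (i : ℝ) / (p : ℝ)) j

/-- The local basis function `j` of the element `e`, extended by zero. -/
def elemBasis (p K e : ℕ) (j : Fin (p + 1)) : ℝ → ℝ :=
  (element K e).indicator fun x => (stdBasis p j).eval ((K : ℝ) * x - e)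

/-- Gauss-Legendre points on `[-1, 1]`: the roots of the Legendre polynomial of degree `G`
(the shifted Legendre polynomial at `t` is the Legendre polynomial at `1 - 2 * t`). -/
def IsGaussPoint (G : ℕ) (x : ℝ) : Prop :=
  aeval ((1 - x) / 2) (shiftedLegendre G) = 0

/-- The point `x` of `[-1, 1]` transported to the element `e`. -/
def elemPoint (K e : ℕ) (x : ℝ) : ℝ := ((x + 1) / 2 + e) / K

/-- Connectivity of the one-dimensional mesh: the global number of the local node `j` of the
element `e`. -/
def IX (p e j : ℕ) : ℕ := e * p + j

/-- The elemental array: the integral over the element `e` of `f` times `b e j k`. -/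
def elemArray {p : ℕ} (K : ℕ) (f : ℝ → ℝ) (b : Fin K → Fin (p + 1) → Fin (p + 1) → ℝ → ℝ)
    (e : Fin K) (j k : Fin (p + 1)) : ℝ :=
  ∫ x in element K e, f x * b e j k x

/-- The global array assembled from the elemental arrays through the connectivity. -/
def globalArray {p : ℕ} (n K : ℕ) (f : ℝ → ℝ)
    (b : Fin K → Fin (p + 1) → Fin (p + 1) → ℝ → ℝ) :
    Matrix (Fin (2 ^ n)) (Fin (2 ^ n)) ℝ :=
  fun I J => ∑ e : Fin K, ∑ j : Fin (p + 1), ∑ k : Fin (p + 1),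
    if (I : ℕ) = IX p e j ∧ (J : ℕ) = IX p e k then elemArray K f b e j k else 0

/-- The integral over the element `e` of the absolute value of `b e j k`. -/
def elemAbs {p : ℕ} (K : ℕ) (b : Fin K → Fin (p + 1) → Fin (p + 1) → ℝ → ℝ)
    (e : Fin K) (j k : Fin (p + 1)) : ℝ :=
  ∫ x in element K e, |b e j k x|

/-- Lebesgue measure on `[0, 1]`. -/
def unitVolume : Measure ℝ := volume.restrict (Set.Icc 0 1)

/-- The norm of `L^∞([0, 1])`. -/
def supNorm (f : ℝ → ℝ) : ℝ := (eLpNorm f ⊤ unitVolume).toReal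

/-- The functions `B[N_j^e, N_k^e]` obtained from a bilinear map `B` on a function space `U` that
contains the local basis functions. -/
def pairing {p K : ℕ} {U : Submodule ℝ (ℝ → ℝ)} (B : U →ₗ[ℝ] U →ₗ[ℝ] (ℝ → ℝ))
    (hU : ∀ (e : Fin K) (j : Fin (p + 1)), elemBasis p K e j ∈ U)
    (e : Fin K) (j k : Fin (p + 1)) : ℝ → ℝ :=
  B ⟨elemBasis p K e j, hU e j⟩ ⟨elemBasis p K e k, hU e k⟩

/-- The number of ancilla qubits. -/
def ancillas (n p G : ℕ) : ℕ := Nat.clog 2 n + Nat.clog 2 G + Nat.clog 2 ((p + 1) ^ 2) + 3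

/-- The number of qubits on which the state-preparation pair for the (at most `2 * G` points times
`(p + 1) ^ 2` pairs of local nodes) precomputed coefficients acts. -/
def prepQubits (p G : ℕ) : ℕ := Nat.clog 2 (2 * G) + Nat.clog 2 ((p + 1) ^ 2)

end QuFEM

end

/-! Let `S` be the essential supremum of `|f|` and `v = q / (S + ε)`, which is bounded by 1 on `[0,
1]`. Since `f - S v = (f - q) + ε v`, replacing `f` by `S v` changes each elemental integral by at
most `2 ε` times the integral of `|B[N_j, N_k]|`. For fixed local nodes `j, k` the pairs of global
nodes form a partial matching as the element varies, so the spectral norm of such a contribution is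
bounded by its largest entry (`specNorm_assembled_sub_le`). This gives `δ`, and it remains to encode
exactly the matrix assembled from `S ∫ v B[N_j, N_k]`.

In local coordinates the polynomials of two elements agree at the Gauss points. Their difference is
divisible by the Legendre polynomial, and by orthogonality it integrates to zero against polynomials
of degree at most `D`; hence one reference element, that with the smallest bound, can serve for all
(`integral_mul_element`). Its integrals are discretised by a rule adapted to the bound on `α`. A
Gauss rule may overestimate the integral of an absolute value, whereas a Tchakaloff argument
(`exists_quadrature`) yields at most `2 G` points with nonnegative weights, exact below degree `2
G`, whose value on the sum of the absolute values is at most the integral. So each entry is a sum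
over points `t_i` of `c_ijk v((e + t_i) / K)`, with total absolute weight below the bound of every
element (`exists_coefficients`). The state-preparation pair supplies the `c_ijk`.

For fixed `i, j, k` the circuit has to send the node `J = e p + k` to `e p + j` with amplitude `v((e
+ t_i) / K)`. Choose a binary digit position with probability proportional to its weight, and the
left or right end of the element with probabilities `1 - t_i` and `t_i`. Because `2 ^ n - 1 = K p`,
the expected sign of that digit is affine in `(e + t_i) / K`. A reflection turns this expectation
into a walk operator `W` with `(W + W†)|0⟩ = 2 y |0⟩` (`exists_walk`). Generalized quantum signal
processing with `2 D` walks produces `W ^ D` times the polynomial in `y`, and `D` inverse walks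
remove `W ^ D`. The required complementary polynomial exists by Fejér-Riesz on `[-1, 1]`
(`fejerRiesz`), and the one-qubit gates by peeling off one degree at a time (`gqsp_of_norm`). If `J`
is not the local node `k` of any element, a flag is raised; the walk then acts trivially and the
zero ancilla state is never reached.

A walk costs order `n G` for a state preparation addressed by the point and order `n p` for the
arithmetic. With `3 D` walks, `D p ≤ D G + 2 p ^ 2` brings the total to the claimed form
(`cost_le`). -/

set_option linter.unusedSectionVars false

noncomputable section
namespace QuFEM

/-! ### Operators placed on some of the wires -/

section OnWires

variable {κ ι W R : Type}

open Classical in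
/-- The basis state `y` with the values on the wires `q` replaced by `t`. -/
def patch (q : κ ↪ W) (y : Basis W) (t : Basis κ) : Basis W :=
  fun v => if h : ∃ k, q k = v then t h.choose else y v

@[simp] theorem patch_apply (q : κ ↪ W) (y : Basis W) (t : Basis κ) (k : κ) :
    patch q y t (q k) = t k := by
  have h : ∃ k', q k' = q k := ⟨k, rfl⟩
  rw [patch, dif_pos h, q.injective h.choose_spec]

theorem patch_apply_of_notMem (q : κ ↪ W) (y : Basis W) (t : Basis κ) {v : W}
    (hv : v ∉ Set.range q) : patch q y t v = y v := by
  rw [patch, dif_neg]; simpa using hv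

@[simp] theorem patch_comp (q : κ ↪ W) (y : Basis W) (t : Basis κ) : patch q y t ∘ q = t := by
  ext k; simp

@[simp] theorem patch_self (q : κ ↪ W) (y : Basis W) : patch q y (y ∘ q) = y := by
  funext v
  by_cases hv : v ∈ Set.range q
  · obtain ⟨k, rfl⟩ := hv; simp
  · rw [patch_apply_of_notMem q y _ hv]

theorem eq_patch_iff (q : κ ↪ W) (x y : Basis W) :
    (∀ v, v ∉ Set.range q → x v = y v) ↔ x = patch q y (x ∘ q) := by
  constructor
  · intro h
    funext v
    by_cases hv : v ∈ Set.range q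
    · obtain ⟨k, rfl⟩ := hv; simp
    · rw [patch_apply_of_notMem q y _ hv, h v hv]
  · intro h v hv
    rw [h, patch_apply_of_notMem q y _ hv]

theorem patch_injective (q : κ ↪ W) (y : Basis W) : Function.Injective (patch q y) := by
  intro s t h
  rw [← patch_comp q y s, h, patch_comp]

theorem onWires_apply_of (q : κ ↪ W) (M : Op κ) (x y : Basis W)
    (h : ∀ v, v ∉ Set.range q → x v = y v) : onWires q M x y = M (x ∘ q) (y ∘ q) := if_pos h

theorem onWires_apply_of_not (q : κ ↪ W) (M : Op κ) (x y : Basis W)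
    (h : ¬ ∀ v, v ∉ Set.range q → x v = y v) : onWires q M x y = 0 := if_neg h

theorem onWires_patch (q : κ ↪ W) (M : Op κ) (y : Basis W) (t : Basis κ) :
    onWires q M (patch q y t) y = M t (y ∘ q) := by
  rw [onWires_apply_of, patch_comp]
  intro v hv; exact patch_apply_of_notMem q y t hv

variable [Fintype W] [DecidableEq W] [Fintype κ] [DecidableEq κ]
  [Fintype R] [DecidableEq R] [Fintype ι] [DecidableEq ι]

/-- A sum over basis states which agree with `y` outside the wires `q`. -/
theorem sum_onWires (q : κ ↪ W) (y : Basis W) (F : Basis W → ℂ)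
    (hF : ∀ x, (¬ ∀ v, v ∉ Set.range q → x v = y v) → F x = 0) :
    ∑ x, F x = ∑ t, F (patch q y t) := by
  classical
  rw [← Finset.sum_image (s := Finset.univ) (g := patch q y)
    (fun _ _ _ _ h => patch_injective q y h)]
  symm
  apply Finset.sum_subset (Finset.subset_univ _)
  intro x _ hx
  apply hF
  intro h
  apply hx
  rw [(eq_patch_iff q x y).1 h]
  exact Finset.mem_image_of_mem _ (Finset.mem_univ _)

theorem onWires_mul (q : κ ↪ W) (A B : Op κ) :
    onWires q (A * B) = onWires q A * onWires q B := by
  ext x y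
  rw [Matrix.mul_apply, sum_onWires q y]
  · by_cases h : ∀ v, v ∉ Set.range q → x v = y v
    · rw [onWires_apply_of q _ x y h, Matrix.mul_apply]
      refine Finset.sum_congr rfl fun t _ => ?_
      rw [onWires_patch, onWires_apply_of, patch_comp]
      intro v hv
      rw [patch_apply_of_notMem q y t hv, h v hv]
    · rw [onWires_apply_of_not q _ x y h]
      symm
      apply Finset.sum_eq_zero
      intro t _
      rw [onWires_apply_of_not, zero_mul]
      intro h'
      apply h
      intro v hv
      rw [h' v hv, patch_apply_of_notMem q y t hv]
  · intro z hz
    rw [onWires_apply_of_not q B z y hz, mul_zero]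

theorem onWires_one (q : κ ↪ W) : onWires q (1 : Op κ) = 1 := by
  ext x y
  by_cases h : ∀ v, v ∉ Set.range q → x v = y v
  · rw [onWires_apply_of q _ x y h]
    by_cases hxy : x = y
    · subst hxy; simp
    · rw [Matrix.one_apply_ne hxy, Matrix.one_apply_ne]
      intro h2
      apply hxy
      rw [(eq_patch_iff q x y).1 h, h2, patch_self]
  · rw [onWires_apply_of_not q _ x y h, Matrix.one_apply_ne]
    rintro rfl
    exact h fun _ _ => rfl

theorem onWires_conjTranspose (q : κ ↪ W) (A : Op κ) :
    (onWires q A).conjTranspose = onWires q A.conjTranspose := by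
  ext x y
  rw [Matrix.conjTranspose_apply]
  by_cases h : ∀ v, v ∉ Set.range q → x v = y v
  · rw [onWires_apply_of q _ x y h, onWires_apply_of q _ y x (fun v hv => (h v hv).symm),
      Matrix.conjTranspose_apply]
  · rw [onWires_apply_of_not q _ x y h, onWires_apply_of_not, star_zero]
    intro h'
    exact h fun v hv => (h' v hv).symm

theorem onWires_trans (q : κ ↪ ι) (s : ι ↪ W) (A : Op κ) :
    onWires (q.trans s) A = onWires s (onWires q A) := by
  ext x y
  by_cases h : ∀ v, v ∉ Set.range s → x v = y v
  · rw [onWires_apply_of s _ x y h]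
    by_cases h2 : ∀ v, v ∉ Set.range q → x (s v) = y (s v)
    · rw [onWires_apply_of q _ (x ∘ s) (y ∘ s) h2, onWires_apply_of]
      · rfl
      · intro v hv
        by_cases hv' : v ∈ Set.range s
        · obtain ⟨k, rfl⟩ := hv'
          apply h2
          rintro ⟨l, rfl⟩
          exact hv ⟨l, rfl⟩
        · exact h v hv'
    · rw [onWires_apply_of_not q _ (x ∘ s) (y ∘ s) h2, onWires_apply_of_not]
      intro h'
      apply h2
      intro v hv
      apply h'
      rintro ⟨l, hl⟩
      exact hv ⟨l, s.injective hl⟩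
  · rw [onWires_apply_of_not s _ x y h, onWires_apply_of_not]
    intro h'
    apply h
    intro v hv
    apply h'
    rintro ⟨l, rfl⟩
    exact hv ⟨_, rfl⟩

theorem onWires_mem_unitary (q : κ ↪ W) {A : Op κ} (hA : A ∈ Matrix.unitaryGroup (Basis κ) ℂ) :
    onWires q A ∈ Matrix.unitaryGroup (Basis W) ℂ := by
  rw [Matrix.mem_unitaryGroup_iff] at hA ⊢
  rw [Matrix.star_eq_conjTranspose] at hA ⊢
  rw [onWires_conjTranspose, ← onWires_mul, hA, onWires_one]

theorem onWires_refl (A : Op W) : onWires (Function.Embedding.refl W) A = A := by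
  ext x y
  rw [onWires_apply_of]
  · rfl
  · intro v hv; exact absurd ⟨v, rfl⟩ hv

/-- The basis vector of a basis state. -/
abbrev ket (y : Basis W) : Basis W → ℂ := Pi.single y 1

theorem mulVec_ket (A : Op W) (x y : Basis W) : A.mulVec (ket y) x = A x y := by
  simp

theorem ket_apply (x y : Basis W) : ket y x = if x = y then 1 else 0 := Pi.single_apply y 1 x

theorem op_ext_ket {A B : Op W} (h : ∀ y, A.mulVec (ket y) = B.mulVec (ket y)) : A = B := by
  ext x y
  have := congrFun (h y) x
  simpa [mulVec_ket] using this

theorem onWires_mulVec_ket (q : κ ↪ W) (M : Op κ) (y : Basis W) :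
    (onWires q M).mulVec (ket y) = ∑ t, M t (y ∘ q) • ket (patch q y t) := by
  ext x
  rw [mulVec_ket]
  rw [Finset.sum_apply]
  by_cases h : ∀ v, v ∉ Set.range q → x v = y v
  · rw [onWires_apply_of q _ x y h, Finset.sum_eq_single (x ∘ q)]
    · rw [← (eq_patch_iff q x y).1 h]; simp
    · intro t _ ht
      have : x ≠ patch q y t := by
        rintro rfl; simp at ht
      simp [this]
    · simp
  · rw [onWires_apply_of_not q _ x y h]
    symm
    apply Finset.sum_eq_zero
    intro t _
    have : x ≠ patch q y t := by
      rintro rfl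
      exact h fun v hv => patch_apply_of_notMem q y t hv
    simp [this]

/-- If `M` maps a basis state to a basis state, then so does `onWires q M`. -/
theorem onWires_mulVec_ket_of (q : κ ↪ W) (M : Op κ) (y : Basis W) (t : Basis κ)
    (h : M.mulVec (ket (y ∘ q)) = ket t) :
    (onWires q M).mulVec (ket y) = ket (patch q y t) := by
  rw [onWires_mulVec_ket, Finset.sum_eq_single t]
  · have := congrFun h t
    rw [mulVec_ket] at this
    simp [this]
  · intro s _ hs
    have := congrFun h s
    rw [mulVec_ket] at this
    simp [this, hs]
  · simp

end OnWires

/-! ### Gates and circuits -/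

section Circuits

variable {W R : Type} [Fintype W] [DecidableEq W] [Fintype R] [DecidableEq R]

theorem circuitOp_append (l l' : List (Gate W)) :
    circuitOp (l ++ l') = circuitOp l' * circuitOp l := by
  induction l with
  | nil => simp [circuitOp]
  | cons g l ih => simp [circuitOp, ih, mul_assoc]

/-- A gate moved to other wires. -/
def Gate.map {W R : Type} (s : W ↪ R) : Gate W → Gate R
  | .single q u => .single (q.trans s) u
  | .cnot q => .cnot (q.trans s)
  | .toffoli q => .toffoli (q.trans s)

theorem Gate.op_map (s : W ↪ R) (g : Gate W) : (g.map s).op = onWires s g.op := by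
  cases g <;> exact onWires_trans _ _ _

theorem circuitOp_map (s : W ↪ R) (l : List (Gate W)) :
    circuitOp (l.map (Gate.map s)) = onWires s (circuitOp l) := by
  induction l with
  | nil => simp [circuitOp, onWires_one]
  | cons g l ih => simp [circuitOp, ih, onWires_mul, Gate.op_map]

/-- The inverse of a gate. -/
def Gate.inv {W : Type} : Gate W → Gate W
  | .single q u => .single q u⁻¹
  | .cnot q => .cnot q
  | .toffoli q => .toffoli q

theorem singleOp_mul (u v : Matrix (Fin 2) (Fin 2) ℂ) :
    singleOp u * singleOp v = singleOp (u * v) := by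
  ext x y
  rw [Matrix.mul_apply]
  simp only [singleOp, Matrix.mul_apply]
  exact Fintype.sum_equiv (Equiv.funUnique (Fin 1) (Fin 2)) _ _ (fun z => rfl)

theorem singleOp_one : singleOp 1 = 1 := by
  ext x y
  by_cases h : x = y
  · subst h; simp [singleOp]
  · have : x 0 ≠ y 0 := by
      intro h'; apply h; funext i; rw [Subsingleton.elim i 0, h']
    simp [singleOp, h, this]

theorem cnotOp_conjTranspose : cnotOp.conjTranspose = cnotOp := by
  ext x y
  simp only [cnotOp, Matrix.conjTranspose_apply]
  have : (y 0 = x 0 ∧ y 1 = x 1 + x 0) ↔ (x 0 = y 0 ∧ x 1 = y 1 + y 0) := by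
    generalize x 0 = a; generalize x 1 = b; generalize y 0 = c; generalize y 1 = d
    revert a b c d; decide
  by_cases h : x 0 = y 0 ∧ x 1 = y 1 + y 0
  · rw [if_pos h, if_pos (this.2 h), star_one]
  · rw [if_neg h, if_neg (fun h' => h (this.1 h')), star_zero]

theorem toffoliOp_conjTranspose : toffoliOp.conjTranspose = toffoliOp := by
  ext x y
  simp only [toffoliOp, Matrix.conjTranspose_apply]
  have : (y 0 = x 0 ∧ y 1 = x 1 ∧ y 2 = x 2 + x 0 * x 1) ↔
      (x 0 = y 0 ∧ x 1 = y 1 ∧ x 2 = y 2 + y 0 * y 1) := by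
    generalize x 0 = a; generalize x 1 = b; generalize y 0 = c; generalize y 1 = d
    generalize x 2 = e; generalize y 2 = f
    revert a b c d e f; decide
  by_cases h : x 0 = y 0 ∧ x 1 = y 1 ∧ x 2 = y 2 + y 0 * y 1
  · rw [if_pos h, if_pos (this.2 h), star_one]
  · rw [if_neg h, if_neg (fun h' => h (this.1 h')), star_zero]

theorem cnotOp_ket (y : Basis (Fin 2)) :
    cnotOp.mulVec (ket y) = ket ![y 0, y 1 + y 0] := by
  ext x
  have : x = ![y 0, y 1 + y 0] ↔ (x 0 = y 0 ∧ x 1 = y 1 + y 0) := by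
    rw [funext_iff, Fin.forall_fin_two]; rfl
  simp [cnotOp, Pi.single_apply, this]

theorem toffoliOp_ket (y : Basis (Fin 3)) :
    toffoliOp.mulVec (ket y) = ket ![y 0, y 1, y 2 + y 0 * y 1] := by
  ext x
  have : x = ![y 0, y 1, y 2 + y 0 * y 1] ↔ (x 0 = y 0 ∧ x 1 = y 1 ∧ x 2 = y 2 + y 0 * y 1) := by
    rw [funext_iff, Fin.forall_fin_succ, Fin.forall_fin_two]; rfl
  simp [toffoliOp, Pi.single_apply, this]

theorem cnotOp_mul_self : cnotOp * cnotOp = 1 := by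
  apply op_ext_ket
  intro y
  rw [← Matrix.mulVec_mulVec, cnotOp_ket, cnotOp_ket, Matrix.one_mulVec]
  congr 1
  funext i
  fin_cases i
  · rfl
  · show y 1 + y 0 + y 0 = y 1
    generalize y 0 = a; generalize y 1 = b; revert a b; decide

theorem toffoliOp_mul_self : toffoliOp * toffoliOp = 1 := by
  apply op_ext_ket
  intro y
  rw [← Matrix.mulVec_mulVec, toffoliOp_ket, toffoliOp_ket, Matrix.one_mulVec]
  congr 1
  funext i
  fin_cases i
  · rfl
  · rfl
  · show y 2 + y 0 * y 1 + y 0 * y 1 = y 2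
    generalize y 0 = a; generalize y 1 = b; generalize y 2 = c; revert a b c; decide

theorem Gate.op_inv (g : Gate W) : g.inv.op = g.op.conjTranspose := by
  cases g with
  | single q u =>
    rw [Gate.op, onWires_conjTranspose]
    rfl
  | cnot q => rw [Gate.inv, Gate.op, onWires_conjTranspose, cnotOp_conjTranspose]
  | toffoli q => rw [Gate.inv, Gate.op, onWires_conjTranspose, toffoliOp_conjTranspose]

theorem Gate.op_inv_mul (g : Gate W) : g.inv.op * g.op = 1 := by
  cases g with
  | single q u =>
    rw [Gate.inv, Gate.op, Gate.op, ← onWires_mul, singleOp_mul]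
    rw [show (((u⁻¹ : Matrix.unitaryGroup (Fin 2) ℂ) : Matrix (Fin 2) (Fin 2) ℂ) * u) = 1 by
      rw [← Matrix.UnitaryGroup.mul_val, inv_mul_cancel]; rfl]
    rw [singleOp_one, onWires_one]
  | cnot q => rw [Gate.inv, Gate.op, ← onWires_mul, cnotOp_mul_self, onWires_one]
  | toffoli q => rw [Gate.inv, Gate.op, ← onWires_mul, toffoliOp_mul_self, onWires_one]

/-- The inverse circuit. -/
def circuitInv (l : List (Gate W)) : List (Gate W) := (l.map Gate.inv).reverse

theorem circuitOp_inv (l : List (Gate W)) :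
    circuitOp (circuitInv l) = (circuitOp l).conjTranspose := by
  induction l with
  | nil => simp [circuitInv, circuitOp]
  | cons g l ih =>
    simp only [circuitInv, List.map_cons, List.reverse_cons] at ih ⊢
    rw [circuitOp_append, ih]
    simp [circuitOp, Gate.op_inv]

theorem circuitOp_conjTranspose_mul (l : List (Gate W)) :
    (circuitOp l).conjTranspose * circuitOp l = 1 := by
  induction l with
  | nil => simp [circuitOp]
  | cons g l ih =>
    rw [circuitOp, Matrix.conjTranspose_mul, Matrix.mul_assoc,
      ← Matrix.mul_assoc (circuitOp l).conjTranspose, ih, Matrix.one_mul, ← Gate.op_inv,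
      Gate.op_inv_mul]

end Circuits

/-! ### Implementing operators with work qubits -/

section Impl

variable {Q R w w' : Type} [Fintype Q] [DecidableEq Q] [Fintype R] [DecidableEq R]
  [Fintype w] [DecidableEq w] [Fintype w'] [DecidableEq w']

/-- The isometry which adjoins the work qubits `w` in the zero state. -/
def adjoinZero (Q w : Type) [Fintype Q] [DecidableEq Q] [Fintype w] [DecidableEq w] :
    Matrix (Basis (Q ⊕ w)) (Basis Q) ℂ :=
  fun s y => if s = Sum.elim y 0 then 1 else 0

theorem adjoinZero_mul_apply (V : Op Q) (s : Basis (Q ⊕ w)) (y : Basis Q) :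
    (adjoinZero Q w * V) s y = if s ∘ Sum.inr = 0 then V (s ∘ Sum.inl) y else 0 := by
  rw [Matrix.mul_apply]
  have key : ∀ x : Basis Q, s = Sum.elim x 0 ↔ (x = s ∘ Sum.inl ∧ s ∘ Sum.inr = 0) := by
    intro x
    constructor
    · rintro rfl; exact ⟨rfl, rfl⟩
    · rintro ⟨rfl, h⟩
      rw [← h]; exact (Sum.elim_comp_inl_inr s).symm
  by_cases h : s ∘ Sum.inr = 0
  · rw [if_pos h, Finset.sum_eq_single (s ∘ Sum.inl)]
    · rw [adjoinZero, if_pos ((key _).2 ⟨rfl, h⟩), one_mul]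
    · intro x _ hx
      rw [adjoinZero, if_neg (fun h' => hx ((key x).1 h').1), zero_mul]
    · simp
  · rw [if_neg h]
    apply Finset.sum_eq_zero
    intro x _
    rw [adjoinZero, if_neg (fun h' => h ((key x).1 h').2), zero_mul]

theorem mul_adjoinZero_apply (T : Op (Q ⊕ w)) (s : Basis (Q ⊕ w)) (y : Basis Q) :
    (T * adjoinZero Q w) s y = T s (Sum.elim y 0) := by
  rw [Matrix.mul_apply, Finset.sum_eq_single (Sum.elim y 0)]
  · simp [adjoinZero]
  · intro x _ hx; simp [adjoinZero, hx]
  · simp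

theorem adjoinZero_isometry :
    (adjoinZero Q w).conjTranspose * adjoinZero Q w = 1 := by
  ext x y
  rw [Matrix.mul_apply, Finset.sum_eq_single (Sum.elim y 0)]
  · simp only [Matrix.conjTranspose_apply, adjoinZero, if_true, mul_one]
    have : (Sum.elim y (0 : Basis w) = Sum.elim x 0) ↔ x = y :=
      ⟨fun h => by have := congrArg (· ∘ Sum.inl) h; simpa using this.symm, fun h => by rw [h]⟩
    by_cases h : x = y
    · subst h; simp
    · rw [if_neg (fun h' => h (this.1 h')), star_zero, Matrix.one_apply_ne h]
  · intro s _ hs; simp [adjoinZero, hs]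
  · simp

/-- `T` implements `V`, with any finite type of work qubits. -/
def Carries (T : Op (Q ⊕ w)) (V : Op Q) : Prop :=
  T * adjoinZero Q w = adjoinZero Q w * V

theorem carries_iff (T : Op (Q ⊕ w)) (V : Op Q) :
    Carries T V ↔ ∀ (x : Basis Q) (y : Basis Q) (z : Basis w),
      T (Sum.elim x z) (Sum.elim y 0) = if z = 0 then V x y else 0 := by
  constructor
  · intro h x y z
    have := congrFun (congrFun h (Sum.elim x z)) y
    rwa [mul_adjoinZero_apply, adjoinZero_mul_apply] at this
  · intro h
    ext s y
    rw [mul_adjoinZero_apply, adjoinZero_mul_apply, ← Sum.elim_comp_inl_inr s, h]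
    rfl

theorem carries_of_ket {T : Op (Q ⊕ w)} {V : Op Q} (z : Basis Q → Basis Q) (c : Basis Q → ℂ)
    (hT : ∀ y, T.mulVec (ket (Sum.elim y 0)) = c y • ket (Sum.elim (z y) 0))
    (hV : ∀ y, V.mulVec (ket y) = c y • ket (z y)) : Carries T V := by
  rw [carries_iff]
  intro x y s
  have h1 := congrFun (hT y) (Sum.elim x s)
  have h2 := congrFun (hV y) x
  rw [mulVec_ket] at h1 h2
  rw [h1, h2]
  have : (Sum.elim x s = Sum.elim (z y) 0) ↔ (x = z y ∧ s = 0) :=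
    ⟨fun h => ⟨congrArg (· ∘ Sum.inl) h, congrArg (· ∘ Sum.inr) h⟩, fun h => by rw [h.1, h.2]⟩
  rw [Pi.smul_apply, Pi.smul_apply, ket_apply, ket_apply, if_congr this rfl rfl]
  by_cases hs : s = 0 <;> by_cases hx : x = z y <;> simp [hs, hx]

/-- Carrying is an intertwining relation with the isometry `adjoinZero`, so it composes without
tracking the work qubits in between. -/
theorem Carries.mul {T S : Op (Q ⊕ w)} {V U : Op Q} (h : Carries T V) (h' : Carries S U) :
    Carries (T * S) (V * U) := by
  unfold Carries at *
  rw [Matrix.mul_assoc, h', ← Matrix.mul_assoc, h, Matrix.mul_assoc]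

theorem carries_onWires_inl (V : Op Q) :
    Carries (onWires (Function.Embedding.inl : Q ↪ Q ⊕ w) V) V := by
  rw [carries_iff]
  intro x y z
  by_cases hz : z = 0
  · rw [if_pos hz, onWires_apply_of]
    · rfl
    · rintro (v | v) hv
      · exact absurd ⟨v, rfl⟩ hv
      · simp [hz]
  · rw [if_neg hz, onWires_apply_of_not]
    intro h
    apply hz
    funext v
    have := h (Sum.inr v) (by rintro ⟨u, hu⟩; cases hu)
    simpa using this

/-- Moving an implementation to other wires and to more work qubits. -/
theorem Carries.map {T : Op (Q ⊕ w)} {V : Op Q} (h : Carries T V) (s : Q ↪ R) (t : w ↪ w') :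
    Carries (onWires (s.sumMap t) T) (onWires s V) := by
  rw [carries_iff] at h ⊢
  intro x y z
  have hcomp : ∀ (a : Basis R) (b : Basis w'),
      (Sum.elim a b : Basis (R ⊕ w')) ∘ (s.sumMap t) = Sum.elim (a ∘ s) (b ∘ t) := by
    intro a b; funext v; cases v <;> rfl
  by_cases hxy : ∀ v, v ∉ Set.range s → x v = y v
  · by_cases hz : ∀ v, v ∉ Set.range t → z v = 0
    · rw [onWires_apply_of, hcomp, hcomp, onWires_apply_of s _ x y hxy]
      · rw [show ((0 : Basis w') ∘ t) = 0 from rfl, h]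
        have : z ∘ t = 0 ↔ z = 0 := by
          constructor
          · intro h0
            funext v
            by_cases hv : v ∈ Set.range t
            · obtain ⟨k, rfl⟩ := hv; exact congrFun h0 k
            · exact hz v hv
          · rintro rfl; rfl
        by_cases h0 : z = 0
        · rw [if_pos h0, if_pos (this.2 h0)]
        · rw [if_neg h0, if_neg (fun h' => h0 (this.1 h'))]
      · rintro (v | v) hv
        · exact hxy v (fun ⟨k, hk⟩ => hv ⟨Sum.inl k, by rw [← hk]; rfl⟩)
        · exact hz v (fun ⟨k, hk⟩ => hv ⟨Sum.inr k, by rw [← hk]; rfl⟩)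
    · rw [onWires_apply_of_not, if_neg]
      · rintro rfl; exact hz fun _ _ => rfl
      · intro h'
        apply hz
        intro v hv
        exact h' (Sum.inr v) (fun ⟨k, hk⟩ => hv (by
          rcases k with k | k
          · cases hk
          · exact ⟨k, Sum.inr_injective hk⟩))
  · rw [onWires_apply_of_not s _ x y hxy, ite_self, onWires_apply_of_not]
    intro h'
    apply hxy
    intro v hv
    exact h' (Sum.inl v) (fun ⟨k, hk⟩ => hv (by
      rcases k with k | k
      · exact ⟨k, Sum.inl_injective hk⟩
      · cases hk))

/-- `V` can be implemented by at most `N` gates, with any finite number of work qubits. -/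
def Impl (N : ℕ) (V : Op Q) : Prop :=
  ∃ (w : Type) (_ : Fintype w) (_ : DecidableEq w) (l : List (Gate (Q ⊕ w))),
    l.length ≤ N ∧ Carries (circuitOp l) V

theorem Impl.mono {N N' : ℕ} {V : Op Q} (h : Impl N V) (hN : N ≤ N') : Impl N' V := by
  obtain ⟨w, i1, i2, l, hl, hc⟩ := h
  exact ⟨w, i1, i2, l, hl.trans hN, hc⟩

theorem impl_one : Impl 0 (1 : Op Q) :=
  ⟨Empty, inferInstance, inferInstance, [], le_rfl, by simp [circuitOp, Carries]⟩

/-- The two circuits receive disjoint work registers. Work qubits are not counted, so nothing is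
gained by sharing them. -/
theorem Impl.mul {N N' : ℕ} {V U : Op Q} (h : Impl N V) (h' : Impl N' U) :
    Impl (N + N') (V * U) := by
  obtain ⟨w, i1, i2, l, hl, hc⟩ := h
  obtain ⟨w', i1', i2', l', hl', hc'⟩ := h'
  refine ⟨w ⊕ w', inferInstance, inferInstance,
    l'.map (Gate.map ((Function.Embedding.refl Q).sumMap Function.Embedding.inr)) ++
    l.map (Gate.map ((Function.Embedding.refl Q).sumMap Function.Embedding.inl)), ?_, ?_⟩
  · simp; omega
  · rw [circuitOp_append, circuitOp_map, circuitOp_map]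
    have := (hc.map (Function.Embedding.refl Q) (Function.Embedding.inl : w ↪ w ⊕ w')).mul
      (hc'.map (Function.Embedding.refl Q) (Function.Embedding.inr : w' ↪ w ⊕ w'))
    rwa [onWires_refl, onWires_refl] at this

theorem Impl.pow {N : ℕ} {V : Op Q} (h : Impl N V) (k : ℕ) : Impl (k * N) (V ^ k) := by
  induction k with
  | zero => simpa using impl_one
  | succ k ih => rw [pow_succ, Nat.succ_mul]; exact ih.mul h

theorem Impl.onWires {N : ℕ} {V : Op Q} (h : Impl N V) (s : Q ↪ R) : Impl N (onWires s V) := by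
  obtain ⟨w, i1, i2, l, hl, hc⟩ := h
  refine ⟨w, i1, i2, l.map (Gate.map (s.sumMap (Function.Embedding.refl w))), by simpa, ?_⟩
  rw [circuitOp_map]
  exact hc.map s _

/-- A circuit is unitary and adjoining zeros is isometric, so an operator intertwined with a circuit
preserves inner products. Unitarity of the circuits' operators is read off here instead of from
their formulas. -/
theorem Impl.isometry {N : ℕ} {V : Op Q} (h : Impl N V) : V.conjTranspose * V = 1 := by
  obtain ⟨w, i1, i2, l, hl, hc⟩ := h
  have h1 : V = (adjoinZero Q w).conjTranspose * (circuitOp l * adjoinZero Q w) := by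
    rw [hc, ← Matrix.mul_assoc, adjoinZero_isometry, Matrix.one_mul]
  calc V.conjTranspose * V
      = V.conjTranspose * ((adjoinZero Q w).conjTranspose * adjoinZero Q w) * V := by
        rw [adjoinZero_isometry, Matrix.mul_one]
    _ = (adjoinZero Q w * V).conjTranspose * (adjoinZero Q w * V) := by
        rw [Matrix.conjTranspose_mul]; simp only [Matrix.mul_assoc]
    _ = 1 := by
        rw [← hc, Matrix.conjTranspose_mul, Matrix.mul_assoc, ← Matrix.mul_assoc _ (circuitOp l),
          circuitOp_conjTranspose_mul, Matrix.one_mul, adjoinZero_isometry]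

theorem Impl.mem_unitary {N : ℕ} {V : Op Q} (h : Impl N V) :
    V ∈ Matrix.unitaryGroup (Basis Q) ℂ := by
  rw [Matrix.mem_unitaryGroup_iff', Matrix.star_eq_conjTranspose]
  exact h.isometry

theorem Impl.mul_conjTranspose {N : ℕ} {V : Op Q} (h : Impl N V) : V * V.conjTranspose = 1 :=
  mul_eq_one_comm.1 h.isometry

theorem Impl.conjTranspose {N : ℕ} {V : Op Q} (h : Impl N V) : Impl N V.conjTranspose := by
  have hV := h.mul_conjTranspose
  obtain ⟨w, i1, i2, l, hl, hc⟩ := h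
  refine ⟨w, i1, i2, circuitInv l, by simpa [circuitInv], ?_⟩
  rw [circuitOp_inv]
  unfold Carries at *
  -- Insert `V * V.conjTranspose = 1`, move the circuit through `adjoinZero`, and cancel it against
  -- its inverse.
  calc (circuitOp l).conjTranspose * adjoinZero Q w
      = (circuitOp l).conjTranspose * (adjoinZero Q w * V) * V.conjTranspose := by
        rw [Matrix.mul_assoc, Matrix.mul_assoc, hV, Matrix.mul_one]
    _ = adjoinZero Q w * V.conjTranspose := by
        rw [← hc, ← Matrix.mul_assoc, circuitOp_conjTranspose_mul, Matrix.one_mul]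

theorem impl_gate (g : Gate Q) : Impl 1 g.op :=
  ⟨Empty, inferInstance, inferInstance, [g.map Function.Embedding.inl], by simp, by
    rw [circuitOp, circuitOp, Matrix.one_mul, Gate.op_map]
    exact carries_onWires_inl _⟩

/-- Work qubits of an implemented operator may be used as work qubits. -/
theorem Impl.descend {N : ℕ} {T : Op (Q ⊕ w)} {V : Op Q} (h : Impl N T) (hT : Carries T V) :
    Impl N V := by
  obtain ⟨w', i1, i2, l, hl, hc⟩ := h
  refine ⟨w ⊕ w', inferInstance, inferInstance,
    l.map (Gate.map (Equiv.sumAssoc Q w w').toEmbedding), by simpa, ?_⟩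
  rw [circuitOp_map]
  rw [carries_iff] at hT hc ⊢
  intro x y z
  have hcomp : ∀ (a : Basis Q) (b : Basis (w ⊕ w')),
      (Sum.elim a b : Basis (Q ⊕ (w ⊕ w'))) ∘ (Equiv.sumAssoc Q w w').toEmbedding =
        Sum.elim (Sum.elim a (b ∘ Sum.inl)) (b ∘ Sum.inr) := by
    intro a b; funext v; rcases v with (v | v) | v <;> rfl
  rw [onWires_apply_of]
  · rw [hcomp, hcomp]
    have h1 : ((0 : Basis (w ⊕ w')) ∘ Sum.inl) = 0 := rfl
    have h2 : ((0 : Basis (w ⊕ w')) ∘ Sum.inr) = 0 := rfl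
    rw [h1, h2, hc, hT]
    have : z = 0 ↔ (z ∘ Sum.inr = 0 ∧ z ∘ Sum.inl = 0) := by
      constructor
      · rintro rfl; exact ⟨rfl, rfl⟩
      · rintro ⟨ha, hb⟩
        rw [← Sum.elim_comp_inl_inr z, ha, hb]; funext v; cases v <;> rfl
    by_cases ha : z ∘ Sum.inr = 0 <;> by_cases hb : z ∘ Sum.inl = 0 <;> simp [this, ha, hb]
  · intro v hv
    exact absurd ⟨(Equiv.sumAssoc Q w w').symm v, by simp⟩ hv

end Impl

end QuFEM
end

noncomputable section
namespace QuFEM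

/-! ### Classical reversible computations -/

section Classical

variable {Q R w κ : Type} [Fintype Q] [DecidableEq Q] [Fintype R] [DecidableEq R]
  [Fintype w] [DecidableEq w] [Fintype κ] [DecidableEq κ]

/-- The operator which maps the basis state `y` to the basis state `φ y`. -/
def permOp (φ : Basis Q → Basis Q) : Op Q := fun x y => if x = φ y then 1 else 0

theorem permOp_ket (φ : Basis Q → Basis Q) (y : Basis Q) :
    (permOp φ).mulVec (ket y) = ket (φ y) := by
  ext x; rw [mulVec_ket, ket_apply, permOp]

theorem eq_permOp {V : Op Q} {φ : Basis Q → Basis Q}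
    (h : ∀ y, V.mulVec (ket y) = ket (φ y)) : V = permOp φ :=
  op_ext_ket fun y => by rw [h, permOp_ket]

theorem permOp_comp (φ ψ : Basis Q → Basis Q) : permOp (φ ∘ ψ) = permOp φ * permOp ψ := by
  symm
  apply eq_permOp
  intro y
  rw [← Matrix.mulVec_mulVec, permOp_ket, permOp_ket]; rfl

theorem Impl.permOp_comp {N N' : ℕ} {φ ψ : Basis Q → Basis Q} (h : Impl N (permOp φ))
    (h' : Impl N' (permOp ψ)) : Impl (N + N') (permOp (φ ∘ ψ)) := by
  rw [QuFEM.permOp_comp]; exact h.mul h'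

theorem patch_eq_update (q : κ ↪ Q) (y : Basis Q) (t : Basis κ) (k : κ)
    (h : ∀ j, j ≠ k → t j = y (q j)) : patch q y t = Function.update y (q k) (t k) := by
  funext v
  by_cases hv : v ∈ Set.range q
  · obtain ⟨j, rfl⟩ := hv
    rw [patch_apply]
    by_cases hj : j = k
    · subst hj; simp
    · rw [Function.update_of_ne (fun h' => hj (q.injective h')), h j hj]
  · rw [patch_apply_of_notMem q y t hv, Function.update_of_ne]
    rintro rfl; exact hv ⟨k, rfl⟩

theorem impl_cnot (u v : Q) (h : u ≠ v) :
    Impl 1 (permOp fun y : Basis Q => Function.update y v (y v + y u)) := by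
  have hinj : Function.Injective ![u, v] := by
    intro i j; fin_cases i <;> fin_cases j <;> simp [h, h.symm]
  have := impl_gate (Gate.cnot (⟨![u, v], hinj⟩ : Fin 2 ↪ Q))
  convert this using 1
  symm
  apply eq_permOp
  intro y
  rw [Gate.op, onWires_mulVec_ket_of _ _ _ _ (cnotOp_ket _), patch_eq_update _ _ _ 1]
  · rfl
  · intro j hj; fin_cases j
    · rfl
    · exact absurd rfl hj

theorem impl_toffoli (u u' v : Q) (h : u ≠ v) (h' : u' ≠ v) (h'' : u ≠ u') :
    Impl 1 (permOp fun y : Basis Q => Function.update y v (y v + y u * y u')) := by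
  have hinj : Function.Injective ![u, u', v] := by
    intro i j; fin_cases i <;> fin_cases j <;> simp [h, h.symm, h', h'.symm, h'', h''.symm]
  have := impl_gate (Gate.toffoli (⟨![u, u', v], hinj⟩ : Fin 3 ↪ Q))
  convert this using 1
  symm
  apply eq_permOp
  intro y
  rw [Gate.op, onWires_mulVec_ket_of _ _ _ _ (toffoliOp_ket _), patch_eq_update _ _ _ 2]
  · rfl
  · intro j hj; fin_cases j
    · rfl
    · rfl
    · exact absurd rfl hj

/-- The wire `v`, as an embedding. -/
def wire (v : Q) : Fin 1 ↪ Q := ⟨fun _ => v, fun _ _ _ => Subsingleton.elim _ _⟩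

theorem impl_single (v : Q) (u : Matrix (Fin 2) (Fin 2) ℂ)
    (hu : u ∈ Matrix.unitaryGroup (Fin 2) ℂ) : Impl 1 (onWires (wire v) (singleOp u)) :=
  impl_gate (Gate.single (wire v) ⟨u, hu⟩)

theorem single_mulVec_ket (v : Q) (u : Matrix (Fin 2) (Fin 2) ℂ) (y : Basis Q) :
    (onWires (wire v) (singleOp u)).mulVec (ket y) =
      ∑ b, u b (y v) • ket (Function.update y v b) := by
  rw [onWires_mulVec_ket]
  refine Fintype.sum_equiv (Equiv.funUnique (Fin 1) (Fin 2)) _ _ (fun t => ?_)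
  rw [patch_eq_update (wire v) y t 0 (fun j hj => absurd (Subsingleton.elim j 0) hj)]
  rfl

theorem impl_not (v : Q) : Impl 1 (permOp fun y : Basis Q => Function.update y v (y v + 1)) := by
  have hu : !![(0 : ℂ), 1; 1, 0] ∈ Matrix.unitaryGroup (Fin 2) ℂ := by
    rw [Matrix.mem_unitaryGroup_iff]
    ext i j; fin_cases i <;> fin_cases j <;> simp [Matrix.mul_apply, Fin.sum_univ_two]
  convert impl_single v _ hu using 1
  symm
  apply eq_permOp
  intro y
  rw [single_mulVec_ket, Fin.sum_univ_two]
  have : ∀ b : Fin 2, b = 0 ∨ b = 1 := by decide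
  rcases this (y v) with h | h <;> simp [h]

/-- Multiplication of each basis state by the sign `(-1) ^ f`. -/
def signOp (f : Basis Q → Fin 2) : Op Q := Matrix.diagonal fun x => (-1 : ℂ) ^ (f x : ℕ)

theorem signOp_ket (f : Basis Q → Fin 2) (y : Basis Q) :
    (signOp f).mulVec (ket y) = (-1 : ℂ) ^ (f y : ℕ) • ket y := by
  ext x
  rw [mulVec_ket, Pi.smul_apply, ket_apply, signOp, Matrix.diagonal_apply]
  by_cases h : x = y
  · subst h; simp
  · simp [h]

theorem impl_sign_wire (v : Q) : Impl 1 (signOp fun y : Basis Q => y v) := by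
  have hu : !![(1 : ℂ), 0; 0, -1] ∈ Matrix.unitaryGroup (Fin 2) ℂ := by
    rw [Matrix.mem_unitaryGroup_iff]
    ext i j; fin_cases i <;> fin_cases j <;> simp [Matrix.mul_apply, Fin.sum_univ_two]
  convert impl_single v _ hu using 1
  apply op_ext_ket
  intro y
  rw [single_mulVec_ket, Fin.sum_univ_two, signOp_ket]
  have : ∀ b : Fin 2, b = 0 ∨ b = 1 := by decide
  have hy : Function.update y v (y v) = y := Function.update_eq_self v y
  rcases this (y v) with h | h <;> rw [h] at hy <;> simp [h, hy]

/-- The functions in `S` can be computed simultaneously, on the input wires or on work qubits which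
are initially zero, by `N` gates which do not change the input. -/
def Computes (N : ℕ) (S : Set (Basis Q → Fin 2)) : Prop :=
  ∃ (w : Type) (_ : Fintype w) (_ : DecidableEq w) (V : Op (Q ⊕ w)) (g : Basis Q → Basis w),
    Impl N V ∧ (∀ x, V.mulVec (ket (Sum.elim x 0)) = ket (Sum.elim x (g x))) ∧
    ∀ f ∈ S, ∃ v, ∀ x, Sum.elim x (g x) v = f x

theorem Computes.mono {N N' : ℕ} {S S' : Set (Basis Q → Fin 2)} (h : Computes N S)
    (hN : N ≤ N') (hS : S' ⊆ S) : Computes N' S' := by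
  obtain ⟨w, i1, i2, V, g, hV, hg, hf⟩ := h
  exact ⟨w, i1, i2, V, g, hV.mono hN, hg, fun f hf' => hf f (hS hf')⟩

theorem computes_base : Computes 0 {f : Basis Q → Fin 2 | ∃ v, f = fun x => x v} := by
  refine ⟨Empty, inferInstance, inferInstance, 1, fun _ => 0, impl_one, ?_, ?_⟩
  · intro x; rw [Matrix.one_mulVec]
  · rintro f ⟨v, rfl⟩; exact ⟨Sum.inl v, fun x => rfl⟩

/-- Common frame for one new function: either it already lies on an available wire, or a permutation
of basis states writes it on one fresh zero wire. The hypothesis quantifies over every layout `w`,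
`g`, because only the set of available functions is remembered, not where they are stored. -/
theorem Computes.step {N k : ℕ} {S : Set (Basis Q → Fin 2)} (h : Computes N S)
    (F : Basis Q → Fin 2)
    (step : ∀ (w : Type) [Fintype w] [DecidableEq w] (g : Basis Q → Basis w),
      (∀ f ∈ S, ∃ v, ∀ x, Sum.elim x (g x) v = f x) →
      (∃ v, ∀ x, Sum.elim x (g x) v = F x) ∨
      ∃ φ : Basis (Q ⊕ (w ⊕ Unit)) → Basis (Q ⊕ (w ⊕ Unit)), Impl k (permOp φ) ∧
        ∀ x, φ (Sum.elim x (Sum.elim (g x) 0)) =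
          Sum.elim x (Sum.elim (g x) fun _ => F x)) :
    Computes (N + k) (insert F S) := by
  obtain ⟨w, i1, i2, V, g, hV, hg, hf⟩ := h
  rcases step w g hf with ⟨v, hv⟩ | ⟨φ, hφ, hφ'⟩
  · refine ⟨w, i1, i2, V, g, hV.mono (by omega), hg, ?_⟩
    rintro f (rfl | hf')
    · exact ⟨v, hv⟩
    · exact hf f hf'
  · let q : Q ⊕ w ↪ Q ⊕ (w ⊕ Unit) := (Function.Embedding.refl Q).sumMap Function.Embedding.inl
    refine ⟨w ⊕ Unit, inferInstance, inferInstance, permOp φ * onWires q V,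
      fun x => Sum.elim (g x) fun _ => F x, (hφ.mul (hV.onWires q)).mono (by omega), ?_, ?_⟩
    · intro x
      have hc : (Sum.elim x 0 : Basis (Q ⊕ (w ⊕ Unit))) ∘ q = Sum.elim x 0 := by
        funext v; rcases v with v | v <;> rfl
      have hp : patch q (Sum.elim x 0) (Sum.elim x (g x)) =
          Sum.elim x (Sum.elim (g x) 0) := by
        funext v
        rcases v with v | v | v
        · exact patch_apply q _ _ (Sum.inl v)
        · exact patch_apply q _ _ (Sum.inr v)
        · rw [patch_apply_of_notMem]
          · rfl
          · rintro ⟨v | v, hv⟩ <;> cases hv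
      rw [← Matrix.mulVec_mulVec, onWires_mulVec_ket_of q V _ _ (by rw [hc]; exact hg x), hp,
        permOp_ket, hφ']
    · rintro f (rfl | hf')
      · exact ⟨Sum.inr (Sum.inr ()), fun x => rfl⟩
      · obtain ⟨v, hv⟩ := hf f hf'
        refine ⟨q v, fun x => ?_⟩
        rw [← hv x]
        rcases v with v | v <;> rfl

theorem elim_update_unit (x : Basis Q) (z : Basis w) (b : Fin 2) :
    Function.update (Sum.elim x (Sum.elim z (0 : Basis Unit))) (Sum.inr (Sum.inr ())) b =
      Sum.elim x (Sum.elim z fun _ => b) := by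
  funext v
  rcases v with v | v | v
  · rw [Function.update_of_ne (by simp)]; rfl
  · rw [Function.update_of_ne (by simp)]; rfl
  · cases v; simp

theorem elim_elim_sumMap (x : Basis Q) (z : Basis w) (v : Q ⊕ w) :
    (Sum.elim x (Sum.elim z (0 : Basis Unit)) : Basis (Q ⊕ (w ⊕ Unit)))
      (Sum.map id Sum.inl v) = Sum.elim x z v := by
  rcases v with v | v <;> rfl

theorem sumMap_inl_ne (v : Q ⊕ w) :
    (Sum.map id Sum.inl v : Q ⊕ (w ⊕ Unit)) ≠ Sum.inr (Sum.inr ()) := by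
  rcases v with v | v <;> simp

theorem Computes.one {N : ℕ} {S : Set (Basis Q → Fin 2)} (h : Computes N S) :
    Computes (N + 1) (insert (fun _ => 1) S) := by
  refine h.step _ fun w _ _ g hf => Or.inr ⟨_, impl_not (Sum.inr (Sum.inr ())), fun x => ?_⟩
  rw [elim_update_unit]; rfl

theorem Computes.add {N : ℕ} {S : Set (Basis Q → Fin 2)} (h : Computes N S)
    {f f' : Basis Q → Fin 2} (hf : f ∈ S) (hf' : f' ∈ S) :
    Computes (N + 2) (insert (fun x => f x + f' x) S) := by
  refine h.step _ fun w _ _ g hS => Or.inr ?_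
  obtain ⟨v, hv⟩ := hS f hf
  obtain ⟨v', hv'⟩ := hS f' hf'
  refine ⟨_, (impl_cnot (Sum.map id Sum.inl v') _ (sumMap_inl_ne v')).permOp_comp
    (impl_cnot (Sum.map id Sum.inl v) _ (sumMap_inl_ne v)), fun x => ?_⟩
  rw [Function.comp_apply, elim_elim_sumMap, elim_update_unit]
  have h1 : (Sum.elim x (Sum.elim (g x) fun _ => (0 : Fin 2) + f x) : Basis (Q ⊕ (w ⊕ Unit)))
      (Sum.map id Sum.inl v') = f' x := by
    rw [← hv' x]; rcases v' with v' | v' <;> rfl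
  have h2 : (Sum.elim x (Sum.elim (g x) (0 : Basis Unit)) : Basis (Q ⊕ (w ⊕ Unit)))
      (Sum.inr (Sum.inr ())) = 0 := rfl
  rw [h2, hv x, h1]
  rw [← elim_update_unit x (g x) (0 + f x), Function.update_idem, Function.update_self,
    elim_update_unit, zero_add]

/-- A Toffoli gate needs two distinct controls. If both factors sit on the same wire their product
is already there, since bits are idempotent. -/
theorem Computes.mul {N : ℕ} {S : Set (Basis Q → Fin 2)} (h : Computes N S)
    {f f' : Basis Q → Fin 2} (hf : f ∈ S) (hf' : f' ∈ S) :
    Computes (N + 1) (insert (fun x => f x * f' x) S) := by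
  refine h.step _ fun w _ _ g hS => ?_
  obtain ⟨v, hv⟩ := hS f hf
  obtain ⟨v', hv'⟩ := hS f' hf'
  by_cases hvv : v = v'
  · left
    subst hvv
    refine ⟨v, fun x => ?_⟩
    rw [← hv x, ← hv' x]
    generalize Sum.elim x (g x) v = b
    revert b; decide
  · right
    refine ⟨_, impl_toffoli (Sum.map id Sum.inl v) (Sum.map id Sum.inl v') _ (sumMap_inl_ne v)
      (sumMap_inl_ne v') ?_, fun x => ?_⟩
    · intro h'
      exact hvv (Function.Injective.sumMap Function.injective_id Sum.inl_injective h')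
    · rw [elim_elim_sumMap, elim_elim_sumMap, elim_update_unit, hv, hv']
      simp

/-- `h` can be computed by `c` further gates once the functions in `S` are available. -/
def Der (S : Set (Basis Q → Fin 2)) (c : ℕ) (h : Basis Q → Fin 2) : Prop :=
  ∀ N S', S ⊆ S' → Computes N S' → Computes (N + c) (insert h S')

theorem Der.mono {S S' : Set (Basis Q → Fin 2)} {c c' : ℕ} {h : Basis Q → Fin 2}
    (hd : Der S c h) (hS : S ⊆ S') (hc : c ≤ c') : Der S' c' h :=
  fun N T hT hN => (hd N T (hS.trans hT) hN).mono (by omega) le_rfl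

theorem der_mem {S : Set (Basis Q → Fin 2)} {h : Basis Q → Fin 2} (hh : h ∈ S) : Der S 0 h :=
  fun N S' hS hN => by rwa [Set.insert_eq_of_mem (hS hh)]

theorem der_one (S : Set (Basis Q → Fin 2)) : Der S 1 (fun _ => 1) := fun _ _ _ hN => hN.one

theorem Der.add {S : Set (Basis Q → Fin 2)} {c c' : ℕ} {h h' : Basis Q → Fin 2}
    (hd : Der S c h) (hd' : Der S c' h') : Der S (c + c' + 2) (fun x => h x + h' x) := by
  intro N S' hS hN
  have h1 := hd' _ _ (hS.trans (Set.subset_insert _ _)) (hd N S' hS hN)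
  have h2 := h1.add (f := h) (f' := h') (by simp) (by simp)
  exact h2.mono (by omega) (Set.insert_subset_insert
    ((Set.subset_insert _ _).trans (Set.subset_insert _ _)))

theorem Der.mul {S : Set (Basis Q → Fin 2)} {c c' : ℕ} {h h' : Basis Q → Fin 2}
    (hd : Der S c h) (hd' : Der S c' h') : Der S (c + c' + 1) (fun x => h x * h' x) := by
  intro N S' hS hN
  have h1 := hd' _ _ (hS.trans (Set.subset_insert _ _)) (hd N S' hS hN)
  have h2 := h1.mul (f := h) (f' := h') (by simp) (by simp)
  exact h2.mono (by omega) (Set.insert_subset_insert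
    ((Set.subset_insert _ _).trans (Set.subset_insert _ _)))

theorem Computes.family {ι : Type*} [DecidableEq ι] {N c : ℕ} {S : Set (Basis Q → Fin 2)}
    (h : Computes N S)
    (T : Finset ι) (F : ι → Basis Q → Fin 2) (hF : ∀ a ∈ T, Der S c (F a)) :
    Computes (N + T.card * c) (S ∪ F '' T) := by
  induction T using Finset.induction_on with
  | empty => simpa using h
  | insert a T ha ih =>
    have h1 := ih fun b hb => hF b (Finset.mem_insert_of_mem hb)
    have h2 := hF a (Finset.mem_insert_self a T) _ _ Set.subset_union_left h1
    refine h2.mono ?_ ?_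
    · rw [Finset.card_insert_of_notMem ha]; ring_nf; rfl
    · rw [Finset.coe_insert, Set.image_insert_eq, Set.union_insert]

theorem der_sum {ι : Type*} [DecidableEq ι] {c : ℕ} {S : Set (Basis Q → Fin 2)}
    (T : Finset ι) (F : ι → Basis Q → Fin 2) (hF : ∀ a ∈ T, Der S c (F a)) :
    Der S (T.card * (c + 2) + 4) (fun x => ∑ a ∈ T, F a x) := by
  induction T using Finset.induction_on with
  | empty =>
    have h := (der_one S).add (der_one S)
    simpa using h
  | insert a T ha ih =>
    have h1 := ih fun b hb => hF b (Finset.mem_insert_of_mem hb)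
    have h2 := (hF a (Finset.mem_insert_self a T)).add h1
    simp only [Finset.sum_insert ha]
    refine h2.mono le_rfl ?_
    rw [Finset.card_insert_of_notMem ha]; ring_nf; omega

theorem der_prod {ι : Type*} [DecidableEq ι] {c : ℕ} {S : Set (Basis Q → Fin 2)}
    (T : Finset ι) (F : ι → Basis Q → Fin 2) (hF : ∀ a ∈ T, Der S c (F a)) :
    Der S (T.card * (c + 1) + 1) (fun x => if ∀ a ∈ T, F a x = 1 then 1 else 0) := by
  induction T using Finset.induction_on with
  | empty => simpa using der_one S
  | insert a T ha ih =>
    have h1 := ih fun b hb => hF b (Finset.mem_insert_of_mem hb)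
    have h2 := (hF a (Finset.mem_insert_self a T)).mul h1
    have h3 : (fun x => F a x * (if ∀ a ∈ T, F a x = 1 then (1 : Fin 2) else 0)) =
        fun x => if ∀ b ∈ insert a T, F b x = 1 then 1 else 0 := by
      funext x
      have : ∀ b : Fin 2, b = 0 ∨ b = 1 := by decide
      simp only [Finset.forall_mem_insert]
      rcases this (F a x) with h | h <;> simp [h]
    rw [h3] at h2
    refine h2.mono le_rfl ?_
    rw [Finset.card_insert_of_notMem ha]; ring_nf; omega

theorem Der.not {S : Set (Basis Q → Fin 2)} {c : ℕ} {h : Basis Q → Fin 2}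
    (hd : Der S c h) : Der S (c + 3) (fun x => h x + 1) :=
  (hd.add (der_one S)).mono le_rfl (by omega)

/-- The operator which multiplies by the sign `(-1) ^ f` for a computable function `f`. -/
theorem Computes.impl_signOp {N : ℕ} {S : Set (Basis Q → Fin 2)} (h : Computes N S)
    {f : Basis Q → Fin 2} (hf : f ∈ S) : Impl (2 * N + 1) (signOp f) := by
  obtain ⟨w, i1, i2, V, g, hV, hg, hS⟩ := h
  obtain ⟨v, hv⟩ := hS f hf
  -- Compute, change the sign on the wire that holds `f`, uncompute. On a basis state the sign is a
  -- scalar, so it survives the uncomputation that clears the work qubits.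
  have h1 : Impl (2 * N + 1) (V.conjTranspose * (signOp (fun y => y v)) * V) :=
    ((hV.conjTranspose.mul (impl_sign_wire v)).mul hV).mono (by omega)
  refine h1.descend (carries_of_ket id (fun y => (-1 : ℂ) ^ (f y : ℕ)) (fun y => ?_)
    (fun y => signOp_ket f y))
  rw [← Matrix.mulVec_mulVec, ← Matrix.mulVec_mulVec, hg, signOp_ket, hv, Matrix.mulVec_smul,
    ← hg, Matrix.mulVec_mulVec, hV.isometry, Matrix.one_mulVec]
  rfl

/-- A layer of CNOT gates. -/
theorem impl_cnots (src : κ → Q) (dst : κ ↪ Q) (h : ∀ k k', src k ≠ dst k') :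
    Impl (Fintype.card κ) (permOp fun y => patch dst y fun k => y (dst k) + y (src k)) := by
  have key : ∀ T : Finset κ, Impl T.card (permOp fun y =>
      patch dst y fun k => if k ∈ T then y (dst k) + y (src k) else y (dst k)) := by
    intro T
    induction T using Finset.induction_on with
    | empty =>
      have : (permOp fun y : Basis Q => patch dst y fun k => if k ∈ (∅ : Finset κ) then
          y (dst k) + y (src k) else y (dst k)) = 1 := by
        symm
        apply eq_permOp
        intro y
        simp only [Finset.notMem_empty, if_false, Matrix.one_mulVec]
        congr 1; exact (patch_self dst y).symm
      rw [this]; exact impl_one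
    | insert a T ha ih =>
      rw [Finset.card_insert_of_notMem ha, add_comm]
      have := (impl_cnot (src a) (dst a) (h a a)).permOp_comp ih
      convert this using 2
      funext y v
      rw [Function.comp_apply]
      have hsrc : ∀ t, patch dst y t (src a) = y (src a) := fun t =>
        patch_apply_of_notMem _ _ _ (by rintro ⟨k, hk⟩; exact h a k hk.symm)
      rw [hsrc, patch_apply, if_neg ha]
      by_cases hv : v ∈ Set.range dst
      · obtain ⟨k, rfl⟩ := hv
        rw [patch_apply]
        by_cases hk : k = a
        · subst hk; simp
        · rw [Function.update_of_ne (fun h' => hk (dst.injective h')), patch_apply]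
          simp [hk]
      · rw [patch_apply_of_notMem _ _ _ hv, Function.update_of_ne, patch_apply_of_notMem _ _ _ hv]
        rintro rfl; exact hv ⟨a, rfl⟩
  have := key Finset.univ
  simpa using this

/-- Computable functions can be added to a register. -/
theorem Computes.impl_xorInto {N : ℕ} {S : Set (Basis Q → Fin 2)} (h : Computes N S)
    (F : κ → Basis Q → Fin 2) (hF : ∀ k, F k ∈ S) :
    Impl (2 * N + Fintype.card κ) (permOp fun y : Basis (Q ⊕ κ) =>
      Sum.elim (y ∘ Sum.inl) fun k => y (Sum.inr k) + F k (y ∘ Sum.inl)) := by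
  obtain ⟨w, i1, i2, V, g, hV, hg, hS⟩ := h
  choose v hv using fun k => hS (F k) (hF k)
  let q : Q ⊕ w ↪ (Q ⊕ κ) ⊕ w := Function.Embedding.inl.sumMap (Function.Embedding.refl w)
  let dst : κ ↪ (Q ⊕ κ) ⊕ w := Function.Embedding.inr.trans Function.Embedding.inl
  have hne : ∀ k k', q (v k) ≠ dst k' := by
    intro k k'
    rcases v k with u | u <;> simp [q, dst]
  -- Compute, copy by CNOT gates, uncompute: the copy leaves input and work qubits unchanged, so the
  -- work qubits return to zero.
  have h1 := ((hV.onWires q).conjTranspose.mul (impl_cnots (fun k => q (v k)) dst hne)).mul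
    (hV.onWires q)
  have hq : ∀ (y : Basis (Q ⊕ κ)) (z : Basis w), (Sum.elim y z : Basis ((Q ⊕ κ) ⊕ w)) ∘ q =
      Sum.elim (y ∘ Sum.inl) z := by
    intro y z; funext u; rcases u with u | u <;> rfl
  have hp : ∀ (y : Basis (Q ⊕ κ)) (z z' : Basis w),
      patch q (Sum.elim y z) (Sum.elim (y ∘ Sum.inl) z') = Sum.elim y z' := by
    intro y z z'
    funext u
    rcases u with (u | u) | u
    · exact patch_apply q _ _ (Sum.inl u)
    · rw [patch_apply_of_notMem]
      · rfl
      · rintro ⟨u' | u', hu⟩ <;> cases hu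
    · exact patch_apply q _ _ (Sum.inr u)
  have hup : ∀ y : Basis (Q ⊕ κ), (onWires q V).mulVec (ket (Sum.elim y 0)) =
      ket (Sum.elim y (g (y ∘ Sum.inl))) := by
    intro y
    rw [onWires_mulVec_ket_of q V _ (Sum.elim (y ∘ Sum.inl) (g (y ∘ Sum.inl)))
      (by rw [hq]; exact hg _), hp]
  refine (h1.mono (by omega)).descend (carries_of_ket _ (fun _ => 1) (fun y => ?_)
    (fun y => by rw [permOp_ket, one_smul]))
  set y' : Basis (Q ⊕ κ) := Sum.elim (y ∘ Sum.inl) fun k => y (Sum.inr k) + F k (y ∘ Sum.inl)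
    with hy'
  have hy'' : y' ∘ Sum.inl = y ∘ Sum.inl := rfl
  rw [one_smul, ← Matrix.mulVec_mulVec, ← Matrix.mulVec_mulVec, hup, permOp_ket]
  have : patch dst (Sum.elim y (g (y ∘ Sum.inl))) (fun k =>
      (Sum.elim y (g (y ∘ Sum.inl)) : Basis ((Q ⊕ κ) ⊕ w)) (dst k) +
      (Sum.elim y (g (y ∘ Sum.inl)) : Basis ((Q ⊕ κ) ⊕ w)) (q (v k))) =
      Sum.elim y' (g (y' ∘ Sum.inl)) := by
    funext u
    rcases u with (u | u) | u
    · rw [patch_apply_of_notMem]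
      · rfl
      · rintro ⟨k, hk⟩; cases hk
    · refine (patch_apply dst _ _ u).trans ?_
      have h3 : (Sum.elim y (g (y ∘ Sum.inl)) : Basis ((Q ⊕ κ) ⊕ w)) (q (v u)) =
          F u (y ∘ Sum.inl) := by
        rw [← hv u, ← hq]; rfl
      rw [h3]; rfl
    · rw [patch_apply_of_notMem]
      · rfl
      · rintro ⟨k, hk⟩; cases hk
  rw [this, ← hup, Matrix.mulVec_mulVec, (hV.onWires q).isometry, Matrix.one_mulVec]

/-- A permutation which changes only the wires `d` can be performed in place if the new values, and
those of the inverse permutation, are computable. -/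
theorem impl_inPlace {N N' : ℕ} {S S' : Set (Basis Q → Fin 2)} (h : Computes N S)
    (h' : Computes N' S') (d : κ ↪ Q) (F F' : κ → Basis Q → Fin 2) (hF : ∀ k, F k ∈ S)
    (hF' : ∀ k, F' k ∈ S') (hinv : ∀ x k, F' k (patch d x fun j => F j x) = x (d k)) :
    Impl (2 * N + 2 * N' + 5 * Fintype.card κ) (permOp fun x => patch d x fun k => F k x) := by
  let e : κ ↪ Q ⊕ κ := d.trans Function.Embedding.inl
  have hs1 : Impl (Fintype.card κ) (permOp fun y : Basis (Q ⊕ κ) =>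
      patch e y fun k => y (e k) + y (Sum.inr k)) :=
    impl_cnots (fun k => Sum.inr k) e (fun k k' hk => by cases hk)
  have hs2 : Impl (Fintype.card κ) (permOp fun y : Basis (Q ⊕ κ) =>
      patch Function.Embedding.inr y fun k => y (Sum.inr k) + y (e k)) :=
    impl_cnots (fun k => e k) Function.Embedding.inr (fun k k' hk => by cases hk)
  -- The new values are computed into a fresh register, and three CNOT layers exchange it with the
  -- wires `d`. The register then holds the old values, which `F'` recomputes from the new state, so
  -- adding `F'` clears it.
  have h1 := (h'.impl_xorInto F' hF').permOp_comp
    ((hs1.permOp_comp (hs2.permOp_comp hs1)).permOp_comp (h.impl_xorInto F hF))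
  refine (h1.mono (by omega)).descend (carries_of_ket (fun x => patch d x fun k => F k x)
    (fun _ => 1) (fun y => ?_) (fun y => by rw [permOp_ket, one_smul]))
  rw [one_smul, permOp_ket]
  congr 1
  have hpi : ∀ (x : Basis Q) (r t : Basis κ), patch e (Sum.elim x r) t =
      Sum.elim (patch d x t) r := by
    intro x r t
    funext u
    rcases u with u | u
    · by_cases hu : u ∈ Set.range d
      · obtain ⟨k, rfl⟩ := hu
        refine (patch_apply e _ _ k).trans ?_
        simp
      · rw [patch_apply_of_notMem]
        · rw [Sum.elim_inl, Sum.elim_inl, patch_apply_of_notMem _ _ _ hu]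
        · rintro ⟨k, hk⟩; exact hu ⟨k, Sum.inl_injective hk⟩
    · rw [patch_apply_of_notMem]
      · rfl
      · rintro ⟨k, hk⟩; cases hk
  have hpr : ∀ (x : Basis Q) (r t : Basis κ), patch Function.Embedding.inr (Sum.elim x r) t =
      Sum.elim x t := by
    intro x r t
    funext u
    rcases u with u | u
    · rw [patch_apply_of_notMem]
      · rfl
      · rintro ⟨k, hk⟩; cases hk
    · exact patch_apply (Function.Embedding.inr : κ ↪ Q ⊕ κ) _ _ u
  have hpp : ∀ (x : Basis Q) (t t' : Basis κ), patch d (patch d x t) t' = patch d x t' := by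
    intro x t t'
    funext u
    by_cases hu : u ∈ Set.range d
    · obtain ⟨k, rfl⟩ := hu; simp
    · simp only [patch_apply_of_notMem _ _ _ hu]
  have hev : ∀ (x : Basis Q) (r : Basis κ) k, (Sum.elim x r : Basis (Q ⊕ κ)) (e k) = x (d k) :=
    fun _ _ _ => rfl
  simp only [Function.comp_apply, Sum.elim_comp_inl, Sum.elim_inr, Pi.zero_apply, zero_add]
  simp only [hpi, hpr, hev, Sum.elim_inr, patch_apply, hpp, Sum.elim_comp_inl]
  have c1 : ∀ a b : Fin 2, a + b + a = b := by decide
  have c2 : ∀ a b : Fin 2, b + (a + b) = a := by decide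
  have c3 : ∀ a : Fin 2, a + a = 0 := by decide
  simp only [c1, c2]
  rw [show (fun k => y (d k) + F' k (patch d y fun k => F k y)) = (0 : Basis κ) from by
    funext k; rw [hinv, c3]; rfl]

end Classical

end QuFEM
end

noncomputable section
namespace QuFEM

/-! ### Multiplexed rotations and state preparation -/

section Prep

variable {Q w : Type} [Fintype Q] [DecidableEq Q] [Fintype w] [DecidableEq w]

/-- A plane rotation. -/
def rot (θ : ℝ) : Matrix (Fin 2) (Fin 2) ℂ :=
  !![(Real.cos θ : ℂ), -(Real.sin θ : ℂ); (Real.sin θ : ℂ), (Real.cos θ : ℂ)]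

theorem rot_mul (a b : ℝ) : rot a * rot b = rot (a + b) := by
  ext i j
  fin_cases i <;> fin_cases j <;>
    simp [rot, Matrix.mul_apply, Fin.sum_univ_two, Complex.cos_add, Complex.sin_add] <;> ring

theorem rot_zero : rot 0 = 1 := by
  ext i j
  fin_cases i <;> fin_cases j <;> simp [rot]

theorem rot_mem_unitary (a : ℝ) : rot a ∈ Matrix.unitaryGroup (Fin 2) ℂ := by
  rw [Matrix.mem_unitaryGroup_iff]
  have : star (rot a) = rot (-a) := by
    ext i j
    fin_cases i <;> fin_cases j <;>
      simp [rot, Matrix.star_apply, ← Complex.cos_conj, ← Complex.sin_conj]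
  rw [this, rot_mul, add_neg_cancel, rot_zero]

/-- The rotation of the wire `v` by an angle which depends on the basis state. -/
def muxRot (v : Q) (θ : Basis Q → ℝ) : Op Q :=
  fun x y => if x = Function.update y v (x v) then rot (θ y) (x v) (y v) else 0

theorem muxRot_ket (v : Q) (θ : Basis Q → ℝ) (y : Basis Q) :
    (muxRot v θ).mulVec (ket y) = ∑ b, rot (θ y) b (y v) • ket (Function.update y v b) := by
  ext x
  rw [mulVec_ket, Finset.sum_apply, muxRot]
  simp only [Pi.smul_apply, ket_apply]
  by_cases h : x = Function.update y v (x v)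
  · rw [if_pos h, Finset.sum_eq_single (x v)]
    · rw [if_pos h]; simp
    · intro b _ hb
      rw [if_neg, smul_zero]
      intro h'
      apply hb
      rw [h']; simp
    · simp
  · rw [if_neg h]
    symm
    apply Finset.sum_eq_zero
    intro b _
    rw [if_neg, smul_zero]
    intro h'
    apply h
    rw [h']; simp

/-- Angles add because the angle `θ` of the rotation applied last ignores the rotated wire, so the
earlier rotation cannot change it. -/
theorem muxRot_mul (v : Q) (θ θ' : Basis Q → ℝ)
    (h : ∀ y b, θ (Function.update y v b) = θ y) :
    muxRot v θ * muxRot v θ' = muxRot v (fun y => θ y + θ' y) := by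
  apply op_ext_ket
  intro y
  rw [← Matrix.mulVec_mulVec, muxRot_ket, muxRot_ket, Matrix.mulVec_sum]
  simp only [Matrix.mulVec_smul, muxRot_ket, h, Function.update_self, Function.update_idem,
    Finset.smul_sum, smul_smul]
  rw [Finset.sum_comm]
  refine Finset.sum_congr rfl fun c _ => ?_
  rw [← Finset.sum_smul, ← rot_mul, Matrix.mul_apply]
  congr 1
  exact Finset.sum_congr rfl fun b _ => mul_comm _ _

theorem muxRot_conj (v : Q) (θ : Basis Q → ℝ) (φ : Basis Q → Basis Q) (h1 : ∀ y, φ (φ y) = y)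
    (h2 : ∀ y b, φ (Function.update y v b) = Function.update (φ y) v b)
    (h3 : ∀ y, φ y v = y v) :
    permOp φ * muxRot v θ * permOp φ = muxRot v (θ ∘ φ) := by
  apply op_ext_ket
  intro y
  rw [← Matrix.mulVec_mulVec, ← Matrix.mulVec_mulVec, permOp_ket, muxRot_ket, muxRot_ket,
    Matrix.mulVec_sum]
  simp only [Matrix.mulVec_smul, permOp_ket, h2, h1, h3, Function.comp_apply]

/-- Conjugating a plane rotation by a bit flip reverses its angle, and a CNOT is a flip controlled
by `u`. -/
theorem muxRot_conj_cnot (u v : Q) (huv : u ≠ v) (θ : Basis Q → ℝ)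
    (h : ∀ y b, θ (Function.update y v b) = θ y) :
    permOp (fun y => Function.update y v (y v + y u)) * muxRot v θ *
      permOp (fun y => Function.update y v (y v + y u)) =
    muxRot v (fun y => if y u = 1 then -θ y else θ y) := by
  apply op_ext_ket
  intro y
  rw [← Matrix.mulVec_mulVec, ← Matrix.mulVec_mulVec, permOp_ket, muxRot_ket, muxRot_ket,
    Matrix.mulVec_sum]
  simp only [Matrix.mulVec_smul, permOp_ket, h, Function.update_self, Function.update_idem,
    Function.update_of_ne huv, Fin.sum_univ_two]
  have hb : ∀ b : Fin 2, b = 0 ∨ b = 1 := by decide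
  have h11 : (1 : Fin 2) + 1 = 0 := rfl
  rcases hb (y u) with h0 | h0 <;> rcases hb (y v) with h1 | h1 <;>
    simp only [h0, h1, rot, Matrix.of_apply, Matrix.cons_val', Matrix.cons_val_zero, Matrix.cons_val_one,
      Matrix.cons_val_fin_one, add_zero, zero_add, zero_ne_one, if_true, if_false, Real.cos_neg,
      Real.sin_neg, Complex.ofReal_neg, neg_neg, neg_smul, h11] <;> abel

theorem carries_muxRot (v : Q) (θ : Basis Q → ℝ) (Θ : Basis (Q ⊕ w) → ℝ)
    (h : ∀ y, Θ (Sum.elim y 0) = θ y) : Carries (muxRot (Sum.inl v) Θ) (muxRot v θ) := by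
  rw [carries_iff]
  intro x y z
  have : (Sum.elim x z : Basis (Q ⊕ w)) = Function.update (Sum.elim y 0) (Sum.inl v) (x v) ↔
      x = Function.update y v (x v) ∧ z = 0 := by
    rw [Sum.update_elim_inl]
    constructor
    · intro h'
      exact ⟨congrArg (· ∘ Sum.inl) h', congrArg (· ∘ Sum.inr) h'⟩
    · rintro ⟨h1, h2⟩; rw [← h1, h2]
  rw [muxRot, muxRot]
  simp only [Sum.elim_inl, h, this]
  by_cases hz : z = 0
  · rw [if_pos hz]
    exact if_congr (and_iff_left hz) rfl rfl
  · rw [if_neg hz, if_neg fun h' => hz h'.2]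

theorem impl_rot (v : Q) (θ : ℝ) : Impl 1 (muxRot v fun _ => θ) := by
  convert impl_single v (rot θ) (rot_mem_unitary θ) using 1
  apply op_ext_ket
  intro y
  rw [muxRot_ket, single_mulVec_ket]

/-- Two half rotations of opposite angle cancel; conjugating one of them by a CNOT reverses it when
the control is 1, and then they add up. -/
theorem impl_ctrlRot (f v : Q) (h : f ≠ v) (θ : ℝ) :
    Impl 4 (muxRot v fun y => if y f = 1 then θ else 0) := by
  have h1 := (impl_rot v (θ / 2)).mul
    (((impl_cnot f v h).mul (impl_rot v (-(θ / 2)))).mul (impl_cnot f v h))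
  rw [muxRot_conj_cnot f v h _ (fun _ _ => rfl), muxRot_mul _ _ _ (fun _ _ => rfl)] at h1
  convert h1 using 2
  funext y
  by_cases hy : y f = 1 <;> simp [hy]

/-- Binary recursion over the address: a work qubit holds the flag restricted to one half of the
addresses. Each level doubles the cost and adds four gates, which `8 * 2 ^ t - 4` reproduces
exactly. The flag is part of the induction so that a recursive call can be confined to one half. -/
theorem impl_muxRot_flag (t : ℕ) : ∀ {Q : Type} [Fintype Q] [DecidableEq Q] (f v : Q)
    (α : Fin t → Q) (θ : (Fin t → Fin 2) → ℝ), f ≠ v → (∀ i, α i ≠ v) → (∀ i, α i ≠ f) →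
    Impl (8 * 2 ^ t - 4) (muxRot v fun y => if y f = 1 then θ (y ∘ α) else 0) := by
  induction t with
  | zero =>
    intro Q _ _ f v α θ hf _ _
    have h1 : (fun y : Basis Q => if y f = 1 then θ (y ∘ α) else 0) =
        fun y => if y f = 1 then θ ![] else 0 := by
      funext y
      rw [Subsingleton.elim (y ∘ α) ![]]
    rw [h1]
    exact impl_ctrlRot f v hf (θ ![])
  | succ t ih =>
    intro Q _ _ f v α θ hf hα hα'
    let g : Q ⊕ Unit := Sum.inr ()
    let β : Fin t → Q ⊕ Unit := fun i => Sum.inl (α i.succ)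
    let toff : Basis (Q ⊕ Unit) → Basis (Q ⊕ Unit) := fun y =>
      Function.update y g (y g + y (Sum.inl f) * y (Sum.inl (α 0)))
    let cn : Basis (Q ⊕ Unit) → Basis (Q ⊕ Unit) := fun y =>
      Function.update y g (y g + y (Sum.inl f))
    have hT : Impl 1 (permOp toff) :=
      impl_toffoli (Sum.inl f) (Sum.inl (α 0)) g (by simp [g]) (by simp [g])
        (fun h => (hα' 0) (Sum.inl_injective h).symm)
    have hC : Impl 1 (permOp cn) := impl_cnot (Sum.inl f) g (by simp [g])
    let θ₁ : Basis (Q ⊕ Unit) → ℝ := fun y =>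
      if y g = 1 then θ (Fin.cons 1 (y ∘ β)) else 0
    let θ₀ : Basis (Q ⊕ Unit) → ℝ := fun y =>
      if y g = 1 then θ (Fin.cons 0 (y ∘ β)) else 0
    have hgv : g ≠ Sum.inl v := by simp [g]
    have hβv : ∀ i, β i ≠ Sum.inl v := fun i h => hα _ (Sum.inl_injective h)
    have hM1 : Impl (8 * 2 ^ t - 4) (muxRot (Sum.inl v) θ₁) :=
      ih g (Sum.inl v) β (fun a => θ (Fin.cons 1 a)) hgv hβv (by simp [β, g])
    have hM0 : Impl (8 * 2 ^ t - 4) (muxRot (Sum.inl v) θ₀) :=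
      ih g (Sum.inl v) β (fun a => θ (Fin.cons 0 a)) hgv hβv (by simp [β, g])
    -- Read from right to left: the Toffoli puts "flag and first address bit" on `g`, which drives
    -- the half with bit 1; the CNOT changes it to "flag and not that bit" for the other half; both
    -- are then undone.
    have h1 := ((hT.mul ((hC.mul hM0).mul hC)).mul hM1).mul hT
    have invT : ∀ y, toff (toff y) = y := by
      intro y
      simp only [toff, Function.update_self, Function.update_idem]
      rw [Function.update_of_ne (by simp [g]), Function.update_of_ne (by simp [g])]
      have : ∀ a b : Fin 2, a + b + b = a := by decide
      rw [this, Function.update_eq_self]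
    have invC : ∀ y, cn (cn y) = y := by
      intro y
      simp only [cn, Function.update_self, Function.update_idem]
      rw [Function.update_of_ne (by simp [g])]
      have : ∀ a b : Fin 2, a + b + b = a := by decide
      rw [this, Function.update_eq_self]
    have hfv : (Sum.inl f : Q ⊕ Unit) ≠ Sum.inl v := fun h => hf (Sum.inl_injective h)
    have hav : (Sum.inl (α 0) : Q ⊕ Unit) ≠ Sum.inl v := fun h => hα 0 (Sum.inl_injective h)
    have comT : ∀ y b, toff (Function.update y (Sum.inl v) b) =
        Function.update (toff y) (Sum.inl v) b := by
      intro y b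
      simp only [toff]
      rw [Function.update_of_ne hgv, Function.update_of_ne hfv, Function.update_of_ne hav,
        Function.update_comm hgv.symm]
    have comC : ∀ y b, cn (Function.update y (Sum.inl v) b) =
        Function.update (cn y) (Sum.inl v) b := by
      intro y b
      simp only [cn]
      rw [Function.update_of_ne hgv, Function.update_of_ne hfv, Function.update_comm hgv.symm]
    have hTv : ∀ y, toff y (Sum.inl v) = y (Sum.inl v) := fun y =>
      Function.update_of_ne hgv.symm _ _
    have hCv : ∀ y, cn y (Sum.inl v) = y (Sum.inl v) := fun y =>
      Function.update_of_ne hgv.symm _ _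
    have ind0 : ∀ y b, θ₀ (Function.update y (Sum.inl v) b) = θ₀ y := by
      intro y b
      have : (Function.update y (Sum.inl v) b) ∘ β = y ∘ β := by
        funext i; exact Function.update_of_ne (hβv i) _ _
      simp only [θ₀]
      rw [this, Function.update_of_ne hgv]
    have e1 : permOp toff * (permOp cn * muxRot (Sum.inl v) θ₀ * permOp cn) *
        muxRot (Sum.inl v) θ₁ * permOp toff =
        muxRot (Sum.inl v) (fun y => θ₀ (cn (toff y)) + θ₁ (toff y)) := by
      rw [muxRot_conj _ _ _ invC comC hCv, Matrix.mul_assoc (permOp toff), muxRot_mul _ _ _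
        (fun y b => by simp only [Function.comp_apply, comC, ind0]),
        muxRot_conj _ _ _ invT comT hTv]
      rfl
    rw [e1] at h1
    refine (h1.mono ?_).descend (carries_muxRot _ _ _ ?_)
    · have : 1 ≤ 2 ^ t := Nat.one_le_two_pow
      rw [pow_succ]; omega
    · intro y
      have hβ : ∀ z : Basis Unit, (Sum.elim y z : Basis (Q ⊕ Unit)) ∘ β = y ∘ α ∘ Fin.succ :=
        fun z => rfl
      have hg : ∀ b : Fin 2, Function.update (Sum.elim y (0 : Basis Unit)) g b =
          Sum.elim y fun _ => b := by
        intro b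
        funext u
        rcases u with u | u
        · rw [Function.update_of_ne (by simp [g])]; rfl
        · cases u; simp [g]
      have t1 : toff (Sum.elim y 0) = Sum.elim y fun _ => y f * y (α 0) := by
        simp only [toff]
        rw [hg]; simp [g]
      have t2 : cn (toff (Sum.elim y 0)) = Sum.elim y fun _ => y f * y (α 0) + y f := by
        rw [t1, ← hg]
        simp only [cn, Function.update_idem, Function.update_self]
        rw [hg, Function.update_of_ne (by simp [g])]; rfl
      rw [t2, t1]
      simp only [θ₀, θ₁, hβ, g, Sum.elim_inr]
      have hcons : ∀ b, y (α 0) = b →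
          (Fin.cons b (y ∘ α ∘ Fin.succ) : Fin (t + 1) → Fin 2) = y ∘ α := by
        intro b hb
        funext i
        refine Fin.cases ?_ (fun i => ?_) i
        · exact hb.symm
        · rfl
      have hb : ∀ b : Fin 2, b = 0 ∨ b = 1 := by decide
      rcases hb (y f) with h0 | h0 <;> rcases hb (y (α 0)) with h2 | h2 <;>
        simp [h0, h2, ← hcons _ h2]

theorem impl_muxRot (t : ℕ) (v : Q) (α : Fin t → Q) (θ : (Fin t → Fin 2) → ℝ)
    (hα : ∀ i, α i ≠ v) : Impl (8 * 2 ^ t) (muxRot v fun y => θ (y ∘ α)) := by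
  -- A flag raised by a NOT gate makes the rotation unconditional.
  let g : Q ⊕ Unit := Sum.inr ()
  have h1 := ((impl_not g).mul (impl_muxRot_flag t g (Sum.inl v) (fun i => Sum.inl (α i)) θ
    (by simp [g]) (fun i h => hα i (Sum.inl_injective h)) (by simp [g]))).mul (impl_not g)
  rw [muxRot_conj] at h1
  · refine (h1.mono ?_).descend (carries_muxRot _ _ _ ?_)
    · have : 1 ≤ 2 ^ t := Nat.one_le_two_pow
      omega
    · intro y
      simp only [Function.comp_apply, Function.update_self]
      rw [if_pos (by simp [g])]
      congr 1
  · intro y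
    have : ∀ a : Fin 2, a + 1 + 1 = a := by decide
    simp only [Function.update_self, Function.update_idem, this, Function.update_eq_self]
  · intro y b
    rw [Function.update_of_ne (by simp [g]), Function.update_comm (by simp [g])]
  · intro y
    rw [Function.update_of_ne (by simp [g])]

/-- The operator `V` does not change the wires outside `τ`. -/
def LocalOn {t : Type} (τ : t ↪ Q) (V : Op Q) : Prop :=
  ∀ x y, (¬ ∀ v, v ∉ Set.range τ → x v = y v) → V x y = 0

/-- Preparation of states with nonnegative amplitudes, controlled by address wires. -/
theorem exists_statePrep (t : ℕ) : ∀ (s : ℕ) (α : Fin s → Q) (τ : Fin t ↪ Q)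
    (_ : ∀ i, α i ∉ Set.range τ) (v : (Fin s → Fin 2) → Basis (Fin t) → ℝ)
    (_ : ∀ a u, 0 ≤ v a u) (_ : ∀ a, ∑ u, v a u ^ 2 = 1),
    ∃ V : Op Q, Impl (8 * 2 ^ s * (2 ^ t - 1)) V ∧ LocalOn τ V ∧
      ∀ y : Basis Q, y ∘ τ = 0 → ∀ u, V (patch τ y u) y = v (y ∘ α) u := by
  induction t with
  | zero =>
    intro s α τ hα v hv hs
    refine ⟨1, impl_one.mono (by omega), ?_, ?_⟩
    · intro x y h
      rw [Matrix.one_apply_ne]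
      rintro rfl
      exact h fun _ _ => rfl
    · intro y _ u
      have h1 : patch τ y u = y := by
        rw [show u = y ∘ τ from Subsingleton.elim _ _, patch_self]
      have h2 := hs (y ∘ α)
      rw [Fintype.sum_subsingleton _ u] at h2
      rw [h1, Matrix.one_apply_eq]
      have h3 : v (y ∘ α) u = 1 := by
        have := hv (y ∘ α) u
        nlinarith
      rw [h3]; simp
  | succ t ih =>
    intro s α τ hα v hv hs
    let r : (Fin s → Fin 2) → Fin 2 → ℝ := fun a b => √(∑ u, v a (Fin.cons b u) ^ 2)
    have hr0 : ∀ a b, 0 ≤ r a b := fun a b => Real.sqrt_nonneg _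
    have hrsq : ∀ a b, r a b ^ 2 = ∑ u, v a (Fin.cons b u) ^ 2 := fun a b =>
      Real.sq_sqrt (Finset.sum_nonneg fun _ _ => sq_nonneg _)
    have hsum : ∀ a, r a 0 ^ 2 + r a 1 ^ 2 = 1 := by
      intro a
      rw [hrsq, hrsq, ← hs a, ← Fin.sum_univ_two (fun b => ∑ u, v a (Fin.cons b u) ^ 2),
        ← Fintype.sum_prod_type' (f := fun b u => v a (Fin.cons b u) ^ 2)]
      exact Fintype.sum_equiv (Fin.consEquiv fun _ => Fin 2) _ _ (fun _ => rfl)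
    -- Both norms are nonnegative, so the angle is in the first quadrant and its sine is the second
    -- norm without a sign ambiguity.
    let θ : (Fin s → Fin 2) → ℝ := fun a => Real.arccos (r a 0)
    have hcos : ∀ a, Real.cos (θ a) = r a 0 := fun a =>
      Real.cos_arccos (by linarith [hr0 a 0]) (by nlinarith [hr0 a 0, hsum a, sq_nonneg (r a 1)])
    have hsin : ∀ a, Real.sin (θ a) = r a 1 := by
      intro a
      rw [Real.sin_arccos, ← hsum a, add_sub_cancel_left, Real.sqrt_sq (hr0 a 1)]
    -- Amplitudes conditional on the first target bit. A branch of norm zero has no conditional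
    -- state; the default basis state keeps the normalisation and is later multiplied by zero.
    let v' : (Fin (s + 1) → Fin 2) → Basis (Fin t) → ℝ := fun a u =>
      if r (Fin.tail a) (a 0) = 0 then (if u = 0 then 1 else 0)
      else v (Fin.tail a) (Fin.cons (a 0) u) / r (Fin.tail a) (a 0)
    have hv' : ∀ a u, 0 ≤ v' a u := by
      intro a u
      simp only [v']
      split_ifs
      · exact zero_le_one
      · exact le_rfl
      · exact div_nonneg (hv _ _) (hr0 _ _)
    have hs' : ∀ a, ∑ u, v' a u ^ 2 = 1 := by
      intro a
      by_cases h : r (Fin.tail a) (a 0) = 0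
      · simp [v', h]
      · simp only [v', h, if_false, div_pow]
        rw [← Finset.sum_div, ← hrsq, div_self (pow_ne_zero 2 h)]
    let τ' : Fin t ↪ Q := (Fin.succEmb t).trans τ
    -- The wire just rotated becomes an address wire for the remaining ones, which is why the
    -- induction is over `t` with `s` arbitrary.
    let α' : Fin (s + 1) → Q := Fin.cons (τ 0) α
    have hτ' : ∀ i, τ' i = τ i.succ := fun i => rfl
    have hα' : ∀ i, α' i ∉ Set.range τ' := by
      intro i
      refine Fin.cases ?_ (fun i => ?_) i
      · rintro ⟨k, hk⟩
        exact (Fin.succ_ne_zero k) (τ.injective hk)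
      · rintro ⟨k, hk⟩
        exact hα i ⟨k.succ, hk⟩
    obtain ⟨V', hV', hloc, hval⟩ := ih (s + 1) α' τ' hα' v' hv' hs'
    have hrot := impl_muxRot s (τ 0) α θ (fun i h => hα i ⟨0, h.symm⟩)
    have hloc0 : ∀ (y : Basis Q) (b : Fin 2) (v : Q), v ∉ Set.range τ →
        Function.update y (τ 0) b v = y v := fun y b v hv =>
      Function.update_of_ne (fun h => hv ⟨0, h.symm⟩) _ _
    have hexp : ∀ x y, (V' * muxRot (τ 0) fun y => θ (y ∘ α)) x y =
        ∑ b, rot (θ (y ∘ α)) b (y (τ 0)) * V' x (Function.update y (τ 0) b) := by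
      intro x y
      rw [← mulVec_ket (V' * _) x y, ← Matrix.mulVec_mulVec, muxRot_ket, Matrix.mulVec_sum, Finset.sum_apply]
      refine Finset.sum_congr rfl fun b _ => ?_
      rw [Matrix.mulVec_smul, Pi.smul_apply, mulVec_ket]; rfl
    refine ⟨_, (hV'.mul hrot).mono ?_, ?_, ?_⟩
    · have : 1 ≤ 2 ^ t := Nat.one_le_two_pow
      obtain ⟨k, hk⟩ := Nat.exists_eq_add_of_le this
      rw [pow_succ 2 t, pow_succ 2 s, hk, show (1 + k) * 2 - 1 = 2 * k + 1 by omega,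
        show 1 + k - 1 = k by omega]
      nlinarith
    · intro x y hxy
      rw [hexp]
      apply Finset.sum_eq_zero
      intro b _
      rw [hloc, mul_zero]
      intro h
      apply hxy
      intro u hu
      rw [h u (fun ⟨k, hk⟩ => hu ⟨k.succ, hk⟩), hloc0 y b u hu]
    · intro y hy u
      have hy0 : y (τ 0) = 0 := congrFun hy 0
      rw [hexp, Finset.sum_eq_single (u 0), hy0]
      · set z := Function.update y (τ 0) (u 0) with hz
        have hz1 : z ∘ τ' = 0 := by
          funext i
          rw [hz, Function.comp_apply, hτ', Function.update_of_ne]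
          · exact congrFun hy i.succ
          · intro h; exact Fin.succ_ne_zero i (τ.injective h)
        have hz2 : z ∘ α' = Fin.cons (u 0) (y ∘ α) := by
          funext i
          refine Fin.cases ?_ (fun i => ?_) i
          · simp [hz, α']
          · simp only [hz, α', Function.comp_apply, Fin.cons_succ]
            rw [Function.update_of_ne]
            intro h; exact hα i ⟨0, h.symm⟩
        have hp : patch τ y u = patch τ' z (Fin.tail u) := by
          funext q
          by_cases hq : q ∈ Set.range τ
          · obtain ⟨k, rfl⟩ := hq
            rw [patch_apply]
            refine Fin.cases ?_ (fun k => ?_) k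
            · rw [patch_apply_of_notMem]
              · simp [hz]
              · exact hα' 0
            · rw [← hτ', patch_apply]; rfl
          · rw [patch_apply_of_notMem _ _ _ hq, patch_apply_of_notMem, hz, hloc0 _ _ _ hq]
            rintro ⟨k, hk⟩; exact hq ⟨k.succ, hk⟩
        rw [hp, hval z hz1, hz2]
        have hrr : rot (θ (y ∘ α)) (u 0) 0 = r (y ∘ α) (u 0) := by
          have hb : ∀ b : Fin 2, b = 0 ∨ b = 1 := by decide
          rcases hb (u 0) with h | h <;> rw [h]
          · simp only [rot, ← hcos]; rfl
          · simp only [rot, ← hsin]; rfl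
        rw [hrr]
        simp only [v', Fin.cons_zero, Fin.tail_cons]
        have huu : (Fin.cons (u 0) (Fin.tail u) : Basis (Fin (t + 1))) = u := Fin.cons_self_tail u
        -- In a branch of norm zero every amplitude vanishes, so the default state does no harm.
        by_cases h : r (y ∘ α) (u 0) = 0
        · rw [h]
          have h2 := hrsq (y ∘ α) (u 0)
          rw [h, eq_comm, zero_pow two_ne_zero,
            Finset.sum_eq_zero_iff_of_nonneg (fun _ _ => sq_nonneg _)] at h2
          have h3 := h2 (Fin.tail u) (Finset.mem_univ _)
          rw [huu] at h3
          rw [pow_eq_zero_iff two_ne_zero] at h3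
          rw [h3]; simp
        · rw [if_neg h, huu]
          rw [← Complex.ofReal_mul, mul_div_cancel₀ _ h]
      · intro b _ hb
        rw [hloc, mul_zero]
        intro h
        have := h (τ 0) (hα' 0)
        rw [patch_apply, Function.update_self] at this
        exact hb this.symm
      · simp

end Prep

end QuFEM
end

noncomputable section
namespace QuFEM

/-! ### Arithmetic with carries -/

section Arithmetic

variable {Q : Type} [Fintype Q] [DecidableEq Q]

/-- The binary digit of weight `2 ^ i`. -/
def nbit (N i : ℕ) : Fin 2 := if N / 2 ^ i % 2 = 1 then 1 else 0

/-- The functions in `U` can be computed by `c` further gates once those in `S` are available. -/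
def DerSet (S : Set (Basis Q → Fin 2)) (c : ℕ) (U : Set (Basis Q → Fin 2)) : Prop :=
  ∀ N S', S ⊆ S' → Computes N S' → Computes (N + c) (S' ∪ U)

theorem DerSet.mono {S S' U U' : Set (Basis Q → Fin 2)} {c c' : ℕ} (h : DerSet S c U)
    (hS : S ⊆ S') (hc : c ≤ c') (hU : U' ⊆ U) : DerSet S' c' U' :=
  fun N T hT hN => (h N T (hS.trans hT) hN).mono (by omega) (Set.union_subset_union_right _ hU)

theorem DerSet.trans {S U U' : Set (Basis Q → Fin 2)} {c c' : ℕ} (h : DerSet S c U)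
    (h' : DerSet (S ∪ U) c' U') : DerSet S (c + c') (U ∪ U') := by
  intro N T hT hN
  have := h' _ _ (Set.union_subset_union_left _ hT) (h N T hT hN)
  rw [← Set.union_assoc]
  exact this.mono (by omega) le_rfl

theorem DerSet.trans_der {S U : Set (Basis Q → Fin 2)} {c c' : ℕ} {f : Basis Q → Fin 2}
    (h : DerSet S c U) (h' : Der (S ∪ U) c' f) : Der S (c + c') f := by
  intro N T hT hN
  have := h' _ _ (Set.union_subset_union_left _ hT) (h N T hT hN)
  exact this.mono (by omega) (Set.insert_subset_insert Set.subset_union_left)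

theorem derSet_family {ι : Type*} [DecidableEq ι] {c : ℕ} {S : Set (Basis Q → Fin 2)}
    (T : Finset ι) (F : ι → Basis Q → Fin 2) (hF : ∀ a ∈ T, Der S c (F a)) :
    DerSet S (T.card * c) (F '' T) :=
  fun _ _ hS hN => hN.family T F fun a ha => (hF a ha).mono hS le_rfl

/-- Stage `i + 1` may use the base functions and stage `i` only. This is the pattern of carries, of
remainders and of one-hot values when a number is read digit by digit. -/
theorem derSet_chain {S : Set (Basis Q → Fin 2)} (U : ℕ → Set (Basis Q → Fin 2)) (c : ℕ → ℕ)
    (h0 : DerSet S (c 0) (U 0)) (n : ℕ) (h : ∀ i < n, DerSet (S ∪ U i) (c (i + 1)) (U (i + 1))) :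
    DerSet S (∑ i ∈ Finset.range (n + 1), c i) {f | ∃ i ≤ n, f ∈ U i} := by
  induction n with
  | zero =>
    refine h0.mono le_rfl (by simp) ?_
    rintro f ⟨i, hi, hf⟩
    rwa [Nat.le_zero.1 hi] at hf
  | succ n ih =>
    have h1 := (ih fun i hi => h i (by omega)).trans
      ((h n (by omega)).mono (Set.union_subset_union_right _ fun f hf => ⟨n, le_rfl, hf⟩)
        le_rfl le_rfl)
    refine h1.mono le_rfl (by rw [Finset.sum_range_succ _ (n + 1)]) ?_
    rintro f ⟨i, hi, hf⟩
    rcases Nat.lt_or_ge n i with h' | h'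
    · right; rwa [show i = n + 1 by omega] at hf
    · left; exact ⟨i, h', hf⟩

theorem der_zero (S : Set (Basis Q → Fin 2)) : Der S 4 (fun _ => 0) :=
  ((der_one S).add (der_one S)).mono le_rfl (by omega)

/-- The carry into position `i` when adding `A`, `B` and `c`. -/
def carryBit (A B c i : ℕ) : Fin 2 := if 2 ^ i ≤ A % 2 ^ i + B % 2 ^ i + c then 1 else 0

/-- A carry leaves if both digits are 1, or if exactly one is and a carry arrives. Modulo 2 these
exclusive cases simply add. -/
theorem carryBit_succ (A B : ℕ) {c : ℕ} (hc : c ≤ 1) (i : ℕ) :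
    carryBit A B c (i + 1) = nbit A i * nbit B i + carryBit A B c i * (nbit A i + nbit B i) := by
  simp only [carryBit, nbit, pow_succ, Nat.mod_mul]
  have hP : 0 < 2 ^ i := by positivity
  have h1 := Nat.mod_lt A hP
  have h2 := Nat.mod_lt B hP
  generalize 2 ^ i = P at *
  generalize A % P = a at *
  generalize B % P = b at *
  rcases Nat.mod_two_eq_zero_or_one (A / P) with h3 | h3 <;>
  rcases Nat.mod_two_eq_zero_or_one (B / P) with h4 | h4 <;>
  simp only [h3, h4, mul_zero, mul_one, add_zero, zero_ne_one, if_true, if_false]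
  · rw [if_neg (by omega)]
  · by_cases h : P ≤ a + b + c
    · rw [if_pos h, if_pos (by omega)]; rfl
    · rw [if_neg h, if_neg (by omega)]; rfl
  · by_cases h : P ≤ a + b + c
    · rw [if_pos h, if_pos (by omega)]; rfl
    · rw [if_neg h, if_neg (by omega)]; rfl
  · rw [if_pos (by omega)]
    split_ifs <;> rfl

theorem nbit_add (A B : ℕ) {c : ℕ} (hc : c ≤ 1) (i : ℕ) :
    nbit (A + B + c) i = nbit A i + nbit B i + carryBit A B c i := by
  simp only [carryBit, nbit]
  have hP : 0 < 2 ^ i := by positivity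
  have h1 := Nat.mod_lt A hP
  have h2 := Nat.mod_lt B hP
  have e1 := Nat.div_add_mod A (2 ^ i)
  have e2 := Nat.div_add_mod B (2 ^ i)
  generalize 2 ^ i = P at *
  have key : (A + B + c) / P = A / P + B / P + if P ≤ A % P + B % P + c then 1 else 0 := by
    have : A + B + c = (A % P + B % P + c) + P * (A / P + B / P) := by
      rw [mul_add]; omega
    rw [this, Nat.add_mul_div_left _ _ hP, add_comm]
    congr 1
    split_ifs with h
    · rw [Nat.div_eq_iff hP]; omega
    · exact Nat.div_eq_of_lt (by omega)
  rw [key]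
  split_ifs <;> omega

theorem der_carry {S : Set (Basis Q → Fin 2)} {w : ℕ} (A B : Basis Q → ℕ) (c : ℕ) (hc : c ≤ 1)
    (hA : ∀ i < w, (fun x => nbit (A x) i) ∈ S) (hB : ∀ i < w, (fun x => nbit (B x) i) ∈ S) :
    DerSet S ((w + 1) * 6) {f | ∃ i ≤ w, f = fun x => carryBit (A x) (B x) c i} := by
  have := derSet_chain (S := S) (fun i => {fun x => carryBit (A x) (B x) c i}) (fun _ => 6) ?_ w ?_
  · refine this.mono le_rfl (by simp) ?_
    rintro f ⟨i, hi, rfl⟩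
    exact ⟨i, hi, rfl⟩
  · have h : Der S 6 (fun x => carryBit (A x) (B x) c 0) := by
      have : (fun x => carryBit (A x) (B x) c 0) = fun _ => if 1 ≤ c then 1 else 0 := by
        funext x; simp [carryBit, Nat.mod_one]
      rw [this]
      split_ifs
      · exact (der_one S).mono le_rfl (by omega)
      · exact (der_zero S).mono le_rfl (by omega)
    intro N T hT hN
    rw [Set.union_singleton]
    exact h N T hT hN
  · intro i hi N T hT hN
    rw [Set.union_singleton]
    have h : Der (S ∪ {fun x => carryBit (A x) (B x) c i}) 6
        (fun x => carryBit (A x) (B x) c (i + 1)) := by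
      simp only [carryBit_succ _ _ hc]
      have ha := der_mem (Set.mem_union_left {fun x => carryBit (A x) (B x) c i} (hA i hi))
      have hb := der_mem (Set.mem_union_left {fun x => carryBit (A x) (B x) c i} (hB i hi))
      exact ((ha.mul hb).add ((der_mem (Or.inr rfl)).mul (ha.add hb))).mono le_rfl le_rfl
    exact h N T hT hN

theorem derSet_add {S : Set (Basis Q → Fin 2)} {w : ℕ} (A B : Basis Q → ℕ) (c : ℕ) (hc : c ≤ 1)
    (hA : ∀ i < w, (fun x => nbit (A x) i) ∈ S) (hB : ∀ i < w, (fun x => nbit (B x) i) ∈ S) :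
    DerSet S ((w + 1) * 10) {f | ∃ i < w, f = fun x => nbit (A x + B x + c) i} := by
  have h1 := (der_carry A B c hc hA hB).trans (derSet_family (Finset.range w)
    (fun i x => nbit (A x + B x + c) i) (c := 4) ?_)
  · refine h1.mono le_rfl (by simp; omega) ?_
    rintro f ⟨i, hi, rfl⟩
    exact Or.inr ⟨i, by simpa using hi, rfl⟩
  · intro i hi
    have hi' : i < w := Finset.mem_range.1 hi
    simp only [nbit_add _ _ hc]
    exact ((der_mem (Or.inl (hA i hi'))).add (der_mem (Or.inl (hB i hi')))).add
      (der_mem (Or.inr ⟨i, hi'.le, rfl⟩))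

/-- Bitwise complement, the first half of two's complement: with it the adder also subtracts. -/
theorem nbit_compl {N k : ℕ} (w : ℕ) (hk : k < 2 ^ N) (hw : w < N) :
    nbit (2 ^ N - 1 - k) w = nbit k w + 1 := by
  have h := Nat.testBit_two_pow_sub_succ hk w
  rw [show 2 ^ N - (k + 1) = 2 ^ N - 1 - k by omega, Nat.testBit_eq_decide_div_mod_eq,
    Nat.testBit_eq_decide_div_mod_eq] at h
  simp only [hw, decide_true, Bool.true_and] at h
  simp only [nbit]
  by_cases h' : k / 2 ^ w % 2 = 1
  · rw [if_pos h', if_neg]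
    · rfl
    · simpa [h'] using h
  · rw [if_neg h', if_pos]
    · rfl
    · simpa [h'] using h

theorem nbit_eq_zero {N i : ℕ} (h : N < 2 ^ i) : nbit N i = 0 := by
  rw [nbit, Nat.div_eq_of_lt h]; rfl

/-- The number stored on the wires `d`. -/
def regVal {w : ℕ} (d : Fin w → Q) (x : Basis Q) : ℕ := finFunctionFinEquiv (x ∘ d)

theorem regVal_lt {w : ℕ} (d : Fin w → Q) (x : Basis Q) : regVal d x < 2 ^ w := Fin.is_lt _

theorem nbit_finFunction {w : ℕ} (t : Basis (Fin w)) (i : Fin w) :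
    nbit (finFunctionFinEquiv t) i = t i := by
  have h := finFunctionFinEquiv_symm_apply_val (finFunctionFinEquiv t) i
  rw [Equiv.symm_apply_apply] at h
  rw [nbit, ← h]
  have : ∀ b : Fin 2, (if (b : ℕ) = 1 then (1 : Fin 2) else 0) = b := by decide
  exact this _

theorem nbit_regVal {w : ℕ} (d : Fin w → Q) (x : Basis Q) (i : Fin w) :
    nbit (regVal d x) i = x (d i) := nbit_finFunction _ _

theorem finFunction_nbit {w N : ℕ} (hN : N < 2 ^ w) :
    (finFunctionFinEquiv (fun i : Fin w => nbit N i) : ℕ) = N := by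
  have : (fun i : Fin w => nbit N i) = finFunctionFinEquiv.symm ⟨N, hN⟩ := by
    funext i
    rw [← nbit_finFunction (finFunctionFinEquiv.symm ⟨N, hN⟩) i, Equiv.apply_symm_apply]
  rw [this, Equiv.apply_symm_apply]

theorem nbit_mod {N w i : ℕ} (hi : i < w) : nbit (N % 2 ^ w) i = nbit N i := by
  have h := Nat.testBit_mod_two_pow N w i
  simp only [Nat.testBit_eq_decide_div_mod_eq, hi, decide_true, Bool.true_and,
    decide_eq_decide] at h
  simp only [nbit, h]

/-- The functions which read one wire. -/
def wires (Q : Type) : Set (Basis Q → Fin 2) := {f | ∃ v, f = fun x => x v}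

theorem nbit_regVal_mem {w : ℕ} (d : Fin w → Q) {i : ℕ} (hi : i < w) :
    (fun x => nbit (regVal d x) i) ∈ wires Q :=
  ⟨d ⟨i, hi⟩, funext fun x => nbit_regVal d x ⟨i, hi⟩⟩

/-- The digits of a register and further zero digits. -/
theorem derSet_regVal {w : ℕ} (d : Fin w → Q) (v : ℕ) :
    DerSet (wires Q) 4 {f | ∃ i < v, f = fun x => nbit (regVal d x) i} := by
  intro N T hT hN
  refine ((der_zero _) N T hT hN).mono le_rfl ?_
  rintro f (hf | ⟨i, _, rfl⟩)
  · exact Or.inr hf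
  · rcases Nat.lt_or_ge i w with h | h
    · exact Or.inr (hT (nbit_regVal_mem d h))
    · left
      funext x
      exact nbit_eq_zero ((regVal_lt d x).trans_le (Nat.pow_le_pow_right (by norm_num) h))

/-- Subtraction of registers, with an additional leading digit. -/
theorem derSet_sub {n m : ℕ} (hm : m ≤ n) (d : Fin n → Q) (k : Fin m → Q) :
    DerSet (wires Q) (30 * n + 40)
      {f | ∃ i < n + 1, f = fun x => nbit (regVal d x + 2 ^ n - regVal k x) i} := by
  have hk : ∀ x : Basis Q, regVal k x < 2 ^ n := fun x =>
    (regVal_lt k x).trans_le (Nat.pow_le_pow_right (by norm_num) hm)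
  have h1 := (derSet_regVal d (n + 1)).trans
    ((derSet_regVal k n).mono Set.subset_union_left le_rfl le_rfl)
  have h2 := h1.trans (derSet_family (Finset.range (n + 1))
    (fun i x => nbit (2 ^ n - 1 - regVal k x) i) (c := 4) ?_)
  · have h3 := h2.trans (derSet_add (w := n + 1) (regVal d) (fun x => 2 ^ n - 1 - regVal k x) 1
      le_rfl ?_ ?_)
    · refine h3.mono le_rfl ?_ ?_
      · rw [Finset.card_range]; omega
      · rintro f ⟨i, hi, rfl⟩
        refine Or.inr ⟨i, hi, ?_⟩
        funext x
        have := hk x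
        rw [show regVal d x + 2 ^ n - regVal k x = regVal d x + (2 ^ n - 1 - regVal k x) + 1 by
          omega]
    · exact fun i hi => Or.inr (Or.inl (Or.inl ⟨i, hi, rfl⟩))
    · exact fun i hi => Or.inr (Or.inr ⟨i, by simpa using hi, rfl⟩)
  · intro i hi
    have hi' : i < n + 1 := Finset.mem_range.1 hi
    rcases Nat.lt_or_ge i n with h | h
    · have : (fun x => nbit (2 ^ n - 1 - regVal k x) i) = fun x => nbit (regVal k x) i + 1 := by
        funext x; exact nbit_compl i (hk x) h
      rw [this]
      exact (der_mem (Or.inr (Or.inr ⟨i, h, rfl⟩))).not.mono le_rfl (by omega)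
    · have : (fun x => nbit (2 ^ n - 1 - regVal k x) i) = fun _ => 0 := by
        funext x
        refine nbit_eq_zero (lt_of_lt_of_le ?_ (Nat.pow_le_pow_right (by norm_num) h))
        have := hk x
        omega
      rw [this]
      exact der_zero _

theorem add_mod_eq_iff {p a : ℕ} (ha : a < p) (X Y : ℕ) :
    (X + Y) % p = a ↔ X % p = (a + (p - Y % p)) % p := by
  have hp : 0 < p := by omega
  have h1 := Nat.mod_lt X hp
  have h2 := Nat.mod_lt Y hp
  rw [Nat.add_mod X Y]
  generalize X % p = x at *
  generalize Y % p = y at *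
  have e1 : (x + y) % p = if x + y < p then x + y else x + y - p := by
    split_ifs with h
    · exact Nat.mod_eq_of_lt h
    · rw [Nat.mod_eq_sub_mod (by omega), Nat.mod_eq_of_lt (by omega)]
  have e2 : (a + (p - y)) % p = if a + (p - y) < p then a + (p - y) else a + (p - y) - p := by
    split_ifs with h
    · exact Nat.mod_eq_of_lt h
    · rw [Nat.mod_eq_sub_mod (by omega), Nat.mod_eq_of_lt (by omega)]
  rw [e1, e2]
  split_ifs <;> omega

theorem nbit_eq (N i : ℕ) : N / 2 ^ i % 2 = (nbit N i : ℕ) := by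
  rw [nbit]
  rcases Nat.mod_two_eq_zero_or_one (N / 2 ^ i) with h | h <;> simp [h]

theorem mod_two_pow_succ (N i : ℕ) : N % 2 ^ (i + 1) = N % 2 ^ i + 2 ^ i * (nbit N i : ℕ) := by
  rw [pow_succ, Nat.mod_mul, nbit_eq]

theorem fin_two_cases : ∀ b : Fin 2, b = 0 ∨ b = 1 := by decide

/-- Unary representation of the remainder modulo `p`. -/
theorem derSet_rem {S : Set (Basis Q → Fin 2)} {w p : ℕ} (T : Basis Q → ℕ)
    (hT : ∀ i < w, (fun x => nbit (T x) i) ∈ S) :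
    DerSet S ((w + 1) * (p * 7))
      {f | ∃ i ≤ w, ∃ a < p, f = fun x => if T x % 2 ^ i % p = a then 1 else 0} := by
  have := derSet_chain (S := S)
    (fun i => (fun a x => if T x % 2 ^ i % p = a then (1 : Fin 2) else 0) '' (Finset.range p))
    (fun _ => p * 7) ?_ w ?_
  · refine this.mono le_rfl (by simp) ?_
    rintro f ⟨i, hi, a, ha, rfl⟩
    exact ⟨i, hi, a, by simpa using ha, rfl⟩
  · refine (derSet_family (c := 7) (Finset.range p) _ fun a _ => ?_).mono le_rfl (by simp) le_rfl
    simp only [pow_zero, Nat.mod_one]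
    split_ifs
    · exact (der_one S).mono le_rfl (by omega)
    · exact (der_zero S).mono le_rfl (by omega)
  · intro i hi
    refine (derSet_family (c := 7) (Finset.range p) _ fun a ha => ?_).mono le_rfl (by simp) le_rfl
    have ha' : a < p := Finset.mem_range.1 ha
    let a' := (a + (p - 2 ^ i % p)) % p
    have hb := der_mem (Set.mem_union_left ((fun a x => if T x % 2 ^ i % p = a then (1 : Fin 2)
      else 0) '' (Finset.range p)) (hT i hi))
    have h0 := der_mem (Set.mem_union_right S (Set.mem_image_of_mem (fun a x =>
      if T x % 2 ^ i % p = a then (1 : Fin 2) else 0) ha))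
    have h1 := der_mem (Set.mem_union_right S (Set.mem_image_of_mem (fun a x =>
      if T x % 2 ^ i % p = a then (1 : Fin 2) else 0)
        (Finset.mem_coe.2 (Finset.mem_range.2 (Nat.mod_lt (a + (p - 2 ^ i % p))
          (show 0 < p by omega))))))
    -- The remainder `a` after one more digit comes from the remainder `a` if the digit is 0, and
    -- from `a - 2 ^ i` modulo `p` if it is 1. The two cases exclude each other, so their sum modulo
    -- 2 is their disjunction.
    have h2 := (hb.mul h1).add (hb.not.mul h0)
    refine Der.mono ?_ le_rfl (le_refl 7)
    convert h2 using 2 with x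
    rw [mod_two_pow_succ]
    rcases fin_two_cases (nbit (T x) i) with h | h
    · simp [h]
    · have h11 : (1 : Fin 2) + 1 = 0 := rfl
      rw [h]
      simp only [Fin.val_one, mul_one, add_mod_eq_iff ha', one_mul, h11, zero_mul, add_zero]

/-- Unary representation of the value of a register. -/
theorem derSet_oneHot {ν : ℕ} (d : Fin ν → Q) :
    DerSet (wires Q) (8 * 2 ^ ν)
      {f | ∃ a < 2 ^ ν, f = fun x => if regVal d x = a then 1 else 0} := by
  have := derSet_chain (S := wires Q)
    (fun i => (fun a x => if regVal d x % 2 ^ i = a then (1 : Fin 2) else 0) ''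
      (Finset.range (2 ^ i))) (fun i => 2 ^ i * 4) ?_ ν ?_
  · refine this.mono le_rfl ?_ ?_
    · rw [← Finset.sum_mul, Nat.geomSum_eq le_rfl, pow_succ]
      omega
    · rintro f ⟨a, ha, rfl⟩
      refine ⟨ν, le_rfl, a, by simpa using ha, ?_⟩
      funext x
      simp only [Nat.mod_eq_of_lt (regVal_lt d x)]
  · refine (derSet_family (c := 4) (Finset.range (2 ^ 0)) _ fun a ha => ?_).mono le_rfl (by simp)
      le_rfl
    have : a = 0 := by simpa using ha
    simp only [pow_zero, Nat.mod_one, this, if_true]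
    exact (der_one _).mono le_rfl (by omega)
  · intro i hi
    refine (derSet_family (c := 4) (Finset.range (2 ^ (i + 1))) _ fun a ha => ?_).mono le_rfl
      (by simp) le_rfl
    have ha' : a < 2 ^ (i + 1) := Finset.mem_range.1 ha
    have hb := der_mem (Set.mem_union_left ((fun a x => if regVal d x % 2 ^ i = a then (1 : Fin 2)
      else 0) '' (Finset.range (2 ^ i))) (nbit_regVal_mem d hi))
    have h1 := der_mem (Set.mem_union_right (wires Q) (Set.mem_image_of_mem (fun a x =>
      if regVal d x % 2 ^ i = a then (1 : Fin 2) else 0)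
        (Finset.mem_coe.2 (Finset.mem_range.2 (Nat.mod_lt a (Nat.two_pow_pos i))))))
    have key : ∀ x : Basis Q, regVal d x % 2 ^ (i + 1) = a ↔
        (regVal d x % 2 ^ i = a % 2 ^ i ∧ nbit (regVal d x) i = nbit a i) := by
      intro x
      rw [mod_two_pow_succ]
      have e := mod_two_pow_succ a i
      rw [Nat.mod_eq_of_lt ha'] at e
      have l1 := Nat.mod_lt (regVal d x) (Nat.two_pow_pos i)
      have l2 := Nat.mod_lt a (Nat.two_pow_pos i)
      rcases fin_two_cases (nbit (regVal d x) i) with h | h <;>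
      rcases fin_two_cases (nbit a i) with h' | h' <;>
      simp only [h, h', Fin.val_one, Fin.val_zero, mul_zero, mul_one, and_true, zero_ne_one,
        one_ne_zero, and_false, add_zero, iff_false] at e ⊢ <;> omega
    simp only [key]
    rcases fin_two_cases (nbit a i) with h' | h'
    · refine Der.mono ?_ le_rfl (le_refl 4)
      convert h1.mul hb.not using 2 with x
      by_cases h2 : regVal d x % 2 ^ i = a % 2 ^ i <;>
      rcases fin_two_cases (nbit (regVal d x) i) with h | h <;> simp [h, h2, h']
    · refine Der.mono (c := 1) ?_ le_rfl (by norm_num)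
      convert h1.mul hb using 2 with x
      by_cases h2 : regVal d x % 2 ^ i = a % 2 ^ i <;>
      rcases fin_two_cases (nbit (regVal d x) i) with h | h <;> simp [h, h2, h']


end Arithmetic

end QuFEM
end

noncomputable section
namespace QuFEM

/-! ### The mesh in binary arithmetic -/

section Mesh

variable {Q : Type} [Fintype Q] [DecidableEq Q] {n m p K ν : ℕ}

theorem nbit_inj {N M w : ℕ} (hN : N < 2 ^ w) (hM : M < 2 ^ w)
    (h : ∀ i < w, nbit N i = nbit M i) : N = M := by
  rw [← finFunction_nbit hN, ← finFunction_nbit hM]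
  congr 2
  funext i
  exact h i i.2

/-- The node `J` is the local node `k` of the element `e`, for some `e`. -/
def onMesh (p K J k : ℕ) : Fin 2 := if ∃ e < K, J = IX p e k then 1 else 0

/-- Three tests on the difference `J - k`: it is nonnegative (leading digit), divisible by `p`, and
different from `K * p`, which would belong to a nonexistent element number `K`. As `K * p = 2 ^ n -
1`, the last test asks whether all `n` digits are 1. -/
theorem onMesh_eq (hp : 1 ≤ p) (hK : 2 ^ n = K * p + 1) {J k : ℕ} (hJ : J < 2 ^ n) :
    onMesh p K J k = nbit (J + 2 ^ n - k) n *
      ((if (J + 2 ^ n - k) % 2 ^ n % p = 0 then 1 else 0) *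
        ((if ∀ i ∈ Finset.range n, nbit (J + 2 ^ n - k) i = 1 then 1 else 0) + 1)) := by
  by_cases hkJ : k ≤ J
  · have e1 : J + 2 ^ n - k = (J - k) + 2 ^ n := by omega
    have h1 : nbit (J + 2 ^ n - k) n = 1 := by
      rw [e1, nbit, Nat.add_div_right _ (Nat.two_pow_pos n), Nat.div_eq_of_lt (by omega)]
      rfl
    have h2 : (J + 2 ^ n - k) % 2 ^ n = J - k := by
      rw [e1, Nat.add_mod_right, Nat.mod_eq_of_lt (by omega)]
    have h3 : (∀ i ∈ Finset.range n, nbit (J + 2 ^ n - k) i = 1) ↔ J - k = K * p := by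
      have h4 : ∀ i < n, nbit (K * p) i = 1 := by
        intro i hi
        rw [show K * p = 2 ^ n - 1 - 0 by omega, nbit_compl i (by positivity) hi,
          nbit_eq_zero (by positivity)]
        rfl
      constructor
      · intro h
        refine nbit_inj (w := n) (by omega) (by omega) fun i hi => ?_
        rw [h4 i hi, ← h i (Finset.mem_range.2 hi), ← nbit_mod hi (N := J + 2 ^ n - k), h2]
      · intro h i hi
        rw [← nbit_mod (Finset.mem_range.1 hi), h2, h, h4 i (Finset.mem_range.1 hi)]
    rw [h1, h2, if_congr h3 rfl rfl, one_mul, onMesh]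
    by_cases hd : (J - k) % p = 0
    · obtain ⟨e, he⟩ := Nat.dvd_of_mod_eq_zero hd
      have heK : e ≤ K := by
        by_contra h
        have : p * (K + 1) ≤ p * e := Nat.mul_le_mul_left p (by omega)
        have : p * (K + 1) = K * p + p := by ring
        omega
      rw [if_pos hd, one_mul]
      by_cases heK' : e = K
      · have h4 : J - k = K * p := by rw [he, heK', mul_comm]
        rw [if_pos h4, if_neg]
        · rfl
        · rintro ⟨e', he', h5⟩
          have : e' * p + p ≤ K * p := by
            rw [← Nat.succ_mul]; exact Nat.mul_le_mul_right p he'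
          simp only [IX] at h5
          omega
      · have h4 : ¬ J - k = K * p := fun h4 => by
          rw [he, mul_comm] at h4
          exact heK' (Nat.eq_of_mul_eq_mul_right (by omega) h4)
        rw [if_neg h4, if_pos ⟨e, by omega, by rw [IX, mul_comm]; omega⟩]
        rfl
    · rw [if_neg hd, if_neg, zero_mul]
      rintro ⟨e, he, h5⟩
      simp only [IX] at h5
      apply hd
      rw [h5, Nat.add_sub_cancel, Nat.mul_mod_left]
  · have h1 : nbit (J + 2 ^ n - k) n = 0 := nbit_eq_zero (by omega)
    rw [h1, zero_mul, onMesh, if_neg]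
    rintro ⟨e, he, h5⟩
    simp only [IX] at h5
    omega

/-- The wires on which the operators on the mesh act. -/
structure MeshWires (Q : Type) (n m ν : ℕ) where
  data : Fin n ↪ Q
  row : Fin m → Q
  col : Fin m → Q
  idx : Fin ν → Q
  flag : Q
  ctrl : Q
  flag_notMem : flag ∉ Set.range data
  row_notMem : ∀ i, row i ∉ Set.range data
  col_notMem : ∀ i, col i ∉ Set.range data
  flag_ne_col : ∀ i, col i ≠ flag

variable (L : MeshWires Q n m ν)

/-- Whether the node is a local node with the number given by the column register. -/
def MeshWires.ok (L : MeshWires Q n m ν) (p K : ℕ) (x : Basis Q) : Fin 2 :=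
  onMesh p K (regVal L.data x) (regVal L.col x)

/-- The unary remainder modulo `p` dominates, with order `n * p` gates. The digits of the difference
stay in the derived set because the sign of the digit uses them again. -/
theorem MeshWires.derSet_ok (hmn : m ≤ n) (hp : 1 ≤ p) (hm : p + 1 = 2 ^ m)
    (hK : 2 ^ n = K * p + 1) :
    DerSet (wires Q) (100 * (n * p) + 100) (insert (L.ok p K) {f | ∃ i < n + 1,
      f = fun x => nbit (regVal L.data x + 2 ^ n - regVal L.col x) i}) := by
  have h1 := derSet_sub hmn L.data L.col
  have h2 := h1.trans (derSet_rem (w := n) (p := p)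
    (fun x => regVal L.data x + 2 ^ n - regVal L.col x)
    (fun i hi => Or.inr ⟨i, by omega, rfl⟩))
  have h3 : Der (wires Q ∪ ({f | ∃ i < n + 1, f = fun x =>
      nbit (regVal L.data x + 2 ^ n - regVal L.col x) i} ∪ {f | ∃ i ≤ n, ∃ a < p, f = fun x =>
        if (regVal L.data x + 2 ^ n - regVal L.col x) % 2 ^ i % p = a then 1 else 0}))
      (n + 6) (L.ok p K) := by
    have : L.ok p K = fun x => nbit (regVal L.data x + 2 ^ n - regVal L.col x) n *
      ((if (regVal L.data x + 2 ^ n - regVal L.col x) % 2 ^ n % p = 0 then 1 else 0) *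
        ((if ∀ i ∈ Finset.range n, nbit (regVal L.data x + 2 ^ n - regVal L.col x) i = 1
          then 1 else 0) + 1)) := by
      funext x
      exact onMesh_eq hp hK (regVal_lt _ _)
    rw [this]
    refine Der.mono ((der_mem (Or.inr (Or.inl ⟨n, by omega, rfl⟩))).mul
      ((der_mem (Or.inr (Or.inr ⟨n, le_rfl, 0, hp, rfl⟩))).mul
        (der_prod (c := 0) (Finset.range n) (fun i x =>
          nbit (regVal L.data x + 2 ^ n - regVal L.col x) i) fun i hi => der_mem (Or.inr (Or.inl
            ⟨i, by have := Finset.mem_range.1 hi; omega, rfl⟩))).not)) le_rfl ?_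
    rw [Finset.card_range]; omega
  intro N T hT hN
  refine (h3 _ _ (Set.union_subset_union_left _ hT) (h2 N T hT hN)).mono ?_ ?_
  · have : n ≤ n * p := Nat.le_mul_of_pos_right n hp
    have h4 : 1 * p ≤ n * p := Nat.mul_le_mul_right p (by
      rcases n with _ | n
      · have hm0 : m = 0 := by omega
        rw [hm0] at hm; omega
      · omega)
    have h5 : (n + 1) * (p * 7) = 7 * (n * p) + 7 * p := by ring
    omega
  · rintro f (hf | rfl | hf)
    · exact Or.inr (Or.inl hf)
    · exact Or.inl rfl
    · exact Or.inr (Or.inr (Or.inl hf))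

theorem regVal_update {w : ℕ} (d : Fin w → Q) (x : Basis Q) {v : Q} (hv : ∀ i, d i ≠ v)
    (b : Fin 2) : regVal d (Function.update x v b) = regVal d x := by
  rw [regVal, regVal]
  congr 2
  funext i
  exact Function.update_of_ne (hv i) _ _

/-- Inversion of the flag away from the mesh. -/
theorem MeshWires.impl_flip (hmn : m ≤ n) (hp : 1 ≤ p) (hm : p + 1 = 2 ^ m)
    (hK : 2 ^ n = K * p + 1) :
    Impl (400 * (n * p) + 500) (permOp fun x : Basis Q =>
      Function.update x L.flag (x L.flag + (L.ok p K x + 1))) := by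
  have h1 := L.derSet_ok hmn hp hm hK
  have h2 : Der (wires Q ∪ insert (L.ok p K) {f | ∃ i < n + 1,
      f = fun x => nbit (regVal L.data x + 2 ^ n - regVal L.col x) i}) 5
      (fun x => x L.flag + (L.ok p K x + 1)) :=
    ((der_mem (Or.inl ⟨L.flag, rfl⟩)).add (der_mem (Or.inr (Or.inl rfl))).not).mono le_rfl
      (by norm_num)
  have h3 := h1.trans_der h2 _ _ le_rfl computes_base
  -- The update is its own inverse: the mesh test does not read the flag, and adding a bit twice
  -- cancels.
  have h4 := impl_inPlace h3 h3 (wire L.flag) (fun _ => fun x => x L.flag + (L.ok p K x + 1))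
    (fun _ => fun x => x L.flag + (L.ok p K x + 1)) (fun _ => Or.inl rfl) (fun _ => Or.inl rfl) ?_
  · convert h4.mono (N' := 400 * (n * p) + 500) ?_ using 2
    · funext x
      rw [patch_eq_update _ _ _ 0 fun j hj => absurd (Subsingleton.elim j 0) hj]
      rfl
    · simp only [Fintype.card_fin]; omega
  · intro x k
    rw [patch_eq_update _ _ _ 0 fun j hj => absurd (Subsingleton.elim j 0) hj]
    have hok : ∀ b, L.ok p K (Function.update x L.flag b) = L.ok p K x := by
      intro b
      simp only [MeshWires.ok]
      rw [regVal_update _ _ fun i hi => L.flag_notMem ⟨i, hi⟩, regVal_update _ _ L.flag_ne_col]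
    change Function.update x L.flag _ L.flag + (L.ok p K (Function.update x L.flag _) + 1) =
      x L.flag
    rw [hok, Function.update_self]
    generalize x L.flag = a
    generalize L.ok p K x = b
    revert a b; decide

/-- Replacement of the node `J` by `J - k + j` modulo the number of nodes. -/
theorem MeshWires.impl_shift (hmn : m ≤ n) :
    Impl (200 * n + 300) (permOp fun x : Basis Q => patch L.data x fun i =>
      nbit (regVal L.data x + 2 ^ n - regVal L.col x + regVal L.row x) i) := by
  have h : ∀ r c : Fin m → Q, Computes (40 * n + 54) (wires Q ∪ {f | ∃ i < n,
      f = fun x => nbit (regVal L.data x + 2 ^ n - regVal c x + regVal r x) i}) := by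
    intro r c
    have h1 := (derSet_sub hmn L.data c).trans ((derSet_regVal r n).mono Set.subset_union_left
      le_rfl le_rfl)
    have h2 := h1.trans (derSet_add (w := n) (fun x => regVal L.data x + 2 ^ n - regVal c x)
      (regVal r) 0 (by norm_num) (fun i hi => Or.inr (Or.inl ⟨i, Nat.lt_succ_of_lt hi, rfl⟩))
      (fun i hi => Or.inr (Or.inr ⟨i, hi, rfl⟩)))
    refine (h2 _ _ le_rfl computes_base).mono ?_
      (Set.union_subset_union_right _ fun f hf => Or.inr hf)
    omega
  -- The inverse shift is the same formula with the row and column registers exchanged.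
  have h4 := impl_inPlace (h L.row L.col) (h L.col L.row) L.data
    (fun i x => nbit (regVal L.data x + 2 ^ n - regVal L.col x + regVal L.row x) i)
    (fun i x => nbit (regVal L.data x + 2 ^ n - regVal L.row x + regVal L.col x) i)
    (fun i => Or.inr ⟨i, i.2, rfl⟩) (fun i => Or.inr ⟨i, i.2, rfl⟩) ?_
  · refine h4.mono ?_
    simp only [Fintype.card_fin]; omega
  · intro x i
    set y := patch L.data x fun i =>
      nbit (regVal L.data x + 2 ^ n - regVal L.col x + regVal L.row x) i with hy
    have hout : ∀ q : Fin m → Q, (∀ i, q i ∉ Set.range L.data) → regVal q y = regVal q x := by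
      intro q hq
      rw [regVal, regVal]
      congr 2
      funext i
      rw [Function.comp_apply, hy]
      exact patch_apply_of_notMem L.data x _ (hq i)
    have hd : regVal L.data y =
        (regVal L.data x + 2 ^ n - regVal L.col x + regVal L.row x) % 2 ^ n := by
      rw [regVal, hy, patch_comp, ← finFunction_nbit (Nat.mod_lt _ (Nat.two_pow_pos n))]
      congr 2
      funext i
      exact (nbit_mod i.2).symm
    rw [hout _ L.row_notMem, hout _ L.col_notMem, hd, ← nbit_regVal L.data x i,
      ← nbit_mod i.2]
    congr 1
    have l1 := regVal_lt L.data x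
    have l2 : regVal L.row x < 2 ^ n := (regVal_lt L.row x).trans_le
      (Nat.pow_le_pow_right (by norm_num) hmn)
    have l3 : regVal L.col x < 2 ^ n := (regVal_lt L.col x).trans_le
      (Nat.pow_le_pow_right (by norm_num) hmn)
    generalize regVal L.data x = J at *
    generalize regVal L.row x = r at *
    generalize regVal L.col x = k at *
    generalize 2 ^ n = P at *
    have e1 := Nat.div_add_mod (J + P - k + r) P
    have l4 := Nat.mod_lt (J + P - k + r) (show 0 < P by omega)
    -- The number is below `3 * P`, so at most two multiples of `P` are removed by the reduction,
    -- and the three cases are checked separately.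
    have l5 : (J + P - k + r) / P ≤ 2 := by
      rw [← Nat.lt_succ_iff, Nat.div_lt_iff_lt_mul (by omega)]; omega
    generalize (J + P - k + r) % P = R at *
    generalize (J + P - k + r) / P = D at *
    have : (R + P - r + k) % P = J := by
      interval_cases D
      · have : R + P - r + k = J + P + P := by omega
        rw [this, Nat.add_mod_right, Nat.add_mod_right, Nat.mod_eq_of_lt l1]
      · have : R + P - r + k = J + P := by omega
        rw [this, Nat.add_mod_right, Nat.mod_eq_of_lt l1]
      · have : R + P - r + k = J := by omega
        rw [this, Nat.mod_eq_of_lt l1]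
    exact this

/-- The digit, chosen by the index register, of the left or of the right (depending on the flag)
end of the element. -/
def MeshWires.digit (L : MeshWires Q n m ν) (p : ℕ) (x : Basis Q) : Fin 2 :=
  if regVal L.idx x < n then
    nbit (regVal L.data x + 2 ^ n - regVal L.col x + (x L.flag : ℕ) * p) (regVal L.idx x) else 0

/-- All `m` digits of `p = 2 ^ m - 1` are 1, so `m` copies of one bit spell `0` or `p`. The flag
thus selects the left or right end of the element without a multiplication. -/
theorem regVal_const (hm : p + 1 = 2 ^ m) (v : Q) (x : Basis Q) :
    regVal (fun _ : Fin m => v) x = (x v : ℕ) * p := by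
  have h : ∀ b : Fin 2, (finFunctionFinEquiv (fun _ : Fin m => b) : ℕ) = (b : ℕ) * p := by
    intro b
    rcases fin_two_cases b with rfl | rfl
    · have := finFunction_nbit (w := m) (N := 0) (by positivity)
      simp only [nbit_eq_zero (Nat.two_pow_pos _)] at this
      rw [this, Fin.val_zero, zero_mul]
    · have := finFunction_nbit (w := m) (N := p) (by omega)
      rw [Fin.val_one, one_mul]
      refine Eq.trans ?_ this
      congr 2
      funext i
      rw [show p = 2 ^ m - 1 - 0 by omega, nbit_compl i (by positivity) i.2,
        nbit_eq_zero (by positivity)]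
      rfl
  exact h (x v)

/-- The sign of the digit, on the mesh and when the control qubit is `0`. -/
theorem MeshWires.impl_digitSign (hmn : m ≤ n) (hp : 1 ≤ p) (hm : p + 1 = 2 ^ m)
    (hK : 2 ^ n = K * p + 1) (hν : n ≤ 2 ^ ν) :
    Impl (400 * (n * p) + 400 + 16 * 2 ^ ν) (signOp fun x : Basis Q =>
      (x L.ctrl + 1) * (L.ok p K x * L.digit p x)) := by
  have h1 := (L.derSet_ok hmn hp hm hK).trans (((derSet_regVal (fun _ : Fin m => L.flag) n).mono
    Set.subset_union_left le_rfl le_rfl).trans (derSet_add (w := n)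
      (fun x => regVal L.data x + 2 ^ n - regVal L.col x) (regVal fun _ : Fin m => L.flag) 0
      (by norm_num) (fun i hi => Or.inl (Or.inr (Or.inr ⟨i, Nat.lt_succ_of_lt hi, rfl⟩)))
      (fun i hi => Or.inr ⟨i, hi, rfl⟩)))
  have h2 := h1.trans ((derSet_oneHot L.idx).mono Set.subset_union_left le_rfl le_rfl)
  have h3 := h2.trans_der (f := fun x => (x L.ctrl + 1) * (L.ok p K x * L.digit p x))
    (c' := n * 3 + 9) ?_
  · have h4 := (h3 _ _ le_rfl computes_base).impl_signOp (Or.inl rfl)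
    refine h4.mono ?_
    have : n ≤ n * p := Nat.le_mul_of_pos_right n hp
    omega
  · have hdig : (L.digit p) = fun x => ∑ i ∈ Finset.range n,
        (if regVal L.idx x = i then 1 else 0) * nbit (regVal L.data x + 2 ^ n - regVal L.col x +
          regVal (fun _ : Fin m => L.flag) x + 0) i := by
      funext x
      rw [MeshWires.digit, add_zero, regVal_const hm]
      simp only [ite_mul, one_mul, zero_mul]
      rw [Finset.sum_ite_eq]
      simp only [Finset.mem_range]
    rw [hdig]
    refine Der.mono ?_ le_rfl (show 0 + 3 + (0 + ((Finset.range n).card * (1 + 2) + 4) + 1) + 1 ≤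
      n * 3 + 9 by rw [Finset.card_range]; omega)
    refine Der.mul (c := 0 + 3) (Der.not (der_mem (Or.inl ⟨L.ctrl, rfl⟩)))
      (Der.mul (c := 0) (der_mem (Or.inr (Or.inl (Or.inl (Or.inl rfl)))))
        (der_sum (c := 1) (Finset.range n) (fun i x => (if regVal L.idx x = i then 1 else 0) *
          nbit (regVal L.data x + 2 ^ n - regVal L.col x +
            regVal (fun _ : Fin m => L.flag) x + 0) i) fun i hi => ?_))
    have hi' := Finset.mem_range.1 hi
    refine Der.mul (c := 0) (c' := 0) (der_mem ?_) (der_mem ?_)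
    · exact Or.inr (Or.inr ⟨i, hi'.trans_le hν, rfl⟩)
    · exact Or.inr (Or.inl (Or.inr (Or.inr ⟨i, hi', rfl⟩)))

/-- The sign of the zero state of some wires. -/
theorem impl_zeroSign (T : Finset Q) :
    Impl (8 * T.card + 3) (signOp fun x : Basis Q => if ∀ v ∈ T, x v = 0 then 1 else 0) := by
  have h1 := der_prod (S := wires Q) (c := 3) T (fun v x => x v + 1)
    (fun v _ => Der.not (c := 0) (der_mem ⟨v, rfl⟩))
  have h2 := (h1 _ _ le_rfl computes_base).impl_signOp (Or.inl rfl)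
  convert h2.mono (N' := 8 * T.card + 3) (by omega) using 2
  funext x
  have h : ∀ a : Fin 2, a = 0 ↔ a + 1 = 1 := by decide
  by_cases hx : ∀ v ∈ T, x v = 0
  · rw [if_pos hx, if_pos fun v hv => (h _).1 (hx v hv)]
  · rw [if_neg hx, if_neg fun h' => hx fun v hv => (h _).2 (h' v hv)]

end Mesh

end QuFEM
end

noncomputable section
namespace QuFEM

/-! ### Fejér-Riesz factorization on an interval -/

section FejerRiesz

/-- Continuity, since no point of the interval is isolated. It is applied after a factor vanishing
at `ρ` has been divided out, when the sign is known only away from `ρ`. -/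
theorem eval_nonneg_of_ne {k : ℝ[X]} (ρ : ℝ)
    (h : ∀ x ∈ Set.Icc (-1 : ℝ) 1, x ≠ ρ → 0 ≤ k.eval x) :
    ∀ x ∈ Set.Icc (-1 : ℝ) 1, 0 ≤ k.eval x := by
  intro x hx
  by_contra hneg
  push Not at hneg
  obtain ⟨δ, hδ, hk⟩ := Metric.continuousAt_iff.1 (k.continuous.continuousAt (x := x))
    (-k.eval x) (by linarith)
  have key : ∀ y ∈ Set.Icc (-1 : ℝ) 1, |y - x| < δ → y = ρ := by
    intro y hy hyx
    by_contra hne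
    have h1 := hk (by rwa [Real.dist_eq])
    rw [Real.dist_eq] at h1
    have h2 := h y hy hne
    have := (abs_lt.1 h1).2
    linarith
  have hx' : x = ρ := key x hx (by simpa using hδ)
  set s := min (δ / 2) 1 with hs
  have hs0 : 0 < s := lt_min (by linarith) one_pos
  have hsδ : s < δ := lt_of_le_of_lt (min_le_left _ _) (by linarith)
  have hs1 : s ≤ 1 := min_le_right _ _
  rcases le_total 0 x with h0 | h0
  · have := key (x - s) ⟨by linarith, by linarith [hx.2]⟩
      (by rw [sub_sub_cancel_left, abs_neg, abs_of_pos hs0]; exact hsδ)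
    linarith
  · have := key (x + s) ⟨by linarith [hx.1], by linarith⟩
      (by rw [add_sub_cancel_left, abs_of_pos hs0]; exact hsδ)
    linarith

/-- The polynomial with the values `z * (re z - ζ)` on the unit circle. -/
def circleFactor (ζ : ℂ) : ℂ[X] := C (1 / 2) * (X ^ 2 + 1) - C ζ * X

theorem sq_add_one_of_norm {z : ℂ} (hz : ‖z‖ = 1) : z ^ 2 + 1 = 2 * (z.re * z) := by
  have h1 : z * (starRingEnd ℂ) z = 1 := by
    rw [Complex.mul_conj, Complex.normSq_eq_norm_sq, hz]; simp
  have h2 : z + (starRingEnd ℂ) z = 2 * z.re := by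
    rw [Complex.add_conj]; push_cast; ring
  linear_combination z * h2 - h1

theorem norm_eval_circleFactor (ζ : ℂ) {z : ℂ} (hz : ‖z‖ = 1) :
    ‖(circleFactor ζ).eval z‖ = ‖(z.re : ℂ) - ζ‖ := by
  have : (circleFactor ζ).eval z = z * (z.re - ζ) := by
    simp only [circleFactor, eval_sub, eval_mul, eval_C, eval_add, eval_pow, eval_X, eval_one]
    rw [sq_add_one_of_norm hz]; ring
  rw [this, norm_mul, hz, one_mul]

theorem natDegree_circleFactor (ζ : ℂ) : (circleFactor ζ).natDegree ≤ 2 := by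
  unfold circleFactor; compute_degree

theorem re_mem_Icc {z : ℂ} (hz : ‖z‖ = 1) : z.re ∈ Set.Icc (-1 : ℝ) 1 :=
  abs_le.1 (hz ▸ Complex.abs_re_le_norm z)

/-- With `w` the larger solution of `w + 1 / w = 2 * |ρ|` and `s` the sign of `ρ`, on the unit
circle `|z - s w| ^ 2 = 2 w |re z - ρ|`. A root outside the open interval therefore costs only one
degree. -/
theorem exists_linear_factor {ρ : ℝ} (hρ : 1 ≤ |ρ|) : ∃ F : ℂ[X], F.natDegree ≤ 1 ∧
    ∀ z : ℂ, ‖z‖ = 1 → ‖F.eval z‖ ^ 2 = |z.re - ρ| := by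
  set a := |ρ| with ha
  set w := a + √(a ^ 2 - 1) with hw
  have hs : √(a ^ 2 - 1) ^ 2 = a ^ 2 - 1 := Real.sq_sqrt (by nlinarith)
  have hw0 : 0 < w := by positivity
  have hwq : w ^ 2 + 1 = 2 * w * a := by rw [hw]; nlinarith
  obtain ⟨s, hs2, hsρ⟩ : ∃ s : ℝ, s ^ 2 = 1 ∧ ρ = s * a := by
    rcases abs_cases ρ with h | h
    · exact ⟨1, by norm_num, by rw [ha, h.1]; ring⟩
    · exact ⟨-1, by norm_num, by rw [ha, h.1]; ring⟩
  refine ⟨C (((√(2 * w))⁻¹ : ℝ) : ℂ) * (X - C ((s * w : ℝ) : ℂ)), ?_, ?_⟩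
  · compute_degree
  · intro z hz
    have hre := re_mem_Icc hz
    simp only [eval_mul, eval_C, eval_sub, eval_X]
    rw [norm_mul, mul_pow, Complex.norm_real, Real.norm_eq_abs, sq_abs, inv_pow,
      Real.sq_sqrt (by positivity), ← Complex.normSq_eq_norm_sq, Complex.normSq_apply]
    simp only [Complex.sub_re, Complex.ofReal_re, Complex.sub_im, Complex.ofReal_im, sub_zero]
    have hz2 : z.re * z.re + z.im * z.im = 1 := by
      rw [← Complex.normSq_apply, Complex.normSq_eq_norm_sq, hz]; norm_num
    have h1 : (z.re - s * w) * (z.re - s * w) + z.im * z.im = 2 * w * (a - s * z.re) := by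
      linear_combination hz2 + w ^ 2 * hs2 + hwq
    have h2 : |z.re - ρ| = a - s * z.re := by
      have h3 : |z.re - ρ| = |s * z.re - a| := by
        have : z.re - ρ = s * (s * z.re - a) := by
          rw [hsρ]; linear_combination -z.re * hs2
        have hsa : |s| = 1 := by
          rw [← abs_one, ← sq_eq_sq_iff_abs_eq_abs, hs2, one_pow]
        rw [this, abs_mul, hsa, one_mul]
      rw [h3, abs_of_nonpos]
      · ring
      · have : |s * z.re| ≤ 1 := by
          have hsa : |s| = 1 := by
            rw [← abs_one, ← sq_eq_sq_iff_abs_eq_abs, hs2, one_pow]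
          rw [abs_mul, hsa, one_mul]; exact abs_le.2 hre
        have := (abs_le.1 this).2
        linarith
    rw [h1, h2, ← mul_assoc, inv_mul_cancel₀ (by positivity), one_mul]

/-- Fejér-Riesz: a polynomial which is nonnegative on `[-1, 1]` is, as a function of the real part,
a squared modulus on the unit circle. -/
theorem fejerRiesz (d : ℕ) : ∀ g : ℝ[X], g.natDegree ≤ d →
    (∀ x ∈ Set.Icc (-1 : ℝ) 1, 0 ≤ g.eval x) →
    ∃ Q : ℂ[X], Q.natDegree ≤ d ∧ ∀ z : ℂ, ‖z‖ = 1 → ‖Q.eval z‖ ^ 2 = g.eval z.re := by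
  induction d using Nat.strong_induction_on with
  | _ d ih =>
  intro g hd hg
  by_cases hdeg : g.natDegree = 0
  · rw [eq_C_of_natDegree_eq_zero hdeg] at hg ⊢
    refine ⟨C ((√(g.coeff 0) : ℝ) : ℂ), by simp, fun z _ => ?_⟩
    have := hg 0 (by simp)
    rw [eval_C] at this
    rw [eval_C, eval_C, Complex.norm_real, Real.norm_eq_abs, sq_abs, Real.sq_sqrt this]
  have hg0 : g ≠ 0 := by rintro rfl; simp at hdeg
  obtain ⟨ζ, hζ⟩ := Complex.exists_root (f := g.map (algebraMap ℝ ℂ)) (by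
    rw [degree_map]; exact natDegree_pos_iff_degree_pos.1 (Nat.pos_of_ne_zero hdeg))
  have hζ' : aeval ζ g = 0 := by rwa [IsRoot, eval_map_algebraMap] at hζ
  -- A quadratic factor `|x - ζ| ^ 2` costs two degrees, through `circleFactor ζ`. It serves both
  -- nonreal roots and double roots inside the interval.
  have quad : ∀ k : ℝ[X], 2 ≤ d → g = (X ^ 2 - C (2 * ζ.re) * X + C (‖ζ‖ ^ 2)) * k →
      (∀ x ∈ Set.Icc (-1 : ℝ) 1, 0 ≤ k.eval x) → k.natDegree + 2 ≤ d →
      ∃ Q : ℂ[X], Q.natDegree ≤ d ∧ ∀ z : ℂ, ‖z‖ = 1 → ‖Q.eval z‖ ^ 2 = g.eval z.re := by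
    intro k h2 hgk hk hkd
    obtain ⟨Q, hQ, hQ'⟩ := ih (d - 2) (by omega) k (by omega) hk
    refine ⟨circleFactor ζ * Q, ?_, ?_⟩
    · refine natDegree_mul_le.trans ?_
      have := natDegree_circleFactor ζ
      omega
    · intro z hz
      rw [eval_mul, norm_mul, mul_pow, hQ' z hz, norm_eval_circleFactor ζ hz, hgk, eval_mul]
      congr 1
      rw [← Complex.normSq_eq_norm_sq, Complex.normSq_apply]
      simp only [Complex.sub_re, Complex.ofReal_re, Complex.sub_im, Complex.ofReal_im, zero_sub,
        eval_add, eval_sub, eval_pow, eval_X, eval_mul, eval_C, ← Complex.normSq_eq_norm_sq]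
      rw [Complex.normSq_apply]
      ring
  by_cases him : ζ.im = 0
  · have hρ : g.IsRoot ζ.re := by
      have : ζ = algebraMap ℝ ℂ ζ.re := by
        apply Complex.ext <;> simp [him]
      rw [this, aeval_algebraMap_apply] at hζ'
      simpa using hζ'
    set ρ := ζ.re with hρd
    obtain ⟨h, hh⟩ := dvd_iff_isRoot.2 hρ
    have hne : h ≠ 0 := by rintro rfl; simp at hh; exact hg0 hh
    have hdh : h.natDegree + 1 = g.natDegree := by
      rw [hh, natDegree_mul (X_sub_C_ne_zero ρ) hne, natDegree_X_sub_C, add_comm]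
    rcases le_or_gt 1 |ρ| with h1 | h1
    · obtain ⟨F, hF, hF'⟩ := exists_linear_factor h1
      -- A root outside the open interval gives `x - ρ` a fixed sign there, so `k` will be the
      -- quotient `h` or its negative.
      have hfin : ∀ k : ℝ[X], k.natDegree ≤ h.natDegree →
          (∀ x ∈ Set.Icc (-1 : ℝ) 1, g.eval x = |x - ρ| * k.eval x) →
          ∃ Q : ℂ[X], Q.natDegree ≤ d ∧ ∀ z : ℂ, ‖z‖ = 1 → ‖Q.eval z‖ ^ 2 = g.eval z.re := by
        intro k hk hgk
        have hk0 : ∀ x ∈ Set.Icc (-1 : ℝ) 1, 0 ≤ k.eval x :=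
          eval_nonneg_of_ne ρ fun x hx hxρ => by
            have h2 := hg x hx
            rw [hgk x hx] at h2
            exact nonneg_of_mul_nonneg_right h2 (abs_pos.2 (sub_ne_zero.2 hxρ))
        obtain ⟨Q, hQ, hQ'⟩ := ih (d - 1) (by omega) k (by omega) hk0
        refine ⟨F * Q, natDegree_mul_le.trans (by omega), fun z hz => ?_⟩
        rw [eval_mul, norm_mul, mul_pow, hF' z hz, hQ' z hz, hgk _ (re_mem_Icc hz)]
      rcases le_total 0 ρ with h0 | h0
      · rw [abs_of_nonneg h0] at h1
        refine hfin (-h) (by simp) fun x hx => ?_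
        rw [abs_of_nonpos (by linarith [hx.2]), hh]
        simp only [eval_mul, eval_sub, eval_X, eval_C, eval_neg]
        ring
      · rw [abs_of_nonpos h0] at h1
        refine hfin h le_rfl fun x hx => ?_
        rw [abs_of_nonneg (by linarith [hx.1]), hh]
        simp
    -- A root in the open interval is a minimum of the nonnegative function `g`, hence at least
    -- double.
    · have hmin : IsLocalMin (fun x => g.eval x) ρ := by
        filter_upwards [Icc_mem_nhds (abs_lt.1 h1).1 (abs_lt.1 h1).2] with x hx
        rw [hρ.eq_zero]
        exact hg x hx
      have hder := hmin.deriv_eq_zero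
      rw [Polynomial.deriv, hh] at hder
      simp only [derivative_mul, derivative_sub, derivative_X, derivative_C, sub_zero, one_mul,
        eval_add, eval_mul, eval_sub, eval_X, eval_C, sub_self, zero_mul, add_zero] at hder
      obtain ⟨k, hk⟩ := dvd_iff_isRoot.2 hder
      have hkne : k ≠ 0 := by rintro rfl; simp at hk; exact hne hk
      have hdk : k.natDegree + 1 = h.natDegree := by
        rw [hk, natDegree_mul (X_sub_C_ne_zero ρ) hkne, natDegree_X_sub_C, add_comm]
      have hgk : g = (X ^ 2 - C (2 * ρ) * X + C (‖ζ‖ ^ 2)) * k := by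
        rw [hh, hk, ← Complex.normSq_eq_norm_sq, Complex.normSq_apply, him, ← hρd]
        simp only [mul_zero, add_zero, C_mul]
        rw [show C (2 : ℝ) = 2 from rfl]
        ring
      refine quad k (by omega) hgk ?_ (by omega)
      refine eval_nonneg_of_ne ρ fun x hx hxρ => ?_
      have h2 := hg x hx
      have h3 : g.eval x = (x - ρ) ^ 2 * k.eval x := by
        rw [hh, hk]; simp; ring
      rw [h3] at h2
      exact nonneg_of_mul_nonneg_right h2 (by have := sub_ne_zero.2 hxρ; positivity)
  · obtain ⟨k, hk⟩ := quadratic_dvd_of_aeval_eq_zero_im_ne_zero g hζ' him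
    have hkne : k ≠ 0 := by rintro rfl; simp at hk; exact hg0 hk
    have hdq : (X ^ 2 - C (2 * ζ.re) * X + C (‖ζ‖ ^ 2) : ℝ[X]).natDegree = 2 := by compute_degree!
    have hqne : (X ^ 2 - C (2 * ζ.re) * X + C (‖ζ‖ ^ 2) : ℝ[X]) ≠ 0 := by
      intro h; rw [h] at hdq; simp at hdq
    have hdk : k.natDegree + 2 = g.natDegree := by
      rw [hk, natDegree_mul hqne hkne, hdq, add_comm]
    refine quad k (by omega) hk (fun x hx => ?_) (by omega)
    have h2 := hg x hx
    rw [hk, eval_mul] at h2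
    refine nonneg_of_mul_nonneg_right h2 ?_
    simp only [eval_add, eval_sub, eval_pow, eval_X, eval_mul, eval_C]
    rw [← Complex.normSq_eq_norm_sq, Complex.normSq_apply]
    have : 0 < ζ.im ^ 2 := by positivity
    nlinarith [sq_nonneg (x - ζ.re)]

end FejerRiesz

/-! ### Generalized quantum signal processing -/

section Gqsp

/-- The pairs of polynomials obtained from `(1, 0)` by unitary matrices, alternating with the
multiplication of the first polynomial by `X`. -/
inductive Gqsp : ℕ → ℂ[X] → ℂ[X] → Prop
  | base (u : Matrix (Fin 2) (Fin 2) ℂ) (hu : u ∈ Matrix.unitaryGroup (Fin 2) ℂ) :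
      Gqsp 0 (C (u 0 0)) (C (u 1 0))
  | step {d : ℕ} {P Q : ℂ[X]} (h : Gqsp d P Q) (u : Matrix (Fin 2) (Fin 2) ℂ)
      (hu : u ∈ Matrix.unitaryGroup (Fin 2) ℂ) :
      Gqsp (d + 1) (C (u 0 0) * (X * P) + C (u 0 1) * Q) (C (u 1 0) * (X * P) + C (u 1 1) * Q)

theorem mem_unitary_two (a b : ℂ) (h : ‖a‖ ^ 2 + ‖b‖ ^ 2 = 1) :
    !![a, -star b; b, star a] ∈ Matrix.unitaryGroup (Fin 2) ℂ := by
  have h1 : star a * a + star b * b = 1 := by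
    have e : ∀ c : ℂ, star c * c = ((‖c‖ ^ 2 : ℝ) : ℂ) := by
      intro c
      rw [← Complex.normSq_eq_norm_sq, Complex.normSq_eq_conj_mul_self]; rfl
    rw [e, e, ← Complex.ofReal_add, h, Complex.ofReal_one]
  rw [Matrix.mem_unitaryGroup_iff']
  ext i j
  fin_cases i <;> fin_cases j <;>
    simp [Matrix.mul_apply, Fin.sum_univ_two] at h1 ⊢ <;>
    first | linear_combination h1 | ring

/-- The first column is the direction of `(a, b)` and the second is orthogonal to it. Stating this
through multiplication by the norm `r` includes the case `a = b = 0`, where any unitary will do. -/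
theorem exists_unitary_two (a b : ℂ) : ∃ u ∈ Matrix.unitaryGroup (Fin 2) ℂ,
    ∃ r : ℝ, u 0 0 * r = a ∧ u 1 0 * r = b ∧ u 0 1 * r = - star b ∧ u 1 1 * r = star a ∧
      (r = 0 → a = 0 ∧ b = 0) := by
  set r := √(‖a‖ ^ 2 + ‖b‖ ^ 2) with hr
  have hr2 : r ^ 2 = ‖a‖ ^ 2 + ‖b‖ ^ 2 := Real.sq_sqrt (by positivity)
  by_cases h : r = 0
  · have h0 : a = 0 ∧ b = 0 := by
      rw [h] at hr2
      have h1 : ‖a‖ ^ 2 = 0 := by nlinarith [sq_nonneg ‖a‖, sq_nonneg ‖b‖]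
      have h2 : ‖b‖ ^ 2 = 0 := by nlinarith [sq_nonneg ‖a‖, sq_nonneg ‖b‖]
      exact ⟨by simpa using h1, by simpa using h2⟩
    refine ⟨1, one_mem _, 0, ?_⟩
    simp [h0.1, h0.2]
  · refine ⟨_, mem_unitary_two (a / r) (b / r) ?_, r, ?_⟩
    · rw [norm_div, norm_div, div_pow, div_pow, ← add_div, Complex.norm_real, Real.norm_eq_abs,
        sq_abs, hr2, div_self]
      rw [← hr2]; exact pow_ne_zero 2 h
    · have hc : (r : ℂ) ≠ 0 := by exact_mod_cast h
      simp [h, hc]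

/-- On the unit circle conjugation is inversion, so reversing the conjugated coefficients expresses
the conjugate value by a polynomial. -/
theorem eval_reflect_conj {z : ℂ} (hz : ‖z‖ = 1) {d : ℕ} {P : ℂ[X]} (hP : P.natDegree ≤ d) :
    (reflect d (P.map (starRingEnd ℂ))).eval z = z ^ d * star (P.eval z) := by
  have hz0 : z ≠ 0 := by rintro rfl; simp at hz
  let _ : Invertible (z⁻¹) := invertibleOfNonzero (inv_ne_zero hz0)
  have h1 := eval₂_reflect_mul_pow (RingHom.id ℂ) (z⁻¹) d (P.map (starRingEnd ℂ))
    (natDegree_map_le.trans hP)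
  rw [invOf_eq_inv, inv_inv, ← eval, inv_pow] at h1
  have hc : z⁻¹ = star z := by
    rw [Complex.inv_def, Complex.normSq_eq_norm_sq, hz]; simp
  have h2 : eval₂ (RingHom.id ℂ) z⁻¹ (P.map (starRingEnd ℂ)) = star (P.eval z) := by
    rw [hc, ← eval]
    exact eval_map_apply (starRingEnd ℂ) z
  rw [h2] at h1
  rw [← h1]
  field_simp

/-- The norm condition is the polynomial identity `P P* + Q Q* = X ^ d` with reversed conjugates,
because it holds at infinitely many points. The claim is its coefficient of degree `2 * d`, to which
`X ^ d` contributes nothing as `d ≠ 0`. -/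
theorem coeff_orthogonal {d : ℕ} (hd : d ≠ 0) {P Q : ℂ[X]} (hP : P.natDegree ≤ d)
    (hQ : Q.natDegree ≤ d) (h : ∀ z : ℂ, ‖z‖ = 1 → ‖P.eval z‖ ^ 2 + ‖Q.eval z‖ ^ 2 = 1) :
    P.coeff d * star (P.coeff 0) + Q.coeff d * star (Q.coeff 0) = 0 := by
  have key : P * reflect d (P.map (starRingEnd ℂ)) + Q * reflect d (Q.map (starRingEnd ℂ)) -
      X ^ d = 0 := by
    refine eq_zero_of_infinite_isRoot _ (Set.Infinite.mono (s := Metric.sphere (0 : ℂ) 1) ?_ ?_)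
    · intro z hz
      have hz' : ‖z‖ = 1 := by simpa using hz
      have e : ∀ c : ℂ, c * star c = ((‖c‖ ^ 2 : ℝ) : ℂ) := by
        intro c
        rw [← Complex.normSq_eq_norm_sq, ← Complex.mul_conj]; rfl
      simp only [Set.mem_ofPred_eq, IsRoot, eval_sub, eval_add, eval_mul, eval_pow, eval_X,
        eval_reflect_conj hz' hP, eval_reflect_conj hz' hQ]
      have h1 := e (P.eval z)
      have h2 := e (Q.eval z)
      have h3 : ((‖P.eval z‖ ^ 2 : ℝ) : ℂ) + ((‖Q.eval z‖ ^ 2 : ℝ) : ℂ) = 1 := by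
        rw [← Complex.ofReal_add, h z hz', Complex.ofReal_one]
      linear_combination z ^ d * h1 + z ^ d * h2 + z ^ d * h3
    · refine Set.infinite_of_injective_forall_mem (f := fun n : ℕ => ((Circle.exp n : Circle) : ℂ))
        ?_ ?_
      · intro a b hab
        have h1 : Circle.exp (a : ℝ) = Circle.exp (b : ℝ) := Circle.coe_injective hab
        obtain ⟨k, hk⟩ := Circle.exp_eq_exp.1 h1
        by_contra hne
        have hk0 : k ≠ 0 := by
          rintro rfl
          apply hne
          simpa using hk
        -- The points with integer arguments are distinct: a coincidence would make `π` rational.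
        have hpi : Real.pi = (((a : ℤ) - b : ℤ) / (2 * k : ℤ) : ℚ) := by
          push_cast
          have : (k : ℝ) ≠ 0 := by exact_mod_cast hk0
          field_simp
          linarith
        exact irrational_pi ⟨_, hpi.symm⟩
      · intro n; exact mem_sphere_zero_iff_norm.2 (Circle.norm_coe _)
  have hr : ∀ {F : ℂ[X]}, F.natDegree ≤ d → (reflect d (F.map (starRingEnd ℂ))).natDegree ≤ d := by
    intro F hF
    exact (natDegree_reflect_le).trans (max_le le_rfl (natDegree_map_le.trans hF))
  have hc := congrArg (fun F => F.coeff (d + d)) key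
  simp only [coeff_sub, coeff_add, coeff_zero, coeff_mul_add_eq_of_natDegree_le hP (hr hP),
    coeff_mul_add_eq_of_natDegree_le hQ (hr hQ), coeff_reflect, revAt_le le_rfl, Nat.sub_self,
    coeff_map, coeff_X_pow] at hc
  rw [if_neg (by omega), sub_zero] at hc
  exact hc

/-- Peeling: a unitary is chosen that removes the constant coefficient of the first polynomial and
the top coefficient of the second. The first can then be divided by `X`, both degrees drop to `d`,
and the norm condition is kept since the matrix is unitary and `|z| = 1`. -/
theorem gqsp_of_norm (d : ℕ) : ∀ P Q : ℂ[X], P.natDegree ≤ d → Q.natDegree ≤ d →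
    (∀ z : ℂ, ‖z‖ = 1 → ‖P.eval z‖ ^ 2 + ‖Q.eval z‖ ^ 2 = 1) → Gqsp d P Q := by
  induction d with
  | zero =>
    intro P Q hP hQ h
    rw [eq_C_of_natDegree_le_zero hP, eq_C_of_natDegree_le_zero hQ] at h ⊢
    have h1 := h 1 (by simp)
    rw [eval_C, eval_C] at h1
    exact Gqsp.base _ (mem_unitary_two _ _ h1)
  | succ d ih =>
    intro P Q hP hQ h
    have hort := coeff_orthogonal (Nat.succ_ne_zero d) hP hQ h
    obtain ⟨u, hu, hA, hB⟩ : ∃ u ∈ Matrix.unitaryGroup (Fin 2) ℂ,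
        star (u 0 0) * P.coeff 0 + star (u 1 0) * Q.coeff 0 = 0 ∧
        star (u 0 1) * P.coeff (d + 1) + star (u 1 1) * Q.coeff (d + 1) = 0 := by
      -- The first column follows the vector of top coefficients: the second column annihilates that
      -- vector, and the first annihilates the constant coefficients by `hort`. If the top
      -- coefficients vanish, the constant ones determine the matrix; if these vanish too, nothing
      -- is required of it.
      obtain ⟨u, hu, r, h1, h2, h3, h4, h5⟩ := exists_unitary_two (P.coeff (d + 1))
        (Q.coeff (d + 1))
      by_cases hr : r = 0
      · obtain ⟨u', hu', r', h1', h2', h3', h4', h5'⟩ := exists_unitary_two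
          (-star (Q.coeff 0)) (star (P.coeff 0))
        by_cases hr' : r' = 0
        · refine ⟨u, hu, ?_, ?_⟩
          · obtain ⟨ha, hb⟩ := h5' hr'
            rw [neg_eq_zero, star_eq_zero] at ha
            rw [star_eq_zero] at hb
            rw [ha, hb]; ring
          · obtain ⟨ha, hb⟩ := h5 hr
            rw [ha, hb]; ring
        · refine ⟨u', hu', ?_, ?_⟩
          · have hc : (r' : ℂ) ≠ 0 := by exact_mod_cast hr'
            have e1 := congrArg star h1'
            have e2 := congrArg star h2'
            simp only [star_mul', star_neg, star_star] at e1 e2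
            have er : star (r' : ℂ) = r' := Complex.conj_ofReal r'
            rw [er] at e1 e2
            apply mul_right_cancel₀ hc
            linear_combination P.coeff 0 * e1 + Q.coeff 0 * e2
          · obtain ⟨ha, hb⟩ := h5 hr
            rw [ha, hb]; ring
      · refine ⟨u, hu, ?_, ?_⟩
        · have hc : (r : ℂ) ≠ 0 := by exact_mod_cast hr
          have e1 := congrArg star h1
          have e2 := congrArg star h2
          have e3 := congrArg star hort
          simp only [star_mul', star_add, star_star, star_zero] at e1 e2 e3
          have er : star (r : ℂ) = r := Complex.conj_ofReal r
          rw [er] at e1 e2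
          apply mul_right_cancel₀ hc
          linear_combination P.coeff 0 * e1 + Q.coeff 0 * e2 + e3
        · have hc : (r : ℂ) ≠ 0 := by exact_mod_cast hr
          have e1 := congrArg star h3
          have e2 := congrArg star h4
          simp only [star_mul', star_neg, star_star] at e1 e2
          have er : star (r : ℂ) = r := Complex.conj_ofReal r
          rw [er] at e1 e2
          apply mul_right_cancel₀ hc
          linear_combination P.coeff (d + 1) * e1 + Q.coeff (d + 1) * e2
    set A := C (star (u 0 0)) * P + C (star (u 1 0)) * Q with hAd
    set B := C (star (u 0 1)) * P + C (star (u 1 1)) * Q with hBd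
    have hu1 := Matrix.mem_unitaryGroup_iff.1 hu
    have hu2 := Matrix.mem_unitaryGroup_iff'.1 hu
    have o : ∀ i j, u i 0 * star (u j 0) + u i 1 * star (u j 1) = (1 : Matrix _ _ ℂ) i j := by
      intro i j
      rw [← hu1, Matrix.mul_apply, Fin.sum_univ_two]; rfl
    have hPA : P = C (u 0 0) * A + C (u 0 1) * B := by
      have e1 := congrArg C (o 0 0)
      have e2 := congrArg C (o 0 1)
      simp only [C_add, C_mul, Matrix.one_apply_eq, Matrix.one_apply_ne zero_ne_one, C_1, C_0]
        at e1 e2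
      rw [hAd, hBd]
      linear_combination -P * e1 - Q * e2
    have hQA : Q = C (u 1 0) * A + C (u 1 1) * B := by
      have e1 := congrArg C (o 1 0)
      have e2 := congrArg C (o 1 1)
      simp only [C_add, C_mul, Matrix.one_apply_eq, Matrix.one_apply_ne one_ne_zero, C_1, C_0]
        at e1 e2
      rw [hAd, hBd]
      linear_combination -P * e1 - Q * e2
    have hA0 : A.coeff 0 = 0 := by
      rw [hAd, coeff_add, coeff_C_mul, coeff_C_mul]; exact hA
    have hAX : X * A.divX = A := by
      conv_rhs => rw [← X_mul_divX_add A, hA0, C_0, add_zero]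
    have hAdeg : A.natDegree ≤ d + 1 :=
      natDegree_add_le_of_degree_le ((natDegree_C_mul_le _ _).trans hP)
        ((natDegree_C_mul_le _ _).trans hQ)
    have hBdeg : B.natDegree ≤ d := by
      have h1 : B.natDegree ≤ d + 1 := natDegree_add_le_of_degree_le
        ((natDegree_C_mul_le _ _).trans hP) ((natDegree_C_mul_le _ _).trans hQ)
      refine natDegree_le_pred h1 ?_
      rw [hBd, coeff_add, coeff_C_mul, coeff_C_mul]; exact hB
    have hG := ih A.divX B (by rw [natDegree_divX_eq_natDegree_tsub_one]; omega) hBdeg ?_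
    · have := hG.step u hu
      rwa [hAX, ← hPA, ← hQA] at this
    · intro z hz
      rw [← h z hz]
      have hAz : A.eval z = z * A.divX.eval z := by
        conv_lhs => rw [← hAX]
        simp
      have hn : ‖A.divX.eval z‖ = ‖A.eval z‖ := by rw [hAz, norm_mul, hz, one_mul]
      rw [hn]
      have e : ∀ c : ℂ, ((‖c‖ ^ 2 : ℝ) : ℂ) = c * star c := by
        intro c
        rw [← Complex.normSq_eq_norm_sq, ← Complex.mul_conj]; rfl
      have hcast : (((‖A.eval z‖ ^ 2 + ‖B.eval z‖ ^ 2 : ℝ)) : ℂ) =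
          ((‖P.eval z‖ ^ 2 + ‖Q.eval z‖ ^ 2 : ℝ) : ℂ) := by
        rw [Complex.ofReal_add, Complex.ofReal_add, e, e, e, e]
        simp only [hAd, hBd, eval_add, eval_mul, eval_C, star_add, star_mul', star_star]
        have o00 := o 0 0
        have o01 := o 0 1
        have o10 := o 1 0
        have o11 := o 1 1
        simp only [Matrix.one_apply_eq, Matrix.one_apply_ne zero_ne_one,
          Matrix.one_apply_ne one_ne_zero] at o00 o01 o10 o11
        linear_combination P.eval z * star (P.eval z) * o00 + Q.eval z * star (Q.eval z) * o11 +
          Q.eval z * star (P.eval z) * o01 + P.eval z * star (Q.eval z) * o10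
      exact_mod_cast hcast

/-- The polynomial with the values `z ^ d * q (re z)` on the unit circle. -/
def circleLift (d : ℕ) (q : ℝ[X]) : ℂ[X] :=
  ∑ i ∈ Finset.range (d + 1), C ((q.coeff i : ℂ) / 2 ^ i) * ((X ^ 2 + 1) ^ i * X ^ (d - i))

theorem natDegree_circleLift (d : ℕ) (q : ℝ[X]) : (circleLift d q).natDegree ≤ 2 * d := by
  refine natDegree_sum_le_of_forall_le _ _ fun i hi => ?_
  have hi' : i ≤ d := by simpa [Nat.lt_succ_iff] using hi
  refine (natDegree_C_mul_le _ _).trans (natDegree_mul_le.trans ?_)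
  have h1 : ((X ^ 2 + 1 : ℂ[X]) ^ i).natDegree ≤ i * 2 :=
    natDegree_pow_le_of_le i (by compute_degree)
  rw [natDegree_X_pow]
  omega

theorem eval_circleLift {d : ℕ} {q : ℝ[X]} (hq : q.natDegree ≤ d) {z : ℂ} (hz : ‖z‖ = 1) :
    (circleLift d q).eval z = z ^ d * (q.eval z.re : ℝ) := by
  rw [circleLift, eval_finsetSum, eval_eq_sum_range' (Nat.lt_succ_of_le hq), Complex.ofReal_sum,
    Finset.mul_sum]
  refine Finset.sum_congr rfl fun i hi => ?_
  have hi' : i ≤ d := by simpa [Nat.lt_succ_iff] using hi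
  simp only [eval_mul, eval_C, eval_pow, eval_add, eval_X, eval_one]
  rw [sq_add_one_of_norm hz, mul_pow, mul_pow, Complex.ofReal_mul, Complex.ofReal_pow,
    ← Nat.sub_add_cancel hi', pow_add z (d - i) i, Nat.sub_add_cancel hi']
  field_simp

/-- The complementary polynomial is the Fejér-Riesz factor of `1 - q ^ 2`, which is nonnegative on
the interval; the lift of `q` has modulus `|q (re z)|` on the circle. -/
theorem exists_gqsp {d : ℕ} {q : ℝ[X]} (hq : q.natDegree ≤ d)
    (h : ∀ x ∈ Set.Icc (-1 : ℝ) 1, |q.eval x| ≤ 1) :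
    ∃ Q : ℂ[X], Gqsp (2 * d) (circleLift d q) Q := by
  obtain ⟨Q, hQ, hQ'⟩ := fejerRiesz (2 * d) (1 - q * q)
    ((natDegree_sub_le _ _).trans (max_le (by simp) (natDegree_mul_le.trans (by omega))))
    (fun x hx => by
      have h1 := h x hx
      have h2 : |q.eval x| * |q.eval x| ≤ 1 := by nlinarith [abs_nonneg (q.eval x)]
      rw [abs_mul_abs_self] at h2
      simp only [eval_sub, eval_one, eval_mul]
      linarith)
  refine ⟨Q, gqsp_of_norm _ _ _ (natDegree_circleLift d q) hQ fun z hz => ?_⟩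
  rw [hQ' z hz, eval_circleLift hq hz, norm_mul, norm_pow, hz, one_pow, one_mul, Complex.norm_real,
    Real.norm_eq_abs, sq_abs]
  simp only [eval_sub, eval_one, eval_mul]
  ring

end Gqsp

end QuFEM
end

noncomputable section
namespace QuFEM

/-! ### Block diagonal operators -/

section Blocks

variable {X A : Type} [Fintype X] [DecidableEq X] [Fintype A] [DecidableEq A]

theorem sum_basis_sum {M : Type*} [AddCommMonoid M] (F : Basis (X ⊕ A) → M) :
    ∑ s, F s = ∑ x, ∑ a, F (Sum.elim x a) := by
  rw [← Fintype.sum_prod_type' (f := fun x a => F (Sum.elim x a))]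
  exact Fintype.sum_equiv (Equiv.sumArrowEquivProdArrow X A (Fin 2)) _ _ fun s => by
    congr 1; exact (Sum.elim_comp_inl_inr s).symm

/-- The vector with the values `u` over the basis state `x`. -/
def tens (x : Basis X) (u : Basis A → ℂ) : Basis (X ⊕ A) → ℂ :=
  fun s => if s ∘ Sum.inl = x then u (s ∘ Sum.inr) else 0

theorem tens_elim (x x' : Basis X) (u : Basis A → ℂ) (a : Basis A) :
    tens x u (Sum.elim x' a) = if x' = x then u a else 0 := rfl

theorem tens_add (x : Basis X) (u v : Basis A → ℂ) : tens x (u + v) = tens x u + tens x v := by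
  funext s
  simp only [tens, Pi.add_apply]
  split_ifs <;> simp

theorem tens_smul (x : Basis X) (c : ℂ) (u : Basis A → ℂ) : tens x (c • u) = c • tens x u := by
  funext s
  simp only [tens, Pi.smul_apply]
  split_ifs <;> simp

theorem tens_ket (x : Basis X) (a : Basis A) : tens x (ket a) = ket (Sum.elim x a) := by
  funext s
  have : s = Sum.elim x a ↔ s ∘ Sum.inl = x ∧ s ∘ Sum.inr = a :=
    ⟨by rintro rfl; exact ⟨rfl, rfl⟩, fun h => by
      rw [← h.1, ← h.2]; exact (Sum.elim_comp_inl_inr s).symm⟩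
  rw [tens, ket_apply, ket_apply, if_congr this rfl rfl, ite_and]

theorem tens_eq_sum (x : Basis X) (u : Basis A → ℂ) :
    tens x u = ∑ a, u a • ket (Sum.elim x a) := by
  have h : u = ∑ a, u a • ket a := by
    funext b
    simp [Finset.sum_apply, Pi.single_apply]
  conv_lhs => rw [h]
  have hs : ∀ T : Finset (Basis A), tens x (∑ a ∈ T, u a • ket a) =
      ∑ a ∈ T, u a • ket (Sum.elim x a) := by
    intro T
    induction T using Finset.induction_on with
    | empty =>
      funext s; simp [tens]
    | insert a T ha ih => rw [Finset.sum_insert ha, Finset.sum_insert ha, tens_add, ih, tens_smul,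
        tens_ket]
  exact hs _

/-- `V` acts by `M x` over the basis state `x`. -/
def Blk (V : Op (X ⊕ A)) (M : Basis X → Op A) : Prop :=
  ∀ x a x' a', V (Sum.elim x a) (Sum.elim x' a') = if x = x' then M x a a' else 0

theorem Blk.mul {V V' : Op (X ⊕ A)} {M M' : Basis X → Op A} (h : Blk V M) (h' : Blk V' M') :
    Blk (V * V') (fun x => M x * M' x) := by
  intro x a x' a'
  rw [Matrix.mul_apply, sum_basis_sum]
  simp only [h x a, h' _ _ x' a', ite_mul, zero_mul, Finset.sum_ite_irrel, Finset.sum_const_zero,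
    Finset.sum_ite_eq, Finset.mem_univ, if_true]
  by_cases hx : x = x'
  · simp [hx, Matrix.mul_apply]
  · simp [hx]

theorem Blk.conjTranspose {V : Op (X ⊕ A)} {M : Basis X → Op A} (h : Blk V M) :
    Blk V.conjTranspose (fun x => (M x).conjTranspose) := by
  intro x a x' a'
  rw [Matrix.conjTranspose_apply, h x' a' x a]
  by_cases hx : x = x'
  · subst hx; simp
  · rw [if_neg hx, if_neg (Ne.symm hx), star_zero]

theorem blk_one : Blk (1 : Op (X ⊕ A)) (fun _ => 1) := by
  intro x a x' a'
  have : (Sum.elim x a : Basis (X ⊕ A)) = Sum.elim x' a' ↔ x = x' ∧ a = a' :=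
    ⟨fun h => ⟨congrArg (· ∘ Sum.inl) h, congrArg (· ∘ Sum.inr) h⟩, fun h => by rw [h.1, h.2]⟩
  change (1 : Op (X ⊕ A)) _ _ = if x = x' then (1 : Op A) a a' else 0
  rw [Matrix.one_apply, Matrix.one_apply, if_congr this rfl rfl, ite_and]

theorem Blk.unique {V : Op (X ⊕ A)} {M M' : Basis X → Op A} (h : Blk V M) (h' : Blk V M')
    (x : Basis X) : M x = M' x := by
  ext a a'
  have h1 := h x a x a'
  rw [h' x a x a', if_pos rfl, if_pos rfl] at h1
  exact h1.symm

theorem Blk.isometry {V : Op (X ⊕ A)} {M : Basis X → Op A} (h : Blk V M)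
    (hV : V.conjTranspose * V = 1) (x : Basis X) : (M x).conjTranspose * M x = 1 := by
  have h1 := h.conjTranspose.mul h
  rw [hV] at h1
  exact h1.unique blk_one x

theorem Blk.mulVec_tens {V : Op (X ⊕ A)} {M : Basis X → Op A} (h : Blk V M) (x : Basis X)
    (u : Basis A → ℂ) : V.mulVec (tens x u) = tens x ((M x).mulVec u) := by
  funext s
  rw [← Sum.elim_comp_inl_inr s]
  simp only [Matrix.mulVec, dotProduct]
  rw [sum_basis_sum, tens_elim]
  have h' := fun x a x' a' => h x a x' a'
  simp only [h', tens_elim, ite_mul, zero_mul, mul_ite, mul_zero]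
  rw [Finset.sum_eq_single x]
  · by_cases hx : s ∘ Sum.inl = x
    · simp [hx, Matrix.mulVec, dotProduct]
    · simp [hx]
  · intro b _ hb; simp [hb]
  · simp

theorem LocalOn.blk {V : Op (X ⊕ A)} (h : LocalOn (Function.Embedding.inr : A ↪ X ⊕ A) V) :
    Blk V (fun x a a' => V (Sum.elim x a) (Sum.elim x a')) := by
  intro x a x' a'
  by_cases hx : x = x'
  · subst hx; rw [if_pos rfl]
  · rw [if_neg hx]
    apply h
    intro h'
    apply hx
    funext v
    exact h' (Sum.inl v) (by rintro ⟨u, hu⟩; cases hu)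

theorem blk_signOp (f : Basis (X ⊕ A) → Fin 2) :
    Blk (signOp f) (fun x => Matrix.diagonal fun a => (-1 : ℂ) ^ (f (Sum.elim x a) : ℕ)) := by
  intro x a x' a'
  have : (Sum.elim x a : Basis (X ⊕ A)) = Sum.elim x' a' ↔ x = x' ∧ a = a' :=
    ⟨fun h => ⟨congrArg (· ∘ Sum.inl) h, congrArg (· ∘ Sum.inr) h⟩, fun h => by rw [h.1, h.2]⟩
  change signOp f _ _ = if x = x' then
    Matrix.diagonal (fun a => (-1 : ℂ) ^ (f (Sum.elim x a) : ℕ)) a a' else 0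
  rw [signOp, Matrix.diagonal_apply, Matrix.diagonal_apply, if_congr this rfl rfl, ite_and]

theorem permOp_tens {φ : Basis (X ⊕ A) → Basis (X ⊕ A)} {φX : Basis X → Basis X} {x : Basis X}
    (h : ∀ a, φ (Sum.elim x a) = Sum.elim (φX x) a) (u : Basis A → ℂ) :
    (permOp φ).mulVec (tens x u) = tens (φX x) u := by
  rw [tens_eq_sum, tens_eq_sum, Matrix.mulVec_sum]
  refine Finset.sum_congr rfl fun a _ => ?_
  rw [Matrix.mulVec_smul, permOp_ket, h]

theorem single_mulVec_tens (c : X) (r : Matrix (Fin 2) (Fin 2) ℂ) (x : Basis X)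
    (u : Basis A → ℂ) :
    (onWires (wire (Sum.inl c)) (singleOp r)).mulVec (tens x u) =
      ∑ b, r b (x c) • tens (Function.update x c b) u := by
  simp only [tens_eq_sum]
  rw [Matrix.mulVec_sum]
  simp only [Matrix.mulVec_smul, single_mulVec_ket, Sum.elim_inl, Sum.update_elim_inl,
    Finset.smul_sum]
  rw [Finset.sum_comm]
  refine Finset.sum_congr rfl fun b _ => Finset.sum_congr rfl fun a _ => ?_
  rw [smul_comm]

/-- The circuit of generalized quantum signal processing. -/
theorem impl_gqsp {d N : ℕ} {P Q : ℂ[X]} (h : Gqsp d P Q) {W : Op (X ⊕ A)} (hW : Impl N W)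
    {M : Basis X → Op A} (hM : Blk W M) (c : X) (hc : ∀ x, x c = 1 → M x = 1) :
    ∃ T : Op (X ⊕ A), Impl (d * (N + 1) + 1) T ∧ ∀ x, x c = 0 → ∀ u, T.mulVec (tens x u) =
      tens x ((aeval (M x) P).mulVec u) +
        tens (Function.update x c 1) ((aeval (M x) Q).mulVec u) := by
  have hcst : ∀ (x : Basis X) (k : ℂ) (R : ℂ[X]) (u : Basis A → ℂ),
      (aeval (M x) (C k * R)).mulVec u = k • (aeval (M x) R).mulVec u := by
    intro x k R u
    rw [map_mul, aeval_C, Algebra.algebraMap_eq_smul_one, smul_mul_assoc, one_mul, Matrix.smul_mulVec]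
  have hup : ∀ x : Basis X, x c = 0 → Function.update x c 0 = x := fun x hx => by
    rw [← hx, Function.update_eq_self]
  induction h with
  | base r hr =>
    refine ⟨_, (impl_single (Sum.inl c) r hr).mono (by omega), fun x hx u => ?_⟩
    have h1 := fun k => hcst x k 1 u
    simp only [mul_one, map_one, Matrix.one_mulVec] at h1
    rw [single_mulVec_tens, Fin.sum_univ_two, hx, hup x hx, h1, h1, tens_smul, tens_smul]
  | @step d P Q h r hr ih =>
    obtain ⟨T, hT, hT'⟩ := ih
    -- The walk acts only where the control is 0, so one application multiplies just the first
    -- polynomial by `X`; the one-qubit gate then mixes the two branches.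
    refine ⟨_, ((impl_single (Sum.inl c) r hr).mul (hW.mul hT)).mono (by ring_nf; omega),
      fun x hx u => ?_⟩
    rw [← Matrix.mulVec_mulVec, ← Matrix.mulVec_mulVec, hT' x hx, Matrix.mulVec_add,
      hM.mulVec_tens, hM.mulVec_tens, hc (Function.update x c 1) (by simp), Matrix.one_mulVec,
      Matrix.mulVec_add, single_mulVec_tens, single_mulVec_tens, Fin.sum_univ_two,
      Fin.sum_univ_two]
    simp only [hx, hup x hx, Function.update_self, Function.update_idem, map_add,
      Matrix.add_mulVec, hcst, tens_add, tens_smul]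
    simp only [map_mul, aeval_X, ← Matrix.mulVec_mulVec]
    abel

end Blocks

/-! ### The walk operator -/

section Walk

variable {A : Type} [Fintype A] [DecidableEq A]

/-- Unitarity gives `W ^ 2 + 1 = W (W + W†)`, which multiplies `v` by `2 * y` and applies `W`;
powers follow because everything commutes with `W`. -/
theorem walk_pow {W : Op A} {v : Basis A → ℂ} {y : ℂ} (hW : W * W.conjTranspose = 1)
    (h : (W + W.conjTranspose).mulVec v = (2 * y) • v) (i : ℕ) :
    ((W ^ 2 + 1) ^ i).mulVec v = (2 * y) ^ i • (W ^ i).mulVec v := by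
  have h1 : (W ^ 2 + 1).mulVec v = (2 * y) • W.mulVec v := by
    rw [← Matrix.mulVec_smul, ← h, Matrix.mulVec_mulVec, mul_add, hW, sq]
  induction i with
  | zero => simp
  | succ i ih =>
    have hcomm : (W ^ 2 + 1) * W ^ i = W ^ i * (W ^ 2 + 1) := by
      rw [add_mul, mul_add, one_mul, mul_one, ← pow_add, ← pow_add, add_comm 2 i]
    rw [pow_succ', ← Matrix.mulVec_mulVec, ih, Matrix.mulVec_smul, Matrix.mulVec_mulVec, hcomm,
      ← Matrix.mulVec_mulVec, h1, Matrix.mulVec_smul, Matrix.mulVec_mulVec, ← pow_succ, smul_smul,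
      ← pow_succ]

/-- All terms of `circleLift` contribute the same power `W ^ d`, so the coefficients recombine into
the value of `q`. The space spanned by the powers of `W` on `v` need not be diagonalised. -/
theorem aeval_circleLift_mulVec {W : Op A} {v : Basis A → ℂ} {y : ℝ}
    (hW : W * W.conjTranspose = 1) (h : (W + W.conjTranspose).mulVec v = (2 * (y : ℂ)) • v)
    {d : ℕ} {q : ℝ[X]} (hq : q.natDegree ≤ d) :
    (aeval W (circleLift d q)).mulVec v = ((q.eval y : ℝ) : ℂ) • (W ^ d).mulVec v := by
  rw [circleLift, map_sum, Matrix.sum_mulVec, eval_eq_sum_range' (Nat.lt_succ_of_le hq),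
    Complex.ofReal_sum, Finset.sum_smul]
  refine Finset.sum_congr rfl fun i hi => ?_
  have hi' : i ≤ d := by simpa [Nat.lt_succ_iff] using hi
  rw [map_mul, aeval_C, Algebra.algebraMap_eq_smul_one, smul_mul_assoc, one_mul, Matrix.smul_mulVec,
    mul_comm ((X ^ 2 + 1) ^ i) (X ^ (d - i))]
  simp only [map_mul, map_pow, map_add, aeval_X, map_one]
  rw [← Matrix.mulVec_mulVec, walk_pow hW h, Matrix.mulVec_smul, Matrix.mulVec_mulVec, ← pow_add,
    Nat.sub_add_cancel hi', smul_smul]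
  congr 1
  rw [mul_pow, Complex.ofReal_mul, Complex.ofReal_pow]
  field_simp

theorem aeval_mulVec_of_fixed {W : Op A} {v : Basis A → ℂ} (h : W.mulVec v = v) (P : ℂ[X]) :
    (aeval W P).mulVec v = P.eval 1 • v := by
  have hp : ∀ i, (W ^ i).mulVec v = v := by
    intro i
    induction i with
    | zero => simp
    | succ i ih => rw [pow_succ, ← Matrix.mulVec_mulVec, h, ih]
  rw [aeval_eq_sum_range, Matrix.sum_mulVec, eval_eq_sum_range, Finset.sum_smul]
  refine Finset.sum_congr rfl fun i _ => ?_
  rw [Matrix.smul_mulVec, hp, one_pow, mul_one]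

/-- The walk operator of the prepared state `V |0⟩` and of the signs `s`. -/
def walk (V : Op A) (s : Basis A → ℂ) : Op A :=
  Matrix.diagonal (fun a => if a = 0 then -1 else 1) * (V.conjTranspose * Matrix.diagonal s * V)

variable {V : Op A} {s : Basis A → ℂ} (hV : V.conjTranspose * V = 1)
  (hs : ∀ a, s a = 1 ∨ s a = -1)

include hV hs in
theorem walk_unitary : walk V s * (walk V s).conjTranspose = 1 := by
  have hV' : V * V.conjTranspose = 1 := mul_eq_one_comm.1 hV
  have hZ : (Matrix.diagonal (fun a : Basis A => if a = 0 then (-1 : ℂ) else 1)) *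
      (Matrix.diagonal (fun a : Basis A => if a = 0 then (-1 : ℂ) else 1)).conjTranspose = 1 := by
    rw [Matrix.diagonal_conjTranspose, Matrix.diagonal_mul_diagonal, ← Matrix.diagonal_one]
    congr 1; funext a
    rw [Pi.star_apply]
    split_ifs <;> simp
  have hS : Matrix.diagonal s * (Matrix.diagonal s).conjTranspose = 1 := by
    rw [Matrix.diagonal_conjTranspose, Matrix.diagonal_mul_diagonal, ← Matrix.diagonal_one]
    congr 1; funext a
    rw [Pi.star_apply]
    rcases hs a with h | h <;> rw [h] <;> simp
  rw [walk]
  generalize Matrix.diagonal (fun a : Basis A => if a = 0 then (-1 : ℂ) else 1) = Z at *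
  generalize Matrix.diagonal s = S at *
  simp only [Matrix.conjTranspose_mul, Matrix.conjTranspose_conjTranspose]
  calc Z * (V.conjTranspose * S * V) * (V.conjTranspose * (S.conjTranspose * V) * Z.conjTranspose)
      = Z * V.conjTranspose * S * (V * V.conjTranspose) * S.conjTranspose * V * Z.conjTranspose := by
        simp only [Matrix.mul_assoc]
    _ = Z * V.conjTranspose * (S * S.conjTranspose) * V * Z.conjTranspose := by
        rw [hV', Matrix.mul_one]; simp only [Matrix.mul_assoc]
    _ = Z * (V.conjTranspose * V) * Z.conjTranspose := by
        rw [hS, Matrix.mul_one]; simp only [Matrix.mul_assoc]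
    _ = 1 := by rw [hV, Matrix.mul_one, hZ]

-- With `B` the conjugated sign operator and `Z` the reflection, `Z B + B Z` applied to the zero
-- state has its off-zero components cancelled by the signs of `Z`, which leaves `-2` times the
-- expectation of the signs.
include hs in
theorem walk_add_conjTranspose :
    (walk V s + (walk V s).conjTranspose).mulVec (ket 0) =
      (-2 * ∑ a, star (V a 0) * s a * V a 0) • ket 0 := by
  have hS : (Matrix.diagonal s).conjTranspose = Matrix.diagonal s := by
    rw [Matrix.diagonal_conjTranspose]
    congr 1; funext a
    rw [Pi.star_apply]
    rcases hs a with h | h <;> rw [h] <;> simp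
  have hZ : (Matrix.diagonal (fun a : Basis A => if a = 0 then (-1 : ℂ) else 1)).conjTranspose =
      Matrix.diagonal (fun a : Basis A => if a = 0 then (-1 : ℂ) else 1) := by
    rw [Matrix.diagonal_conjTranspose]
    congr 1; funext a
    rw [Pi.star_apply]
    split_ifs <;> simp
  have hB : (V.conjTranspose * Matrix.diagonal s * V) 0 0 =
      ∑ a, star (V a 0) * s a * V a 0 := by
    rw [Matrix.mul_apply]
    simp only [Matrix.mul_diagonal, Matrix.conjTranspose_apply]
  rw [← hB]
  have hct : (walk V s).conjTranspose = V.conjTranspose * Matrix.diagonal s * V *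
      Matrix.diagonal (fun a => if a = 0 then -1 else 1) := by
    rw [walk, Matrix.conjTranspose_mul, Matrix.conjTranspose_mul, Matrix.conjTranspose_mul, hS, hZ,
      Matrix.conjTranspose_conjTranspose]
    simp only [Matrix.mul_assoc]
  rw [hct, walk]
  generalize V.conjTranspose * Matrix.diagonal s * V = B
  funext b
  rw [mulVec_ket, Matrix.add_apply, Matrix.diagonal_mul, Matrix.mul_diagonal, Pi.smul_apply,
    ket_apply]
  by_cases hb : b = 0
  · subst hb; simp; ring
  · simp [hb]

-- With trivial signs the preparation cancels its inverse and only the reflection remains, which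
-- moves nothing but the phase of the zero state. This is the behaviour away from the mesh.
include hV in
theorem walk_trivial {a : Basis A} (ha : a ≠ 0) :
    (walk V fun _ => 1).mulVec (ket a) = ket a := by
  rw [walk, Matrix.diagonal_one, Matrix.mul_one, hV, Matrix.mul_one]
  funext b
  rw [mulVec_ket, Matrix.diagonal_apply, ket_apply]
  by_cases hb : b = a
  · rw [if_pos hb, if_neg (hb ▸ ha), if_pos hb]
  · rw [if_neg hb, if_neg hb]

end Walk

end QuFEM
end

noncomputable section
namespace QuFEM

/-! ### The circuit on the mesh -/

section MeshCircuit

/-- The wires of the data qubits, the registers for the coefficients and the control qubit. -/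
structure RegWires (X : Type) (n m l : ℕ) where
  data : Fin n ↪ X
  row : Fin m → X
  col : Fin m → X
  point : Fin l → X
  ctrl : X
  row_notMem : ∀ i, row i ∉ Set.range data
  col_notMem : ∀ i, col i ∉ Set.range data
  ctrl_notMem : ctrl ∉ Set.range data

variable {X : Type} [Fintype X] [DecidableEq X] {n m l ν p K D : ℕ}

/-- The wires of the mesh, with a further register which holds the flag and the index. -/
def RegWires.mesh (R : RegWires X n m l) (ν : ℕ) : MeshWires (X ⊕ Fin (ν + 1)) n m ν where
  data := R.data.trans Function.Embedding.inl
  row i := Sum.inl (R.row i)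
  col i := Sum.inl (R.col i)
  idx i := Sum.inr i.succ
  flag := Sum.inr 0
  ctrl := Sum.inl R.ctrl
  flag_notMem := by rintro ⟨i, hi⟩; cases hi
  row_notMem i := by rintro ⟨j, hj⟩; exact R.row_notMem i ⟨j, Sum.inl_injective hj⟩
  col_notMem i := by rintro ⟨j, hj⟩; exact R.col_notMem i ⟨j, Sum.inl_injective hj⟩
  flag_ne_col i := by simp

variable (R : RegWires X n m l)

/-- Replacement of the node `J` by `J - k + j`, for the row number `j` and the column number `k`. -/
def RegWires.shift (z : Basis X) : Basis X :=
  patch R.data z fun i => nbit (regVal R.data z + 2 ^ n - regVal R.col z + regVal R.row z) i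

/-- The amplitudes which encode the position of a point in an element. -/
def posAmp (n ν : ℕ) (t : ℝ) (u : Basis (Fin (ν + 1))) : ℝ :=
  if (finFunctionFinEquiv (Fin.tail u) : ℕ) < n then
    √(2 ^ (finFunctionFinEquiv (Fin.tail u) : ℕ) / (2 ^ n - 1)) *
      (if u 0 = 0 then √(1 - t) else √t)
  else 0

theorem posAmp_nonneg (t : ℝ) (u : Basis (Fin (ν + 1))) : 0 ≤ posAmp n ν t u := by
  rw [posAmp]; split_ifs <;> positivity

/-- The squared amplitudes form a product distribution: index `i` with weight `2 ^ i / (2 ^ n - 1)`,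
flag 1 with probability `t`. Indices from `n` on exist only because the register is rounded up, and
have amplitude zero. -/
theorem sum_posAmp (hν : n ≤ 2 ^ ν) {t : ℝ} (ht : t ∈ Set.Icc (0 : ℝ) 1) (g : ℕ → Fin 2 → ℝ) :
    ∑ u, posAmp n ν t u ^ 2 * g (finFunctionFinEquiv (Fin.tail u)) (u 0) =
      ∑ i ∈ Finset.range n, 2 ^ i / (2 ^ n - 1) * ((1 - t) * g i 0 + t * g i 1) := by
  have hpos : ∀ i : ℕ, 0 ≤ (2 : ℝ) ^ i / (2 ^ n - 1) := fun i =>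
    div_nonneg (by positivity) (sub_nonneg.2 (one_le_pow₀ (by norm_num)))
  have h1 : ∑ u, posAmp n ν t u ^ 2 * g (finFunctionFinEquiv (Fin.tail u)) (u 0) =
      ∑ b : Fin 2, ∑ w : Basis (Fin ν), posAmp n ν t (Fin.cons b w) ^ 2 *
        g (finFunctionFinEquiv w) b := by
    rw [← Fintype.sum_prod_type' (f := fun b w => posAmp n ν t (Fin.cons b w) ^ 2 *
        g (finFunctionFinEquiv w) b)]
    symm
    exact Fintype.sum_equiv (Fin.consEquiv fun _ => Fin 2) _ _ (fun _ => rfl)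
  have h2 : ∀ b : Fin 2, ∑ w : Basis (Fin ν), posAmp n ν t (Fin.cons b w) ^ 2 *
      g (finFunctionFinEquiv w) b =
      ∑ i ∈ Finset.range n, 2 ^ i / (2 ^ n - 1) * ((if b = 0 then 1 - t else t) * g i b) := by
    intro b
    let F : ℕ → ℝ := fun i => if i < n then
      2 ^ i / (2 ^ n - 1) * ((if b = 0 then 1 - t else t) * g i b) else 0
    have h3 : ∀ w : Basis (Fin ν), posAmp n ν t (Fin.cons b w) ^ 2 *
        g (finFunctionFinEquiv w) b = F (finFunctionFinEquiv w) := by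
      intro w
      simp only [posAmp, F, Fin.tail_cons, Fin.cons_zero]
      split_ifs
      · rw [mul_pow, Real.sq_sqrt (hpos _), Real.sq_sqrt (by linarith [ht.2]), mul_assoc]
      · rw [mul_pow, Real.sq_sqrt (hpos _), Real.sq_sqrt ht.1, mul_assoc]
      · ring
    rw [Finset.sum_congr rfl fun w _ => h3 w,
      Fintype.sum_equiv finFunctionFinEquiv _ (fun i : Fin (2 ^ ν) => F i) (fun _ => rfl),
      Fin.sum_univ_eq_sum_range, ← Finset.sum_subset (Finset.range_subset_range.2 hν)]
    · exact Finset.sum_congr rfl fun i hi => if_pos (Finset.mem_range.1 hi)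
    · intro i _ hi
      exact if_neg fun h => hi (Finset.mem_range.2 h)
  rw [h1, Fin.sum_univ_two, h2, h2, ← Finset.sum_add_distrib]
  refine Finset.sum_congr rfl fun i _ => ?_
  simp; ring

theorem sum_nbit (N w : ℕ) : ∑ i ∈ Finset.range w, 2 ^ i * (nbit N i : ℕ) = N % 2 ^ w := by
  induction w with
  | zero => simp [Nat.mod_one]
  | succ w ih => rw [Finset.sum_range_succ, ih, mod_two_pow_succ]

theorem sum_two_pow (hn : 1 ≤ n) : ∑ i ∈ Finset.range n, (2 : ℝ) ^ i / (2 ^ n - 1) = 1 := by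
  have h1 : (1 : ℝ) < 2 ^ n := one_lt_pow₀ (by norm_num) (by omega)
  rw [← Finset.sum_div, geom_sum_eq (by norm_num), show (2 : ℝ) - 1 = 1 by norm_num, div_one,
    div_self (by linarith)]

theorem sum_posAmp_sq (hn : 1 ≤ n) (hν : n ≤ 2 ^ ν) {t : ℝ} (ht : t ∈ Set.Icc (0 : ℝ) 1) :
    ∑ u, posAmp n ν t u ^ 2 = 1 := by
  have := sum_posAmp hν ht fun _ _ => 1
  simp only [mul_one, sub_add_cancel] at this
  rw [this, sum_two_pow hn]

/-- The expected value of the sign of the digit. -/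
theorem sum_posAmp_digit (hn : 1 ≤ n) (hp : 1 ≤ p) (hK : 2 ^ n = K * p + 1) (hν : n ≤ 2 ^ ν)
    {t : ℝ} (ht : t ∈ Set.Icc (0 : ℝ) 1) {e : ℕ} (he : e < K) :
    ∑ u, posAmp n ν t u ^ 2 *
      (1 - 2 * ((nbit (e * p + (u 0 : ℕ) * p) (finFunctionFinEquiv (Fin.tail u)) : ℕ) : ℝ)) =
      -(2 * ((e + t) / K) - 1) := by
  have h := sum_posAmp hν ht fun i b => 1 - 2 * ((nbit (e * p + (b : ℕ) * p) i : ℕ) : ℝ)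
  rw [h]
  have hle : e * p + p ≤ K * p := by rw [← Nat.succ_mul]; exact Nat.mul_le_mul_right p he
  have hKR : (2 : ℝ) ^ n - 1 = K * p := by
    have : ((2 ^ n : ℕ) : ℝ) = ((K * p + 1 : ℕ) : ℝ) := by rw [hK]
    push_cast at this
    linarith
  -- Weighted by `2 ^ i` the digits of a number add up to it, and `2 ^ n - 1 = K * p` turns the ends
  -- of the element into `e / K` and `(e + 1) / K`. The flag interpolates between these.
  have hb : ∀ b : Fin 2, ∑ i ∈ Finset.range n, (2 : ℝ) ^ i / (2 ^ n - 1) *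
      ((nbit (e * p + (b : ℕ) * p) i : ℕ) : ℝ) = (e + (b : ℕ)) / K := by
    intro b
    have hb1 : (b : ℕ) * p ≤ p := by
      have : (b : ℕ) ≤ 1 := by omega
      calc (b : ℕ) * p ≤ 1 * p := Nat.mul_le_mul_right p this
        _ = p := one_mul p
    have h1 := sum_nbit (e * p + (b : ℕ) * p) n
    rw [Nat.mod_eq_of_lt (by omega)] at h1
    have h2 : ((∑ i ∈ Finset.range n, 2 ^ i * (nbit (e * p + (b : ℕ) * p) i : ℕ) : ℕ) : ℝ) =
      ((e * p + (b : ℕ) * p : ℕ) : ℝ) := by rw [h1]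
    push_cast at h2
    rw [← Finset.sum_congr rfl fun i _ => (mul_div_right_comm _ _ _), ← Finset.sum_div, h2, hKR]
    have hK0 : (K : ℝ) ≠ 0 := by
      have : 0 < K := by omega
      positivity
    have hp0 : (p : ℝ) ≠ 0 := by positivity
    field_simp
  have h0 := hb 0
  have h1 := hb 1
  have h2 := sum_two_pow hn
  have e1 : ∀ i : ℕ, (2 : ℝ) ^ i / (2 ^ n - 1) *
      ((1 - t) * (1 - 2 * ((nbit (e * p + ((0 : Fin 2) : ℕ) * p) i : ℕ) : ℝ)) +
        t * (1 - 2 * ((nbit (e * p + ((1 : Fin 2) : ℕ) * p) i : ℕ) : ℝ))) =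
      2 ^ i / (2 ^ n - 1) -
        2 * (1 - t) * (2 ^ i / (2 ^ n - 1) *
          ((nbit (e * p + ((0 : Fin 2) : ℕ) * p) i : ℕ) : ℝ)) -
        2 * t * (2 ^ i / (2 ^ n - 1) *
          ((nbit (e * p + ((1 : Fin 2) : ℕ) * p) i : ℕ) : ℝ)) := by
    intro i; ring
  rw [Finset.sum_congr rfl fun i _ => e1 i, Finset.sum_sub_distrib, Finset.sum_sub_distrib,
    ← Finset.mul_sum, ← Finset.mul_sum, h0, h1, h2]
  simp
  ring

theorem Blk.pow {X A : Type} [Fintype X] [DecidableEq X] [Fintype A] [DecidableEq A]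
    {V : Op (X ⊕ A)} {M : Basis X → Op A} (h : Blk V M) (d : ℕ) :
    Blk (V ^ d) (fun x => M x ^ d) := by
  induction d with
  | zero => simpa using blk_one
  | succ d ih => simpa only [pow_succ] using ih.mul h

theorem conjTranspose_pow_mulVec {A : Type} [Fintype A] [DecidableEq A] {W : Op A}
    (hW : W * W.conjTranspose = 1) (d : ℕ) (u : Basis A → ℂ) :
    (W ^ d).conjTranspose.mulVec ((W ^ d).mulVec u) = u := by
  have h : ∀ d : ℕ, (W ^ d).conjTranspose * W ^ d = 1 := by
    intro d
    induction d with
    | zero => simp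
    | succ d ih =>
      rw [pow_succ', Matrix.conjTranspose_mul, Matrix.mul_assoc, ← Matrix.mul_assoc _ W,
        mul_eq_one_comm.1 hW, Matrix.one_mul, ih]
  rw [Matrix.mulVec_mulVec, h, Matrix.one_mulVec]

theorem neg_one_pow_fin (b : Fin 2) : (-1 : ℂ) ^ (b : ℕ) = ((1 - 2 * ((b : ℕ) : ℝ) : ℝ) : ℂ) := by
  rcases fin_two_cases b with rfl | rfl <;> norm_num

/-- The controlled walk operator, for the points `t`. -/
theorem exists_walk (hn : 1 ≤ n) (hmn : m ≤ n) (hp : 1 ≤ p) (hm : p + 1 = 2 ^ m)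
    (hK : 2 ^ n = K * p + 1) (hν : n ≤ 2 ^ ν) (t : Basis (Fin l) → ℝ)
    (ht : ∀ a, t a ∈ Set.Icc (0 : ℝ) 1) :
    ∃ (W : Op (X ⊕ Fin (ν + 1))) (M : Basis X → Op (Fin (ν + 1))),
      Impl (16 * 2 ^ l * (2 ^ (ν + 1) - 1) + 400 * (n * p) + 450 + 16 * 2 ^ ν + 8 * ν) W ∧
      Blk W M ∧ (∀ x, x R.ctrl = 1 → M x = 1) ∧
      ∀ x, x R.ctrl = 0 → M x * (M x).conjTranspose = 1 ∧
        (∀ e < K, regVal R.data x = IX p e (regVal R.col x) →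
          (M x + (M x).conjTranspose).mulVec (ket 0) =
            (2 * ((2 * ((e + t (x ∘ R.point)) / K) - 1 : ℝ) : ℂ)) • ket 0) ∧
        ((∀ e < K, regVal R.data x ≠ IX p e (regVal R.col x)) → ∀ a, a ≠ 0 →
          (M x).mulVec (ket a) = ket a) := by
  let L := R.mesh ν
  obtain ⟨V, hV, hloc, hval⟩ := exists_statePrep (Q := X ⊕ Fin (ν + 1)) (ν + 1) l
    (fun i => Sum.inl (R.point i)) Function.Embedding.inr
    (by rintro i ⟨v, hv⟩; cases hv) (fun a => posAmp n ν (t a))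
    (fun a u => posAmp_nonneg _ _) (fun a => sum_posAmp_sq hn hν (ht a))
  have hS := L.impl_digitSign hmn hp hm hK hν
  -- Only the two sign operators depend on the control. When it is 1 both are trivial, and the
  -- uncontrolled preparation cancels its own inverse.
  let T : Finset (X ⊕ Fin (ν + 1)) :=
    insert L.ctrl (Finset.univ.map Function.Embedding.inr)
  have hT : T.card ≤ ν + 2 := (Finset.card_insert_le _ _).trans (by simp)
  have hZ := impl_zeroSign T
  have hT' : ∀ x a, (∀ v ∈ T, (Sum.elim x a : Basis (X ⊕ Fin (ν + 1))) v = 0) ↔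
      x R.ctrl = 0 ∧ a = 0 := by
    intro x a
    simp only [T, Finset.forall_mem_insert, Finset.forall_mem_map, Finset.mem_univ, true_implies]
    refine and_congr Iff.rfl ?_
    rw [funext_iff]
    exact Iff.rfl
  have hVb := hloc.blk
  have hB := (blk_signOp (fun x => if ∀ v ∈ T, x v = 0 then 1 else 0)).mul
    ((hVb.conjTranspose.mul (blk_signOp fun x : Basis (X ⊕ Fin (ν + 1)) =>
      (x L.ctrl + 1) * (L.ok p K x * L.digit p x))).mul hVb)
  refine ⟨_, _, (hZ.mul ((hV.conjTranspose.mul hS).mul hV)).mono ?_, hB, ?_, ?_⟩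
  · have e1 : 16 * 2 ^ l * (2 ^ (ν + 1) - 1) = 2 * (8 * 2 ^ l * (2 ^ (ν + 1) - 1)) := by ring
    rw [e1]; omega
  · intro x hx
    have hx' : ∀ a, (Sum.elim x a : Basis (X ⊕ Fin (ν + 1))) L.ctrl = 1 := fun _ => hx
    have h11 : (1 : Fin 2) + 1 = 0 := rfl
    simp only [hx', hT', hx, h11, zero_mul, one_ne_zero, false_and, if_false, Fin.val_zero,
      pow_zero, Matrix.diagonal_one, Matrix.mul_one, Matrix.one_mul]
    exact hVb.isometry hV.isometry x
  · intro x hx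
    have hx' : ∀ a, (Sum.elim x a : Basis (X ⊕ Fin (ν + 1))) L.ctrl = 0 := fun _ => hx
    have hdZ : (fun a : Basis (Fin (ν + 1)) => (-1 : ℂ) ^
        ((if ∀ v ∈ T, (Sum.elim x a : Basis (X ⊕ Fin (ν + 1))) v = 0 then (1 : Fin 2)
          else 0 : Fin 2) : ℕ)) = fun a => if a = 0 then -1 else 1 := by
      funext a
      rw [if_congr (hT' x a) rfl rfl]
      by_cases ha : a = 0 <;> simp [ha, hx]
    simp only [hx', zero_add, one_mul, hdZ]
    set Vx : Op (Fin (ν + 1)) := fun a a' => V (Sum.elim x a) (Sum.elim x a') with hVx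
    set s : Basis (Fin (ν + 1)) → ℂ := fun a =>
      (-1 : ℂ) ^ ((L.ok p K (Sum.elim x a) * L.digit p (Sum.elim x a) : Fin 2) : ℕ) with hsd
    have hVu : Vx.conjTranspose * Vx = 1 := hVb.isometry hV.isometry x
    have hs : ∀ a, s a = 1 ∨ s a = -1 := fun a => neg_one_pow_eq_or ℂ _
    refine ⟨walk_unitary hVu hs, fun e he hJ => ?_, fun hJ a ha => ?_⟩
    · refine (walk_add_conjTranspose hs).trans ?_
      congr 1
      have hok : ∀ a, L.ok p K (Sum.elim x a) = 1 := fun a => if_pos ⟨e, he, hJ⟩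
      have hterm : ∀ a, star (Vx a 0) * s a * Vx a 0 =
          ((posAmp n ν (t (x ∘ R.point)) a ^ 2 * (1 - 2 * ((nbit (e * p + (a 0 : ℕ) * p)
            (finFunctionFinEquiv (Fin.tail a)) : ℕ) : ℝ)) : ℝ) : ℂ) := by
        intro a
        have h1 : Vx a 0 = (posAmp n ν (t (x ∘ R.point)) a : ℝ) := by
          have hp : patch Function.Embedding.inr (Sum.elim x (0 : Basis (Fin (ν + 1)))) a =
              Sum.elim x a := by
            funext v
            rcases v with v | v
            · rw [patch_apply_of_notMem]
              · rfl
              · rintro ⟨u, hu⟩; cases hu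
            · exact patch_apply Function.Embedding.inr _ _ v
          have := hval (Sum.elim x 0) rfl a
          rw [hp] at this
          exact this
        have h2 : posAmp n ν (t (x ∘ R.point)) a ^ 2 * (1 - 2 * ((L.digit p (Sum.elim x a) : ℕ) : ℝ))
            = posAmp n ν (t (x ∘ R.point)) a ^ 2 * (1 - 2 * ((nbit (e * p + (a 0 : ℕ) * p)
            (finFunctionFinEquiv (Fin.tail a)) : ℕ) : ℝ)) := by
          by_cases hi : (finFunctionFinEquiv (Fin.tail a) : ℕ) < n
          · have h3 : L.digit p (Sum.elim x a) = nbit (e * p + (a 0 : ℕ) * p)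
                (finFunctionFinEquiv (Fin.tail a)) := by
              have h4 : L.digit p (Sum.elim x a) = nbit (regVal R.data x + 2 ^ n - regVal R.col x +
                  (a 0 : ℕ) * p) (finFunctionFinEquiv (Fin.tail a)) := if_pos hi
              -- The summand `2 ^ n`, which protects the natural-number subtraction, does not affect
              -- digits below `n`.
              rw [h4, hJ, IX, ← nbit_mod hi, show e * p + regVal R.col x + 2 ^ n - regVal R.col x +
                (a 0 : ℕ) * p = e * p + (a 0 : ℕ) * p + 2 ^ n by omega, Nat.add_mod_right,
                nbit_mod hi]
            rw [h3]
          · rw [posAmp, if_neg hi]; ring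
        rw [← h2, h1, hsd]
        simp only [hok, one_mul, neg_one_pow_fin]
        rw [Complex.star_def, Complex.conj_ofReal]
        push_cast
        ring
      rw [Finset.sum_congr rfl fun a _ => hterm a, ← Complex.ofReal_sum,
        sum_posAmp_digit hn hp hK hν (ht _) he]
      push_cast
      ring
    · have hok : ∀ a, L.ok p K (Sum.elim x a) = 0 := fun a => if_neg fun ⟨e, he, h⟩ => hJ e he h
      have hs1 : s = fun _ => 1 := by
        funext a
        simp only [hsd, hok, zero_mul, Fin.val_zero, pow_zero]
      rw [hs1]
      exact walk_trivial hVu ha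

/-- The circuit which multiplies by a polynomial at the position of a point and moves the column
node to the row node of the element. -/
theorem exists_meshCircuit (hn : 1 ≤ n) (hmn : m ≤ n) (hp : 1 ≤ p) (hm : p + 1 = 2 ^ m)
    (hK : 2 ^ n = K * p + 1) (hν : n ≤ 2 ^ ν) (t : Basis (Fin l) → ℝ)
    (ht : ∀ a, t a ∈ Set.Icc (0 : ℝ) 1) {q : ℝ[X]} (hq : q.natDegree ≤ D)
    (hq1 : ∀ x ∈ Set.Icc (-1 : ℝ) 1, |q.eval x| ≤ 1) :
    ∃ U : Op (X ⊕ Fin (ν + 1)),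
      Impl (3 * D * (16 * 2 ^ l * (2 ^ (ν + 1) - 1) + 400 * (n * p) + 451 + 16 * 2 ^ ν + 8 * ν) +
        (400 * (n * p) + 200 * n + 801)) U ∧
      ∀ x x', x R.ctrl = 0 → x' R.ctrl = 0 →
        (∀ e < K, regVal R.data x = IX p e (regVal R.col x) → U (Sum.elim x' 0) (Sum.elim x 0) =
          if x' = patch R.data x (fun i => nbit (IX p e (regVal R.row x)) i) then
            ((q.eval (2 * ((e + t (x ∘ R.point)) / K) - 1) : ℝ) : ℂ) else 0) ∧
        ((∀ e < K, regVal R.data x ≠ IX p e (regVal R.col x)) → U (Sum.elim x' 0) (Sum.elim x 0) = 0) := by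
  let L := R.mesh ν
  obtain ⟨W, M, hW, hM, hM1, hM0⟩ := exists_walk R hn hmn hp hm hK hν t ht
  obtain ⟨Q, hQ⟩ := exists_gqsp hq hq1
  obtain ⟨T, hT, hTt⟩ := impl_gqsp hQ hW hM (R.ctrl) hM1
  have hF := L.impl_flip hmn hp hm hK
  have hSh := L.impl_shift hmn
  have hWD := (hW.pow D).conjTranspose
  have hMD := (hM.pow D).conjTranspose
  -- From right to left: raise the flag off the mesh, run signal processing with `2 * D` walks, undo
  -- the factor `W ^ D` by `D` inverse walks, shift `J` to `J - k + j`.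
  refine ⟨_, ((hSh.mul (hWD.mul hT)).mul hF).mono (by ring_nf; omega), fun x x' hx hx' => ?_⟩
  have hentry : ∀ u : Basis (Fin (ν + 1)) → ℂ, ∀ y : Basis (Fin (ν + 1)), u = ket y →
      Function.update (Sum.elim x (0 : Basis (Fin (ν + 1)))) L.flag ((Sum.elim x
        (0 : Basis (Fin (ν + 1)))) L.flag + (L.ok p K (Sum.elim x 0) + 1)) = Sum.elim x y →
      ((permOp fun x : Basis (X ⊕ Fin (ν + 1)) => patch L.data x fun i =>
          nbit (regVal L.data x + 2 ^ n - regVal L.col x + regVal L.row x) i) *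
        (Matrix.conjTranspose (W ^ D : Op (X ⊕ Fin (ν + 1))) * T) *
        permOp fun x => Function.update x L.flag (x L.flag + (L.ok p K x + 1)))
        (Sum.elim x' 0) (Sum.elim x 0) =
      if x' = R.shift x then ((M x ^ D).conjTranspose.mulVec
          ((aeval (M x) (circleLift D q)).mulVec u)) 0 else 0 := by
    intro u y hu hy
    rw [← mulVec_ket (_ * _ * _) (Sum.elim x' 0) (Sum.elim x 0), ← Matrix.mulVec_mulVec,
      ← Matrix.mulVec_mulVec, permOp_ket, hy, ← tens_ket,
      ← hu, ← Matrix.mulVec_mulVec, hTt x hx, Matrix.mulVec_add, hMD.mulVec_tens,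
      hMD.mulVec_tens, Matrix.mulVec_add]
    have hsh : ∀ (z : Basis X) (a : Basis (Fin (ν + 1))),
        (patch L.data (Sum.elim z a) fun i => nbit (regVal L.data (Sum.elim z a) + 2 ^ n -
          regVal L.col (Sum.elim z a) + regVal L.row (Sum.elim z a)) i) =
        Sum.elim (R.shift z) a := by
      intro z a
      funext v
      by_cases hv : v ∈ Set.range L.data
      · obtain ⟨i, rfl⟩ := hv
        rw [patch_apply]
        exact (patch_apply R.data z (fun i =>
          nbit (regVal R.data z + 2 ^ n - regVal R.col z + regVal R.row z) i) i).symm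
      · rw [patch_apply_of_notMem _ _ _ hv]
        rcases v with v | v
        · rw [Sum.elim_inl, Sum.elim_inl, RegWires.shift, patch_apply_of_notMem]
          rintro ⟨i, rfl⟩
          exact hv ⟨i, rfl⟩
        · rfl
    -- The branch of the complementary polynomial has control 1 and is invisible in the block, where
    -- the control starts and ends at 0.
    rw [permOp_tens (hsh _), permOp_tens (hsh _), Pi.add_apply, tens_elim, tens_elim,
      if_neg (c := x' = R.shift (Function.update x R.ctrl 1)), add_zero]
    intro h
    have h1 := congrFun h (R.ctrl)
    rw [RegWires.shift, patch_apply_of_notMem, Function.update_self, hx'] at h1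
    · exact zero_ne_one h1
    · exact R.ctrl_notMem
  have hup : ∀ b : Fin 2, Function.update (Sum.elim x (0 : Basis (Fin (ν + 1)))) L.flag b =
      Sum.elim x (Function.update 0 0 b) := fun b => Sum.update_elim_inr
  obtain ⟨hMu, hMok, hMfail⟩ := hM0 x hx
  constructor
  · intro e he hJ
    have hok : L.ok p K (Sum.elim x 0) = 1 := if_pos ⟨e, he, hJ⟩
    have hy : Function.update (Sum.elim x (0 : Basis (Fin (ν + 1)))) L.flag ((Sum.elim x
        (0 : Basis (Fin (ν + 1)))) L.flag + (L.ok p K (Sum.elim x 0) + 1)) = Sum.elim x 0 := by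
      rw [hok, hup]
      congr 1
      exact Function.update_eq_self 0 (0 : Basis (Fin (ν + 1)))
    rw [hentry _ 0 rfl hy, aeval_circleLift_mulVec hMu (hMok e he hJ) hq, Matrix.mulVec_smul,
      conjTranspose_pow_mulVec hMu]
    have hnode : (fun i : Fin n => nbit (regVal R.data x + 2 ^ n - regVal R.col x + regVal R.row x) i) =
        fun i : Fin n => nbit (IX p e (regVal R.row x)) i := by
      funext i
      rw [hJ, IX, IX, ← nbit_mod i.2, show e * p + regVal R.col x + 2 ^ n - regVal R.col x + regVal R.row x =
        e * p + regVal R.row x + 2 ^ n by omega, Nat.add_mod_right, nbit_mod i.2]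
    rw [RegWires.shift, hnode]
    simp
  · intro hJ
    have hok : L.ok p K (Sum.elim x 0) = 0 := if_neg fun ⟨e, he, h⟩ => hJ e he h
    -- Off the mesh the register enters with the flag raised. The walk fixes this state, so it comes
    -- out as a multiple of itself, orthogonal to the zero state.
    have hne : (Function.update 0 0 1 : Basis (Fin (ν + 1))) ≠ 0 := fun h => by
      have := congrFun h 0
      simp at this
    have hy : Function.update (Sum.elim x (0 : Basis (Fin (ν + 1)))) L.flag ((Sum.elim x
        (0 : Basis (Fin (ν + 1)))) L.flag + (L.ok p K (Sum.elim x 0) + 1)) =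
        Sum.elim x (Function.update 0 0 1) := by
      rw [hok, hup]; rfl
    have hfix := hMfail hJ _ hne
    have hfixD : (M x ^ D).mulVec (ket (Function.update 0 0 1)) = ket (Function.update 0 0 1) := by
      have := aeval_mulVec_of_fixed hfix (Polynomial.X ^ D)
      simpa using this
    rw [hentry _ _ rfl hy, aeval_mulVec_of_fixed hfix, Matrix.mulVec_smul]
    conv_lhs => rw [← hfixD]
    rw [conjTranspose_pow_mulVec hMu, Pi.smul_apply, ket_apply, if_neg hne.symm, smul_zero, ite_self]

end MeshCircuit

end QuFEM
end

noncomputable section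
namespace QuFEM

/-! ### State-preparation pairs and block-encodings -/

section Encoding

theorem signOp_mem_unitary {Q : Type} [Fintype Q] [DecidableEq Q] (f : Basis Q → Fin 2) :
    signOp f ∈ Matrix.unitaryGroup (Basis Q) ℂ := by
  rw [Matrix.mem_unitaryGroup_iff, Matrix.star_eq_conjTranspose, signOp,
    Matrix.diagonal_conjTranspose, Matrix.diagonal_mul_diagonal, ← Matrix.diagonal_one]
  congr 1
  funext x
  rw [Pi.star_apply]
  rcases fin_two_cases (f x) with h | h <;> simp [h]

theorem exists_unitary_column {b : ℕ} (v : Basis (Fin b) → ℝ) (hv : ∀ u, 0 ≤ v u)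
    (hs : ∑ u, v u ^ 2 = 1) :
    ∃ V ∈ Matrix.unitaryGroup (Basis (Fin b)) ℂ, ∀ u, V u 0 = v u := by
  obtain ⟨V, hV, -, hval⟩ := exists_statePrep (Q := Fin b) b 0 Fin.elim0
    (Function.Embedding.refl _) (fun i => i.elim0) (fun _ => v) (fun _ => hv) (fun _ => hs)
  refine ⟨V, hV.mem_unitary, fun u => ?_⟩
  have h := hval 0 rfl u
  rwa [show patch (Function.Embedding.refl (Fin b)) 0 u = u from
    funext fun i => patch_apply (Function.Embedding.refl _) 0 u i] at h

/-- State-preparation pairs. -/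
theorem exists_prepPair {b : ℕ} (hb : 1 ≤ b) (c : Basis (Fin b) → ℝ) {α : ℝ} (hα : 0 < α)
    (h : ∑ t, |c t| = α ∨ ∀ t, c t = 0) :
    ∃ PL PR : Matrix.unitaryGroup (Basis (Fin b)) ℂ, ∀ t,
      star ((PL : Op (Fin b)) t 0) * (PR : Op (Fin b)) t 0 = ((c t / α : ℝ) : ℂ) := by
  rcases h with h | h
  · obtain ⟨V, hV, hcol⟩ := exists_unitary_column (fun t => √(|c t| / α))
      (fun _ => Real.sqrt_nonneg _) (by
        simp only [Real.sq_sqrt (div_nonneg (abs_nonneg _) hα.le)]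
        rw [← Finset.sum_div, h, div_self hα.ne'])
    -- Both columns hold square roots of `|c| / α`; the signs of the coefficients are put into `PL`.
    refine ⟨⟨_, mul_mem (signOp_mem_unitary fun t => if c t < 0 then 1 else 0) hV⟩, ⟨V, hV⟩,
      fun t => ?_⟩
    simp only [signOp, Matrix.diagonal_mul, hcol]
    rw [star_mul', Complex.star_def, Complex.conj_ofReal, mul_assoc,
      ← Complex.ofReal_mul, Real.mul_self_sqrt (div_nonneg (abs_nonneg _) hα.le)]
    rcases lt_or_ge (c t) 0 with h0 | h0
    · rw [if_pos h0, abs_of_neg h0]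
      simp [neg_div]
    · rw [if_neg h0.not_gt, abs_of_nonneg h0]
      simp
  -- If all coefficients vanish, the two columns are distinct basis states, whose entrywise product
  -- is zero. Their existence needs `b ≥ 1`.
  · have hcolumn : ∀ s : Basis (Fin b), ∃ V ∈ Matrix.unitaryGroup (Basis (Fin b)) ℂ,
        ∀ u, V u 0 = ((if u = s then 1 else 0 : ℝ) : ℂ) := fun s =>
      exists_unitary_column _ (fun u => by split_ifs <;> norm_num) (by simp)
    obtain ⟨V, hV, hcol⟩ := hcolumn 0
    obtain ⟨V', hV', hcol'⟩ := hcolumn 1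
    refine ⟨⟨V, hV⟩, ⟨V', hV'⟩, fun t => ?_⟩
    have hne : (0 : Basis (Fin b)) ≠ 1 := fun h => by
      have := congrFun h ⟨0, hb⟩
      simp at this
    simp only [hcol, hcol', h t, zero_div]
    by_cases ht : t = 0
    · subst ht; simp [hne]
    · simp [ht]

theorem Impl.exists_fin {Q : Type} [Fintype Q] [DecidableEq Q] {N : ℕ} {V : Op Q}
    (h : Impl N V) : ∃ (w : ℕ) (gates : List (Gate (Q ⊕ Fin w))), gates.length ≤ N ∧
      Carries (circuitOp gates) V := by
  obtain ⟨w, i1, i2, gates, hl, hc⟩ := h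
  refine ⟨Fintype.card w, gates.map (Gate.map ((Function.Embedding.refl Q).sumMap
    (Fintype.equivFin w).toEmbedding)), by simpa, ?_⟩
  rw [circuitOp_map]
  have := hc.map (Function.Embedding.refl Q) (Fintype.equivFin w).toEmbedding
  rwa [onWires_refl] at this

variable {n a b : ℕ}

theorem implementableWith_of_impl {N : ℕ} {U : Op (Fin n ⊕ Fin a)} (hU : Impl N U)
    (reg : Fin b ↪ Fin a) (PL PR : Matrix.unitaryGroup (Basis (Fin b)) ℂ) :
    ImplementableWith n a b N
      (onWires (reg.trans Function.Embedding.inr) ((PL : Op (Fin b)).conjTranspose) * U *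
        onWires (reg.trans Function.Embedding.inr) (PR : Op (Fin b))) := by
  obtain ⟨w, gates, hl, hc⟩ := hU.exists_fin
  refine ⟨w, reg, PL, PR, gates, hl, ?_⟩
  have h : ∀ A : Op (Fin b), Carries (onWires (reg.trans (Function.Embedding.inr.trans
      (Function.Embedding.inl : _ ↪ (Fin n ⊕ Fin a) ⊕ Fin w))) A)
      (onWires (reg.trans Function.Embedding.inr) A) := by
    intro A
    have := carries_onWires_inl (w := Fin w) (onWires (reg.trans Function.Embedding.inr) A :
      Op (Fin n ⊕ Fin a))
    rwa [← onWires_trans] at this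
  exact (carries_iff _ _).1 (((h _).mul hc).mul (h _))

/-- The matrix elements of an operator between two state preparations. -/
theorem prep_apply {W κ : Type} [Fintype W] [DecidableEq W] [Fintype κ] [DecidableEq κ]
    (q : κ ↪ W) (U : Op W) (PL PR : Op κ) (x y : Basis W) :
    (onWires q PL.conjTranspose * U * onWires q PR) x y =
      ∑ t, ∑ t', star (PL t' (x ∘ q)) * U (patch q x t') (patch q y t) * PR t (y ∘ q) := by
  rw [Matrix.mul_apply, sum_onWires q y _ fun z hz => by
    rw [onWires_apply_of_not q _ _ _ hz, mul_zero]]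
  refine Finset.sum_congr rfl fun t _ => ?_
  rw [onWires_patch, Matrix.mul_apply, ← onWires_conjTranspose, sum_onWires q x _ fun z hz => by
    rw [Matrix.conjTranspose_apply, onWires_apply_of_not q _ _ _ hz, star_zero, zero_mul],
    Finset.sum_mul]
  refine Finset.sum_congr rfl fun t' _ => ?_
  rw [Matrix.conjTranspose_apply, onWires_patch]

variable {m l ν p K D : ℕ}

/-- The register for the coefficients, read as a point and two local nodes. -/
def coeffEquiv (σ : Fin l ⊕ (Fin m ⊕ Fin m) ≃ Fin b) (hm : p + 1 = 2 ^ m) :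
    Basis (Fin b) ≃ Basis (Fin l) × (Fin (p + 1) × Fin (p + 1)) :=
  (Equiv.arrowCongr σ.symm (Equiv.refl (Fin 2))).trans
    ((Equiv.sumArrowEquivProdArrow _ _ _).trans (Equiv.prodCongr (Equiv.refl _)
      ((Equiv.sumArrowEquivProdArrow _ _ _).trans (Equiv.prodCongr
        (finFunctionFinEquiv.trans (finCongr hm.symm))
        (finFunctionFinEquiv.trans (finCongr hm.symm))))))

/-- The wires on which the circuit acts. -/
def coeffWires (σ : Fin l ⊕ (Fin m ⊕ Fin m) ≃ Fin b) (n : ℕ) :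
    RegWires (Fin n ⊕ (Fin b ⊕ Unit)) n m l where
  data := Function.Embedding.inl
  row i := Sum.inr (Sum.inl (σ (Sum.inr (Sum.inl i))))
  col i := Sum.inr (Sum.inl (σ (Sum.inr (Sum.inr i))))
  point i := Sum.inr (Sum.inl (σ (Sum.inl i)))
  ctrl := Sum.inr (Sum.inr ())
  row_notMem i := by rintro ⟨j, hj⟩; cases hj
  col_notMem i := by rintro ⟨j, hj⟩; cases hj
  ctrl_notMem := by rintro ⟨j, hj⟩; cases hj

theorem nbit_eq_iff {N : ℕ} (hN : N < 2 ^ n) (x : Basis (Fin n)) :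
    x = (fun i : Fin n => nbit N i) ↔ (finFunctionFinEquiv x : ℕ) = N := by
  constructor
  · rintro rfl; exact finFunction_nbit hN
  · intro h
    funext i
    rw [← h, nbit_finFunction]

/-- Block-encoding of the array assembled from the values of a polynomial at points of the
elements. -/
theorem exists_meshEncoding (hn : 1 ≤ n) (hp : 1 ≤ p) (hm : p + 1 = 2 ^ m)
    (hK : 2 ^ n = K * p + 1) (hν : n ≤ 2 ^ ν) (hb : l + (m + m) = b) (ha : b + 1 + (ν + 1) = a)
    (hl : 1 ≤ l) (t : Basis (Fin l) → ℝ)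
    (ht : ∀ a, t a ∈ Set.Icc (0 : ℝ) 1) {q : ℝ[X]} (hq : q.natDegree ≤ D)
    (hq1 : ∀ x ∈ Set.Icc (-1 : ℝ) 1, |q.eval x| ≤ 1)
    (c : Basis (Fin l) → Fin (p + 1) → Fin (p + 1) → ℝ) {α : ℝ} (hα : 0 < α)
    (hc : ∑ i, ∑ j, ∑ k, |c i j k| = α ∨ ∀ i j k, c i j k = 0) :
    ∃ V : Op (Fin n ⊕ Fin a), V ∈ Matrix.unitaryGroup (Basis (Fin n ⊕ Fin a)) ℂ ∧
      ImplementableWith n a b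
        (3 * D * (16 * 2 ^ l * (2 ^ (ν + 1) - 1) + 400 * (n * p) + 451 + 16 * 2 ^ ν + 8 * ν) +
          (400 * (n * p) + 200 * n + 801)) V ∧
      ((α : ℂ) • (Matrix.of fun x y : Basis (Fin n) => V (Sum.elim x 0) (Sum.elim y 0))) =
        toQubits fun I J => ∑ e : Fin K, ∑ j : Fin (p + 1), ∑ k : Fin (p + 1),
          if (I : ℕ) = IX p e j ∧ (J : ℕ) = IX p e k then
            ∑ i, c i j k * q.eval (2 * ((e + t i) / K) - 1) else 0 := by
  have hmn : m ≤ n := by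
    have hK0 : 1 ≤ K := by
      rcases K with _ | K
      · have := Nat.one_lt_two_pow (n := n) (by omega)
        omega
      · omega
    rw [← Nat.pow_le_pow_iff_right (a := 2) (by norm_num), ← hm, hK]
    have := Nat.mul_le_mul_right p hK0
    omega
  let σ : Fin l ⊕ (Fin m ⊕ Fin m) ≃ Fin b := Fintype.equivFinOfCardEq (by simpa using hb)
  -- The ancillas: `b` for the coefficients, one control of signal processing, and `ν + 1` for the
  -- flag and the digit index.
  let η : (Fin b ⊕ Unit) ⊕ Fin (ν + 1) ≃ Fin a := Fintype.equivFinOfCardEq (by simpa using ha)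
  let R := coeffWires σ n
  obtain ⟨U, hU, hUval⟩ := exists_meshCircuit R (ν := ν) hn hmn hp hm hK hν t ht hq hq1
  let E : (Fin n ⊕ (Fin b ⊕ Unit)) ⊕ Fin (ν + 1) ≃ Fin n ⊕ Fin a :=
    (Equiv.sumAssoc _ _ _).trans (Equiv.sumCongr (Equiv.refl _) η)
  let reg : Fin b ↪ Fin a :=
    (Function.Embedding.inl.trans Function.Embedding.inl).trans η.toEmbedding
  let Θ := coeffEquiv σ hm
  let c' : Basis (Fin b) → ℝ := fun s => c (Θ s).1 (Θ s).2.1 (Θ s).2.2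
  have hsumΘ : ∀ F : Basis (Fin l) → Fin (p + 1) → Fin (p + 1) → ℝ,
      ∑ s, F (Θ s).1 (Θ s).2.1 (Θ s).2.2 = ∑ i, ∑ j, ∑ k, F i j k := by
    intro F
    rw [Equiv.sum_comp Θ fun z => F z.1 z.2.1 z.2.2, Fintype.sum_prod_type]
    simp only [Fintype.sum_prod_type]
  obtain ⟨PL, PR, hP⟩ := exists_prepPair (by omega : 1 ≤ b) c' hα (by
    rcases hc with hc | hc
    · left; rw [← hc]; exact hsumΘ fun i j k => |c i j k|
    · right; intro s; exact hc _ _ _)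
  have hU' := hU.onWires E.toEmbedding
  refine ⟨_, ?_, implementableWith_of_impl hU' reg PL PR, ?_⟩
  · have hL : onWires (reg.trans Function.Embedding.inr) ((PL : Op (Fin b)).conjTranspose) ∈
        Matrix.unitaryGroup (Basis (Fin n ⊕ Fin a)) ℂ := onWires_mem_unitary _ (Unitary.star_mem PL.2)
    exact mul_mem (mul_mem hL hU'.mem_unitary) (onWires_mem_unitary _ PR.2)
  ext x y
  rw [Matrix.smul_apply, Matrix.of_apply, prep_apply]
  have hpE : ∀ (z : Basis (Fin n)) (s : Basis (Fin b)),
      (patch (reg.trans Function.Embedding.inr) (Sum.elim z (0 : Basis (Fin a))) s) ∘ E.toEmbedding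
        = Sum.elim (Sum.elim z (Sum.elim s 0)) 0 := by
    intro z s
    have hout : ∀ v, v ∉ Set.range (reg.trans (Function.Embedding.inr : _ ↪ Fin n ⊕ Fin a)) →
        patch (reg.trans Function.Embedding.inr) (Sum.elim z (0 : Basis (Fin a))) s v =
          Sum.elim z (0 : Basis (Fin a)) v := fun v hv => patch_apply_of_notMem _ _ _ hv
    have hinj := η.injective
    funext v
    rcases v with (v | v | v) | v
    · exact hout (Sum.inl v) (by rintro ⟨u, hu⟩; cases hu)
    · exact patch_apply (reg.trans Function.Embedding.inr) _ _ v
    · refine hout (Sum.inr (η (Sum.inl (Sum.inr v)))) ?_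
      rintro ⟨u, hu⟩
      have := hinj (Sum.inr_injective hu)
      cases this
    · refine hout (Sum.inr (η (Sum.inr v))) ?_
      rintro ⟨u, hu⟩
      have := hinj (Sum.inr_injective hu)
      cases this
  have hUE : ∀ s s' : Basis (Fin b), onWires E.toEmbedding U
      (patch (reg.trans Function.Embedding.inr) (Sum.elim x (0 : Basis (Fin a))) s')
      (patch (reg.trans Function.Embedding.inr) (Sum.elim y (0 : Basis (Fin a))) s) =
      if s' = s then ((∑ e : Fin K, if (finFunctionFinEquiv x : ℕ) = IX p e (Θ s).2.1 ∧
        (finFunctionFinEquiv y : ℕ) = IX p e (Θ s).2.2 then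
          q.eval (2 * ((e + t (Θ s).1) / K) - 1) else 0 : ℝ) : ℂ) else 0 := by
    intro s s'
    rw [onWires_apply_of _ _ _ _ fun v hv => absurd ⟨E.symm v, by simp⟩ hv, hpE, hpE]
    obtain ⟨h1, h2⟩ := hUval (Sum.elim y (Sum.elim s 0)) (Sum.elim x (Sum.elim s' 0)) rfl rfl
    have hnode : regVal R.data (Sum.elim y (Sum.elim s 0) : Basis (Fin n ⊕ (Fin b ⊕ Unit))) =
      (finFunctionFinEquiv y : ℕ) := rfl
    have hrow : regVal R.row (Sum.elim y (Sum.elim s 0) : Basis (Fin n ⊕ (Fin b ⊕ Unit))) =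
      ((Θ s).2.1 : ℕ) := rfl
    have hcol : regVal R.col (Sum.elim y (Sum.elim s 0) : Basis (Fin n ⊕ (Fin b ⊕ Unit))) =
      ((Θ s).2.2 : ℕ) := rfl
    have hpt : (Sum.elim y (Sum.elim s 0) : Basis (Fin n ⊕ (Fin b ⊕ Unit))) ∘ R.point = (Θ s).1 :=
      rfl
    rw [hnode, hcol] at h1 h2
    rw [hrow, hpt] at h1
    by_cases hex : ∃ e < K, (finFunctionFinEquiv y : ℕ) = IX p e (Θ s).2.2
    · obtain ⟨e, he, hJ⟩ := hex
      -- The node and `k` determine `e` because `p ≥ 1`, so at most one element contributes.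
      rw [h1 e he hJ, Finset.sum_eq_single (⟨e, he⟩ : Fin K)]
      · have hlt : IX p e (Θ s).2.1 < 2 ^ n := by
          have h3 : e * p + p ≤ K * p := by rw [← Nat.succ_mul]; exact Nat.mul_le_mul_right p he
          have h4 := (Θ s).2.1.is_le
          rw [IX, hK]; omega
        have hiff : (Sum.elim x (Sum.elim s' 0) : Basis (Fin n ⊕ (Fin b ⊕ Unit))) =
            patch R.data (Sum.elim y (Sum.elim s 0)) (fun i => nbit (IX p e (Θ s).2.1) i) ↔
            s' = s ∧ (finFunctionFinEquiv x : ℕ) = IX p e (Θ s).2.1 := by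
          have hp : patch R.data (Sum.elim y (Sum.elim s 0))
              (fun i => nbit (IX p e (Θ s).2.1) i) =
              Sum.elim (fun i : Fin n => nbit (IX p e (Θ s).2.1) i) (Sum.elim s 0) := by
            funext v
            rcases v with v | v
            · exact patch_apply R.data _ _ v
            · rw [patch_apply_of_notMem]
              · rfl
              · rintro ⟨u, hu⟩; cases hu
          rw [hp, ← nbit_eq_iff hlt]
          constructor
          · intro h
            exact ⟨congrArg (fun f => f ∘ Sum.inr ∘ Sum.inl) h, congrArg (fun f => f ∘ Sum.inl) h⟩
          · rintro ⟨rfl, h⟩; rw [h]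
        rw [if_congr hiff rfl rfl]
        by_cases hs : s' = s
        · by_cases hx : (finFunctionFinEquiv x : ℕ) = IX p e (Θ s).2.1
          · rw [if_pos ⟨hs, hx⟩, if_pos hs, if_pos ⟨hx, hJ⟩]
          · rw [if_neg fun h => hx h.2, if_pos hs, if_neg fun h => hx h.1, Complex.ofReal_zero]
        · rw [if_neg fun h => hs h.1, if_neg hs]
      · intro e' _ he'
        rw [if_neg]
        rintro ⟨-, h⟩
        rw [hJ, IX, IX] at h
        exact he' (Fin.ext (Nat.eq_of_mul_eq_mul_right (show 0 < p by omega)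
          (Nat.add_right_cancel h).symm))
      · simp
    · rw [h2 fun e he h => hex ⟨e, he, h⟩, Finset.sum_eq_zero, Complex.ofReal_zero, ite_self]
      intro e _
      rw [if_neg]
      rintro ⟨-, h⟩
      exact hex ⟨e, e.2, h⟩
  simp only [hUE]
  have hzero : ∀ z : Basis (Fin n), (Sum.elim z (0 : Basis (Fin a))) ∘
      (reg.trans Function.Embedding.inr) = 0 := fun z => rfl
  -- The circuit preserves the coefficient register, so the double sum over its states collapses to
  -- the diagonal, where the pair supplies `c / α`.
  simp only [hzero, mul_ite, ite_mul, mul_zero, zero_mul, Finset.sum_ite_eq', Finset.mem_univ,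
    if_true, mul_right_comm, hP, ← Complex.ofReal_mul, ← Complex.ofReal_sum]
  rw [smul_eq_mul, ← Complex.ofReal_mul]
  refine congrArg Complex.ofReal ?_
  rw [Finset.mul_sum]
  have h1 := hsumΘ fun i j k => α * (c i j k / α * ∑ e : Fin K,
    if (finFunctionFinEquiv x : ℕ) = IX p e j ∧ (finFunctionFinEquiv y : ℕ) = IX p e k then
      q.eval (2 * ((e + t i) / K) - 1) else 0)
  rw [h1]
  have h2 : ∀ i j k, α * (c i j k / α * ∑ e : Fin K,
      if (finFunctionFinEquiv x : ℕ) = IX p e j ∧ (finFunctionFinEquiv y : ℕ) = IX p e k then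
        q.eval (2 * ((e + t i) / K) - 1) else 0) = ∑ e : Fin K,
      if (finFunctionFinEquiv x : ℕ) = IX p e j ∧ (finFunctionFinEquiv y : ℕ) = IX p e k then
        c i j k * q.eval (2 * ((e + t i) / K) - 1) else 0 := by
    intro i j k
    rw [← mul_assoc, mul_div_cancel₀ _ hα.ne', Finset.mul_sum]
    simp only [mul_ite, mul_zero]
  simp only [h2]
  calc _ = ∑ i, ∑ j : Fin (p + 1), ∑ e : Fin K, ∑ k : Fin (p + 1), (if (finFunctionFinEquiv x : ℕ) =
        IX p e j ∧ (finFunctionFinEquiv y : ℕ) = IX p e k then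
          c i j k * q.eval (2 * ((e + t i) / K) - 1) else 0) :=
        Finset.sum_congr rfl fun i _ => Finset.sum_congr rfl fun j _ => Finset.sum_comm
    _ = ∑ i, ∑ e : Fin K, ∑ j : Fin (p + 1), ∑ k : Fin (p + 1), (if (finFunctionFinEquiv x : ℕ) =
        IX p e j ∧ (finFunctionFinEquiv y : ℕ) = IX p e k then
          c i j k * q.eval (2 * ((e + t i) / K) - 1) else 0) :=
        Finset.sum_congr rfl fun i _ => Finset.sum_comm
    _ = ∑ e : Fin K, ∑ i, ∑ j : Fin (p + 1), ∑ k : Fin (p + 1), (if (finFunctionFinEquiv x : ℕ) =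
        IX p e j ∧ (finFunctionFinEquiv y : ℕ) = IX p e k then
          c i j k * q.eval (2 * ((e + t i) / K) - 1) else 0) := Finset.sum_comm
    _ = ∑ e : Fin K, ∑ j : Fin (p + 1), ∑ k : Fin (p + 1), ∑ i, (if (finFunctionFinEquiv x : ℕ) =
        IX p e j ∧ (finFunctionFinEquiv y : ℕ) = IX p e k then
          c i j k * q.eval (2 * ((e + t i) / K) - 1) else 0) :=
        Finset.sum_congr rfl fun e _ => by
          rw [Finset.sum_comm]
          exact Finset.sum_congr rfl fun j _ => Finset.sum_comm
    _ = _ := by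
        refine Finset.sum_congr rfl fun e _ => Finset.sum_congr rfl fun j _ =>
          Finset.sum_congr rfl fun k _ => ?_
        split_ifs
        · rfl
        · simp

end Encoding

end QuFEM
end

noncomputable section
namespace QuFEM

/-! ### Zeros and orthogonality of the Legendre polynomials -/

section Legendre

/-- The polynomial of Rodrigues' formula. -/
def rodrigues (G : ℕ) : ℝ[X] := X ^ G * (1 - X) ^ G

theorem factorial_mul_legendre (G : ℕ) :
    C (G.factorial : ℝ) * (shiftedLegendre G).map (Int.castRingHom ℝ) =
      derivative^[G] (rodrigues G) := by
  have h := congrArg (Polynomial.map (Int.castRingHom ℝ)) (factorial_mul_shiftedLegendre_eq G)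
  rw [← iterate_derivative_map] at h
  simpa [rodrigues] using h

theorem isRoot_iterate_rodrigues {G k : ℕ} (hk : k < G) {x : ℝ} (hx : x = 0 ∨ x = 1) :
    (derivative^[k] (rodrigues G)).eval x = 0 := by
  rcases hx with rfl | rfl
  · have h : (X : ℝ[X]) ^ G ∣ rodrigues G := dvd_mul_right _ _
    obtain ⟨c, hc⟩ := pow_sub_dvd_iterate_derivative_of_pow_dvd k h
    rw [hc]
    simp [show G - k ≠ 0 by omega]
  · have h : (1 - X : ℝ[X]) ^ G ∣ rodrigues G := dvd_mul_left _ _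
    obtain ⟨c, hc⟩ := pow_sub_dvd_iterate_derivative_of_pow_dvd k h
    rw [hc]
    simp [show G - k ≠ 0 by omega]

theorem rodrigues_ne_zero (G : ℕ) : rodrigues G ≠ 0 := by
  intro h
  have := congrArg (eval 2) h
  simp [rodrigues] at this
  norm_num at this

theorem natDegree_rodrigues (G : ℕ) : (rodrigues G).natDegree = 2 * G := by
  have h1 : (1 - X : ℝ[X]).natDegree = 1 := by compute_degree!
  have h2 : (1 - X : ℝ[X]) ≠ 0 := by intro h; rw [h] at h1; simp at h1
  rw [rodrigues, natDegree_mul (pow_ne_zero _ X_ne_zero) (pow_ne_zero _ h2), natDegree_X_pow,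
    natDegree_pow, h1]
  omega

theorem iterate_rodrigues_ne_zero {G k : ℕ} (hk : k ≤ 2 * G) :
    derivative^[k] (rodrigues G) ≠ 0 := by
  intro h
  have := coeff_iterate_derivative (p := rodrigues G) (k := k) (2 * G - k)
  rw [h, coeff_zero, Nat.sub_add_cancel hk, ← natDegree_rodrigues G, coeff_natDegree,
    nsmul_eq_mul, eq_comm, mul_eq_zero] at this
  rcases this with h1 | h1
  · have h2 : (rodrigues G).natDegree.descFactorial k = 0 := by exact_mod_cast h1
    rw [Nat.descFactorial_eq_zero_iff_lt, natDegree_rodrigues] at h2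
    omega
  · exact rodrigues_ne_zero G (leadingCoeff_eq_zero.1 h1)

/-- Rolle: between consecutive zeros lies a zero of the derivative that is not an old one, and the
zeros at 0 and 1 persist while `k < G`. The number of distinct zeros thus grows by one each time. -/
theorem card_roots_iterate_rodrigues {G : ℕ} (k : ℕ) (hk : k < G) :
    k + 2 ≤ (derivative^[k] (rodrigues G)).roots.toFinset.card := by
  have hsub : ∀ k < G, ({0, 1} : Finset ℝ) ⊆ (derivative^[k] (rodrigues G)).roots.toFinset := by
    intro k hk x hx
    rw [Multiset.mem_toFinset, mem_roots (iterate_rodrigues_ne_zero (by omega))]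
    exact isRoot_iterate_rodrigues hk (by simpa using hx)
  induction k with
  | zero =>
    have := Finset.card_le_card (hsub 0 hk)
    rwa [Finset.card_pair zero_ne_one] at this
  | succ k ih =>
    have h1 := ih (by omega)
    have h2 := card_roots_toFinset_le_card_roots_derivative_sdiff_roots_succ
      (derivative^[k] (rodrigues G))
    rw [← Function.iterate_succ_apply' derivative, Nat.succ_eq_add_one] at h2
    have h3 : Disjoint ((derivative^[k + 1] (rodrigues G)).roots.toFinset \
        (derivative^[k] (rodrigues G)).roots.toFinset) {0, 1} :=
      Finset.disjoint_left.2 fun x hx hx' => (Finset.mem_sdiff.1 hx).2 (hsub k (by omega) hx')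
    have h4 := Finset.card_le_card (Finset.union_subset
      (Finset.sdiff_subset (t := (derivative^[k] (rodrigues G)).roots.toFinset)) (hsub (k + 1) hk))
    rw [Finset.card_union_of_disjoint h3, Finset.card_pair zero_ne_one] at h4
    omega

/-- The Legendre polynomial with real coefficients. -/
def legendre (G : ℕ) : ℝ[X] := (shiftedLegendre G).map (Int.castRingHom ℝ)

theorem natDegree_legendre (G : ℕ) : (legendre G).natDegree = G := by
  rw [legendre, natDegree_map_eq_of_injective Int.cast_injective, natDegree_shiftedLegendre]

theorem legendre_ne_zero (G : ℕ) : legendre G ≠ 0 := by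
  intro h
  have h1 := iterate_rodrigues_ne_zero (G := G) (k := G) (by omega)
  rw [← factorial_mul_legendre] at h1
  exact h1 (by rw [show (shiftedLegendre G).map (Int.castRingHom ℝ) = 0 from h, mul_zero])

/-- The last Rolle step, from `G + 1` zeros of the derivative of order `G - 1`; the endpoints are
now lost, and the degree gives the matching upper bound. -/
theorem card_roots_legendre {G : ℕ} (hG : 1 ≤ G) : (legendre G).roots.toFinset.card = G := by
  apply le_antisymm
  · exact (Multiset.toFinset_card_le _).trans ((card_roots' _).trans (natDegree_legendre G).le)
  · have h1 := card_roots_iterate_rodrigues (G := G) (G - 1) (by omega)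
    have h2 := card_roots_toFinset_le_card_roots_derivative_sdiff_roots_succ
      (derivative^[G - 1] (rodrigues G))
    rw [← Function.iterate_succ_apply' derivative, Nat.succ_eq_add_one, Nat.sub_add_cancel hG,
      ← factorial_mul_legendre, roots_C_mul _ (by exact_mod_cast G.factorial_ne_zero)] at h2
    have h3 := Finset.card_le_card (Finset.sdiff_subset (s := (legendre G).roots.toFinset)
      (t := (derivative^[G - 1] (rodrigues G)).roots.toFinset))
    rw [legendre] at h3 ⊢
    omega

/-- The polynomial splits into distinct linear factors over the reals, so vanishing at its zeros
already means divisibility. -/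
theorem legendre_dvd {G : ℕ} (hG : 1 ≤ G) {h : ℝ[X]}
    (hh : ∀ x, (legendre G).eval x = 0 → h.eval x = 0) : legendre G ∣ h := by
  by_cases h0 : h = 0
  · rw [h0]; exact dvd_zero _
  have hcard : Multiset.card (legendre G).roots = (legendre G).natDegree := by
    apply le_antisymm (card_roots' _)
    refine (natDegree_legendre G).trans_le ((card_roots_legendre hG).symm.trans_le ?_)
    exact Multiset.toFinset_card_le (legendre G).roots
  have hnodup : (legendre G).roots.Nodup := by
    rw [← Multiset.toFinset_card_eq_card_iff_nodup, card_roots_legendre hG, hcard,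
      natDegree_legendre]
  have hle : (legendre G).roots ≤ h.roots := by
    rw [Multiset.le_iff_subset hnodup]
    intro x hx
    rw [mem_roots h0]
    exact hh x (isRoot_of_mem_roots hx)
  have h1 := (Multiset.prod_X_sub_C_dvd_iff_le_roots h0 _).2 hle
  rw [← C_leadingCoeff_mul_prod_multiset_X_sub_C hcard]
  exact (IsUnit.mul_left_dvd (isUnit_C.2 (isUnit_iff_ne_zero.2
    (leadingCoeff_ne_zero.2 (legendre_ne_zero G))))).2 h1

/-- Integration by parts moves one derivative onto `g`, lowering its degree. Boundary terms vanish
because the derivatives of order below `G` vanish at 0 and 1. -/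
theorem integral_iterate_rodrigues {G : ℕ} (k : ℕ) (hk : k ≤ G) :
    ∀ g : ℝ[X], g.degree < k →
      ∫ x in (0 : ℝ)..1, (derivative^[k] (rodrigues G)).eval x * g.eval x = 0 := by
  induction k with
  | zero =>
    intro g hg
    have : g = 0 := degree_eq_bot.1 (Nat.WithBot.lt_zero_iff.1 (by simpa using hg))
    simp [this]
  | succ k ih =>
    intro g hg
    have h1 : g.derivative.degree < k := by
      by_cases h0 : g = 0
      · rw [h0, derivative_zero, degree_zero]; exact WithBot.bot_lt_coe _
      · refine (degree_derivative_lt h0).trans_le ?_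
        rw [degree_eq_natDegree h0] at hg ⊢
        have : g.natDegree < k + 1 := by exact_mod_cast hg
        exact_mod_cast Nat.lt_succ_iff.1 this
    have h2 := intervalIntegral.integral_mul_deriv_eq_deriv_mul (a := 0) (b := 1)
      (u := fun x => g.eval x) (v := fun x => (derivative^[k] (rodrigues G)).eval x)
      (u' := fun x => g.derivative.eval x)
      (v' := fun x => (derivative^[k + 1] (rodrigues G)).eval x)
      (fun x _ => g.hasDerivAt x)
      (fun x _ => by
        rw [Function.iterate_succ_apply']
        exact (derivative^[k] (rodrigues G)).hasDerivAt x)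
      (g.derivative.continuous.intervalIntegrable _ _)
      ((derivative^[k + 1] (rodrigues G)).continuous.intervalIntegrable _ _)
    simp only [isRoot_iterate_rodrigues (show k < G by omega) (Or.inl rfl),
      isRoot_iterate_rodrigues (show k < G by omega) (Or.inr rfl), mul_zero, sub_zero] at h2
    have h3 := ih (by omega) _ h1
    rw [show (∫ x in (0 : ℝ)..1, (derivative^[k + 1] (rodrigues G)).eval x * g.eval x) =
      ∫ x in (0 : ℝ)..1, g.eval x * (derivative^[k + 1] (rodrigues G)).eval x from
        intervalIntegral.integral_congr fun x _ => mul_comm _ _, h2,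
      show (∫ x in (0 : ℝ)..1, g.derivative.eval x * (derivative^[k] (rodrigues G)).eval x) =
        ∫ x in (0 : ℝ)..1, (derivative^[k] (rodrigues G)).eval x * g.derivative.eval x from
        intervalIntegral.integral_congr fun x _ => mul_comm _ _, h3, sub_zero]

/-- Gauss quadrature: the integral of a polynomial of low degree which vanishes at the Gauss
points is zero. -/
theorem integral_eq_zero_of_gauss {G D r : ℕ} (hG : 1 ≤ G) (hDr : D + r ≤ 2 * G - 1) {v h : ℝ[X]}
    (hv : v.natDegree ≤ D) (hh : h.natDegree ≤ r)
    (h0 : ∀ x, (legendre G).eval x = 0 → h.eval x = 0) :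
    ∫ x in (0 : ℝ)..1, v.eval x * h.eval x = 0 := by
  obtain ⟨w, hw⟩ := legendre_dvd hG h0
  by_cases hw0 : w = 0
  · rw [hw, hw0]; simp
  by_cases hv0 : v = 0
  · rw [hv0]; simp
  have hdeg : w.natDegree + G = h.natDegree := by
    rw [hw, natDegree_mul (legendre_ne_zero G) hw0, natDegree_legendre, add_comm]
  -- The quotient `w` has degree at most `r - G`, so `v * w` has degree at most `D + r - G < G`: the
  -- exactness range of the Gauss rule.
  have h1 := integral_iterate_rodrigues G le_rfl (v * w) (by
    rw [degree_eq_natDegree (mul_ne_zero hv0 hw0), natDegree_mul hv0 hw0]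
    exact_mod_cast (by omega : v.natDegree + w.natDegree < G))
  rw [← factorial_mul_legendre] at h1
  have h2 : ∀ x, (C (G.factorial : ℝ) * (shiftedLegendre G).map (Int.castRingHom ℝ)).eval x *
      (v * w).eval x = G.factorial * (v.eval x * h.eval x) := by
    intro x
    rw [hw, legendre]
    simp only [eval_mul, eval_C]
    ring
  simp only [h2] at h1
  rw [intervalIntegral.integral_const_mul, mul_eq_zero] at h1
  rcases h1 with h1 | h1
  · exact absurd h1 (by exact_mod_cast G.factorial_ne_zero)
  · exact h1

/-- The coefficients alternate in sign, so at a nonpositive argument no term is negative and the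
constant term is 1. With the reflection symmetry this confines all zeros to the open unit interval.
-/
theorem legendre_eval_pos {G : ℕ} {x : ℝ} (hx : x ≤ 0) : 0 < (legendre G).eval x := by
  rw [legendre, eval_map, eval₂_eq_sum_range, natDegree_shiftedLegendre]
  apply Finset.sum_pos'
  · intro i _
    rw [coeff_shiftedLegendre]
    have : (Int.castRingHom ℝ) ((-1) ^ i * (G.choose i : ℤ) * ((G + i).choose G : ℤ)) * x ^ i =
        (G.choose i : ℝ) * ((G + i).choose G : ℝ) * (-x) ^ i := by
      rw [neg_pow x]; simp; ring
    rw [this]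
    have : 0 ≤ -x := by linarith
    positivity
  · refine ⟨0, by simp, ?_⟩
    rw [coeff_shiftedLegendre]; simp

theorem legendre_eval_symm (G : ℕ) (x : ℝ) :
    (legendre G).eval x = (-1) ^ G * (legendre G).eval (1 - x) := by
  have h := shiftedLegendre_eval_symm G x
  rw [aeval_def, aeval_def] at h
  simpa [legendre, eval_map] using h

theorem mem_Ioo_of_legendre {G : ℕ} {x : ℝ} (hx : (legendre G).eval x = 0) :
    x ∈ Set.Ioo (0 : ℝ) 1 := by
  constructor
  · by_contra h
    exact (legendre_eval_pos (not_lt.1 h)).ne' hx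
  · by_contra h
    rw [legendre_eval_symm] at hx
    have := legendre_eval_pos (G := G) (x := 1 - x) (by linarith [not_lt.1 h])
    rcases mul_eq_zero.1 hx with h1 | h1
    · exact pow_ne_zero _ (by norm_num) h1
    · exact this.ne' h1

/-- `IsGaussPoint` reverses the orientation of the interval; the symmetry of the zeros compensates
for it. -/
theorem isGaussPoint_of_legendre {G : ℕ} {s : ℝ} (hs : (legendre G).eval s = 0) :
    IsGaussPoint G (2 * s - 1) := by
  have h1 : (legendre G).eval (1 - s) = 0 := by
    rw [legendre_eval_symm, sub_sub_cancel, hs, mul_zero]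
  rw [IsGaussPoint, show (1 - (2 * s - 1)) / 2 = 1 - s by ring, aeval_def]
  simpa [legendre, eval_map] using h1

end Legendre

end QuFEM
end

noncomputable section
namespace QuFEM

/-! ### Quadrature rules with few points -/

section Quadrature

/-- A discrete measure can be replaced by one with at most `N` atoms, without changing the first
`N` moments and without increasing the integral of `Ψ`. -/
theorem exists_weights_few {ι : Type*} [Fintype ι] {N : ℕ} (hN : 1 ≤ N) (Ψ : ℝ → ℝ) (t : ι → ℝ)
    (m : ℕ) : ∀ w : ι → ℝ, (∀ i, 0 ≤ w i) → (Finset.univ.filter (fun i => w i ≠ 0)).card = m →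
      ∃ w' : ι → ℝ, (∀ i, 0 ≤ w' i) ∧ (Finset.univ.filter (fun i => w' i ≠ 0)).card ≤ N ∧
        (∀ k < N, ∑ i, w' i * t i ^ k = ∑ i, w i * t i ^ k) ∧
        ∑ i, w' i * Ψ (t i) ≤ ∑ i, w i * Ψ (t i) := by
  classical
  induction m using Nat.strong_induction_on with
  | _ m ih =>
  intro w hw hm
  by_cases hmN : m ≤ N
  · exact ⟨w, hw, hm.trans_le hmN, fun _ _ => rfl, le_rfl⟩
  set s := Finset.univ.filter (fun i => w i ≠ 0) with hs
  -- More than `N` moment vectors in an `N`-dimensional space are dependent.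
  have hdep : ¬ LinearIndepOn ℝ (fun i => (fun k : Fin N => t i ^ (k : ℕ))) (s : Set ι) := by
    intro h
    have := LinearIndependent.fintype_card_le_finrank h
    simp at this
    omega
  rw [not_linearIndepOn_finset_iff] at hdep
  -- The sign of the dependence is chosen so that subtracting it does not increase the integral of
  -- `Ψ`; this inequality needs no extra atom.
  have hdep' : ∃ f : ι → ℝ, (∀ k < N, ∑ i ∈ s, f i * t i ^ k = 0) ∧
      0 ≤ ∑ i ∈ s, f i * Ψ (t i) ∧ ∃ i ∈ s, f i ≠ 0 := by
    obtain ⟨f, hf, hne⟩ := hdep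
    have hf' : ∀ k < N, ∑ i ∈ s, f i * t i ^ k = 0 := by
      intro k hk
      have := congrFun hf ⟨k, hk⟩
      simpa [Finset.sum_apply] using this
    rcases le_total 0 (∑ i ∈ s, f i * Ψ (t i)) with h | h
    · exact ⟨f, hf', h, hne⟩
    · refine ⟨fun i => -f i, fun k hk => ?_, ?_, ?_⟩
      · simp [hf' k hk]
      · simpa using h
      · simpa using hne
  obtain ⟨f, hf, hΨ, hne⟩ := hdep'
  -- The zeroth moment of `f` vanishes, so `f` takes positive values; here `N ≥ 1` enters.
  have hpos : (s.filter (fun i => 0 < f i)).Nonempty := by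
    have h0 : ∑ i ∈ s, f i = 0 := by simpa using hf 0 (by omega)
    obtain ⟨i, hi, hi'⟩ := Finset.exists_pos_of_sum_zero_of_exists_nonzero f h0 hne
    exact ⟨i, Finset.mem_filter.2 ⟨hi, hi'⟩⟩
  obtain ⟨i₀, hi₀, hmin⟩ := Finset.exists_min_image _ (fun i => w i / f i) hpos
  rw [Finset.mem_filter] at hi₀
  -- The largest multiple of `f` that keeps all weights nonnegative; at that value the weight of
  -- `i₀` becomes zero and the support shrinks.
  set τ := w i₀ / f i₀ with hτ
  have hτ0 : 0 ≤ τ := div_nonneg (hw _) hi₀.2.le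
  set w₁ : ι → ℝ := fun i => if i ∈ s then w i - τ * f i else 0 with hw₁
  have hsum : ∀ g : ι → ℝ, ∑ i, w₁ i * g i = ∑ i, w i * g i - τ * ∑ i ∈ s, f i * g i := by
    intro g
    have h1 : ∑ i, w i * g i = ∑ i ∈ s, w i * g i := by
      symm
      apply Finset.sum_subset (Finset.subset_univ _)
      intro i _ hi
      have : w i = 0 := by simpa [hs] using hi
      rw [this, zero_mul]
    have h2 : ∑ i, w₁ i * g i = ∑ i ∈ s, w₁ i * g i := by
      symm
      apply Finset.sum_subset (Finset.subset_univ _)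
      intro i _ hi
      simp only [hw₁, if_neg hi, zero_mul]
    rw [h1, h2, Finset.mul_sum, ← Finset.sum_sub_distrib]
    refine Finset.sum_congr rfl fun i hi => ?_
    simp only [hw₁, if_pos hi]
    ring
  have hlt : (Finset.univ.filter (fun i => w₁ i ≠ 0)).card < m := by
    rw [← hm]
    apply Finset.card_lt_card
    rw [Finset.ssubset_iff_of_subset]
    · refine ⟨i₀, hi₀.1, ?_⟩
      have : w₁ i₀ = 0 := by
        simp only [hw₁, if_pos hi₀.1, hτ]
        rw [div_mul_cancel₀ _ hi₀.2.ne', sub_self]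
      simp [this]
    · intro i hi
      by_contra h
      simp [hw₁, h] at hi
  obtain ⟨w', h1, h2, h3, h4⟩ := ih _ hlt w₁ (by
    intro i
    simp only [hw₁]
    split_ifs with hi
    · rcases le_or_gt (f i) 0 with h | h
      · nlinarith [hw i, mul_nonneg hτ0 (neg_nonneg.2 h)]
      · have := hmin i (Finset.mem_filter.2 ⟨hi, h⟩)
        rw [le_div_iff₀ h] at this
        linarith
    · exact le_rfl) rfl
  refine ⟨w', h1, h2, fun k hk => ?_, h4.trans ?_⟩
  · rw [h3 k hk, hsum fun i => t i ^ k, hf k hk, mul_zero, sub_zero]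
  · rw [hsum fun i => Ψ (t i)]
    nlinarith [mul_nonneg hτ0 hΨ]

/-- The at most `N` surviving atoms are relabelled by `A`; unused labels receive weight 0 at the
point 0. -/
theorem exists_rule_few {ι A : Type*} [Fintype ι] [Fintype A] {N : ℕ} (hN : 1 ≤ N)
    (hA : N ≤ Fintype.card A) (Ψ : ℝ → ℝ) (t : ι → ℝ) (ht : ∀ i, t i ∈ Set.Icc (0 : ℝ) 1)
    (w : ι → ℝ) (hw : ∀ i, 0 ≤ w i) :
    ∃ (t' w' : A → ℝ), (∀ i, t' i ∈ Set.Icc (0 : ℝ) 1) ∧ (∀ i, 0 ≤ w' i) ∧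
      (∀ k < N, ∑ i, w' i * t' i ^ k = ∑ i, w i * t i ^ k) ∧
      ∑ i, w' i * Ψ (t' i) ≤ ∑ i, w i * Ψ (t i) := by
  obtain ⟨v, hv, hcard, h3, h4⟩ := exists_weights_few hN Ψ t _ w hw rfl
  set s := Finset.univ.filter (fun i => v i ≠ 0) with hs
  obtain ⟨φ⟩ : Nonempty (s ↪ A) := Function.Embedding.nonempty_of_card_le (by
    rw [Fintype.card_coe]; omega)
  have hsum : ∀ g : ℝ → ℝ, ∑ a, Function.extend φ (fun i : s => v i) 0 a *
      g (Function.extend φ (fun i : s => t i) 0 a) = ∑ i, v i * g (t i) := by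
    intro g
    rw [← Fintype.sum_of_injective φ φ.injective (fun i : s => v i * g (t i)) _
      (fun a ha => by
        rw [Function.extend_apply' _ _ _ (by simpa using ha), Pi.zero_apply, zero_mul])
      (fun i => by rw [φ.injective.extend_apply, φ.injective.extend_apply])]
    rw [Finset.sum_coe_sort s (fun i => v i * g (t i))]
    apply Finset.sum_subset (Finset.subset_univ _)
    intro i _ hi
    have : v i = 0 := by simpa [hs] using hi
    rw [this, zero_mul]
  refine ⟨Function.extend φ (fun i : s => t i) 0, Function.extend φ (fun i : s => v i) 0,
    fun a => ?_, fun a => ?_, fun k hk => ?_, ?_⟩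
  · by_cases ha : ∃ i, φ i = a
    · obtain ⟨i, rfl⟩ := ha
      rw [φ.injective.extend_apply]; exact ht i
    · rw [Function.extend_apply' _ _ _ ha]; simp
  · by_cases ha : ∃ i, φ i = a
    · obtain ⟨i, rfl⟩ := ha
      rw [φ.injective.extend_apply]; exact hv i
    · rw [Function.extend_apply' _ _ _ ha]; simp
  · rw [hsum fun x => x ^ k, h3 k hk]
  · rw [hsum Ψ]; exact h4

/-- The first `N` moments of the probability measures on `[0, 1]` with atoms labelled by `A`,
together with all upper bounds for the integral of `Ψ`. -/
def momentSet (A : Type) [Fintype A] (N : ℕ) (Ψ : ℝ → ℝ) : Set ((Fin N → ℝ) × ℝ) :=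
  {y | ∃ t w : A → ℝ, (∀ i, t i ∈ Set.Icc (0 : ℝ) 1) ∧ w ∈ stdSimplex ℝ A ∧
    (∀ k : Fin N, ∑ i, w i * t i ^ (k : ℕ) = y.1 k) ∧ ∑ i, w i * Ψ (t i) ≤ y.2}

variable {A : Type} [Fintype A] {N : ℕ} {Ψ : ℝ → ℝ}

/-- Nodes and weights range over a compact set, and the projection of a closed set along a compact
factor is closed. -/
theorem isClosed_momentSet (hΨ : Continuous Ψ) : IsClosed (momentSet A N Ψ) := by
  set X : Set ((A → ℝ) × (A → ℝ)) :=
    (Set.univ.pi fun _ => Set.Icc (0 : ℝ) 1) ×ˢ stdSimplex ℝ A with hX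
  have hXc : IsCompact X :=
    (isCompact_univ_pi fun _ => isCompact_Icc).prod (isCompact_stdSimplex ℝ A)
  have : CompactSpace X := isCompact_iff_compactSpace.1 hXc
  have himage : momentSet A N Ψ = Prod.snd ''
      {z : X × ((Fin N → ℝ) × ℝ) | (∀ k : Fin N, ∑ i, z.1.1.2 i * z.1.1.1 i ^ (k : ℕ) = z.2.1 k) ∧
        ∑ i, z.1.1.2 i * Ψ (z.1.1.1 i) ≤ z.2.2} := by
    ext y
    constructor
    · rintro ⟨t, w, ht, hw, h1, h2⟩
      exact ⟨(⟨(t, w), Set.mk_mem_prod (fun i _ => ht i) hw⟩, y), ⟨h1, h2⟩, rfl⟩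
    · rintro ⟨⟨⟨⟨t, w⟩, ht, hw⟩, y'⟩, ⟨h1, h2⟩, rfl⟩
      exact ⟨t, w, fun i => ht i (Set.mem_univ i), hw, h1, h2⟩
  rw [himage]
  apply isClosedMap_snd_of_compactSpace
  rw [Set.ofPred_and]
  apply IsClosed.inter
  · rw [Set.ofPred_forall]
    exact isClosed_iInter fun k => isClosed_eq (by fun_prop) (by fun_prop)
  · exact isClosed_le (by fun_prop) (by fun_prop)

/-- A mixture of two rules has twice as many atoms, and `exists_rule_few` reduces them to `N` again.
It may lower the integral of `Ψ`, which is why the last coordinate records upper bounds rather than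
values. -/
theorem convex_momentSet (hN : 1 ≤ N) (hA : N ≤ Fintype.card A) :
    Convex ℝ (momentSet A N Ψ) := by
  rintro y ⟨t, w, ht, hw, h1, h2⟩ y' ⟨t', w', ht', hw', h1', h2'⟩ a b ha hb hab
  obtain ⟨s, v, hs, hv, h3, h4⟩ := exists_rule_few (A := A) hN hA Ψ (Sum.elim t t')
    (by rintro (i | i); exacts [ht i, ht' i]) (Sum.elim (a • w) (b • w'))
    (by rintro (i | i); exacts [mul_nonneg ha (hw.1 i), mul_nonneg hb (hw'.1 i)])
  simp only [Fintype.sum_sum_type, Sum.elim_inl, Sum.elim_inr, Pi.smul_apply, smul_eq_mul,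
    mul_assoc, ← Finset.mul_sum] at h3 h4
  refine ⟨s, v, hs, ⟨hv, ?_⟩, fun k => ?_, h4.trans ?_⟩
  · have := h3 0 (by omega)
    simp only [pow_zero, mul_one, hw.2, hw'.2, hab] at this
    exact this
  · rw [h3 k k.2, h1 k, h1' k]; simp
  · simp only [Prod.snd_add, Prod.smul_snd, smul_eq_mul]
    gcongr

theorem mem_momentSet (hA : 1 ≤ Fintype.card A) {x : ℝ} (hx : x ∈ Set.Icc (0 : ℝ) 1) :
    ((fun k : Fin N => x ^ (k : ℕ)), Ψ x) ∈ momentSet A N Ψ := by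
  classical
  obtain ⟨a⟩ : Nonempty A := Fintype.card_pos_iff.1 hA
  refine ⟨fun _ => x, Pi.single a 1, fun _ => hx, single_mem_stdSimplex ℝ a, fun k => ?_, ?_⟩
  · rw [← Finset.sum_mul]; simp
  · rw [← Finset.sum_mul]; simp

/-- A quadrature rule on `[0, 1]` with nonnegative weights which integrates polynomials of degree
less than `N` exactly and does not exceed the integral of `Ψ`. -/
theorem exists_quadrature (hN : 1 ≤ N) (hA : N ≤ Fintype.card A) (hΨ : Continuous Ψ) :
    ∃ t w : A → ℝ, (∀ i, t i ∈ Set.Icc (0 : ℝ) 1) ∧ (∀ i, 0 ≤ w i) ∧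
      (∀ g : ℝ[X], g.natDegree < N → ∑ i, w i * g.eval (t i) = ∫ x in (0 : ℝ)..1, g.eval x) ∧
      ∑ i, w i * Ψ (t i) ≤ ∫ x in (0 : ℝ)..1, Ψ x := by
  set μ : Measure ℝ := volume.restrict (Set.Ioc 0 1) with hμ
  have : IsProbabilityMeasure μ := ⟨by simp [hμ]⟩
  set γ : ℝ → (Fin N → ℝ) × ℝ := fun x => ((fun k : Fin N => x ^ (k : ℕ)), Ψ x) with hγ
  have hγc : Continuous γ := by fun_prop
  have hγi : Integrable γ μ :=
    (hγc.continuousOn.integrableOn_compact isCompact_Icc).mono_set Set.Ioc_subset_Icc_self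
  -- The mean of a curve in a closed convex set lies in that set; point masses show that the curve
  -- does.
  have h1 : ∫ x, γ x ∂μ ∈ momentSet A N Ψ := by
    refine (convex_momentSet hN hA).integral_mem (isClosed_momentSet hΨ) ?_ hγi
    filter_upwards [ae_restrict_mem measurableSet_Ioc] with x hx
    exact mem_momentSet (hN.trans hA) (Set.Ioc_subset_Icc_self hx)
  obtain ⟨t, w, ht, hw, h2, h3⟩ := h1
  have hmom : ∀ k : Fin N, ∑ i, w i * t i ^ (k : ℕ) = ∫ x in (0 : ℝ)..1, x ^ (k : ℕ) := by
    intro k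
    rw [h2 k, intervalIntegral.integral_of_le zero_le_one, fst_integral hγi,
      eval_integral (fun i => (hγi.fst.eval i))]
  refine ⟨t, w, ht, hw.1, fun g hg => ?_, ?_⟩
  · simp only [eval_eq_sum_range]
    rw [intervalIntegral.integral_finsetSum fun k _ =>
      (by fun_prop : Continuous fun x : ℝ => g.coeff k * x ^ k).intervalIntegrable _ _]
    simp only [Finset.mul_sum]
    rw [Finset.sum_comm]
    refine Finset.sum_congr rfl fun k hk => ?_
    rw [intervalIntegral.integral_const_mul,
      ← hmom ⟨k, by have := Finset.mem_range.1 hk; omega⟩, Finset.mul_sum]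
    exact Finset.sum_congr rfl fun i _ => by ring
  · rw [intervalIntegral.integral_of_le zero_le_one]
    rwa [snd_integral hγi] at h3

end Quadrature

end QuFEM
end

noncomputable section
namespace QuFEM

/-! ### Elemental integrals -/

section Elements

variable {K p : ℕ}

/-- The restriction of a polynomial to the element `e`, in the local coordinate. -/
def localPoly (K e : ℕ) (P : ℝ[X]) : ℝ[X] := P.comp (C ((K : ℝ)⁻¹) * (X + C (e : ℝ)))

theorem localPoly_eval (K e : ℕ) (P : ℝ[X]) (s : ℝ) :
    (localPoly K e P).eval s = P.eval ((e + s) / K) := by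
  rw [localPoly, eval_comp]
  congr 1
  simp only [eval_mul, eval_C, eval_add, eval_X]
  rw [div_eq_inv_mul, add_comm]

theorem natDegree_localPoly_le (K e : ℕ) {P : ℝ[X]} {r : ℕ} (hP : P.natDegree ≤ r) :
    (localPoly K e P).natDegree ≤ r := by
  rw [localPoly, natDegree_comp]
  have : (C ((K : ℝ)⁻¹) * (X + C (e : ℝ))).natDegree ≤ 1 :=
    (natDegree_C_mul_le _ _).trans (natDegree_X_add_C _).le
  nlinarith

theorem setIntegral_element (hK : 1 ≤ K) (e : ℕ) (g : ℝ → ℝ) :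
    ∫ x in element K e, g x = (K : ℝ)⁻¹ * ∫ s in (0 : ℝ)..1, g ((e + s) / K) := by
  have hK' : (K : ℝ) ≠ 0 := by positivity
  have h := intervalIntegral.integral_comp_add_div (a := 0) (b := 1) g hK' ((e : ℝ) / K)
  simp only [← add_div] at h
  rw [h, smul_eq_mul, inv_mul_cancel_left₀ hK', element, integral_Icc_eq_integral_Ioc,
    intervalIntegral.integral_of_le (by gcongr; linarith)]
  simp

theorem element_subset {e : ℕ} (he : e < K) : element K e ⊆ Set.Icc (0 : ℝ) 1 := by
  have hK : (0 : ℝ) < K := by exact_mod_cast (by omega : 0 < K)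
  refine Set.Icc_subset_Icc (by positivity) ?_
  rw [div_le_one hK]
  exact_mod_cast he

theorem setIntegral_element_congr (e : ℕ) {g h : ℝ → ℝ}
    (hgh : ∀ x ∈ interior (element K e), g x = h x) :
    ∫ x in element K e, g x = ∫ x in element K e, h x := by
  rw [element, interior_Icc] at hgh
  rw [element, integral_Icc_eq_integral_Ioo, integral_Icc_eq_integral_Ioo]
  exact setIntegral_congr_fun measurableSet_Ioo hgh

theorem mem_interior_element (hK : 1 ≤ K) (e : ℕ) {s : ℝ} (hs : s ∈ Set.Ioo (0 : ℝ) 1) :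
    ((e : ℝ) + s) / K ∈ interior (element K e) := by
  have hK' : (0 : ℝ) < K := by positivity
  rw [element, interior_Icc]
  constructor
  · gcongr; linarith [hs.1]
  · gcongr; exact hs.2

variable {b : Fin K → Fin (p + 1) → Fin (p + 1) → ℝ → ℝ}

theorem elemAbs_eq (hK : 1 ≤ K) {e : Fin K} {j k : Fin (p + 1)} {P : ℝ[X]}
    (hP : ∀ x ∈ interior (element K e), b e j k x = P.eval x) :
    elemAbs K b e j k = (K : ℝ)⁻¹ * ∫ s in (0 : ℝ)..1, |(localPoly K e P).eval s| := by
  rw [elemAbs, setIntegral_element_congr (e : ℕ) (h := fun x => |P.eval x|)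
    fun x hx => by rw [hP x hx], setIntegral_element hK]
  simp only [localPoly_eval]

/-- A polynomial which has the values of `b e j k` is integrated by the local values of a
reference element. -/
theorem integral_mul_element {D r G : ℕ} (hK : 1 ≤ K) (hG : 1 ≤ G) (hDr : D + r ≤ 2 * G - 1)
    {e e₀ : Fin K} {j k : Fin (p + 1)} {P P₀ : ℝ[X]}
    (hPr : P.natDegree ≤ r) (hP₀r : P₀.natDegree ≤ r)
    (hP : ∀ x ∈ interior (element K e), b e j k x = P.eval x)
    (hP₀ : ∀ x ∈ interior (element K e₀), b e₀ j k x = P₀.eval x)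
    (hgauss : ∀ x, IsGaussPoint G x →
      b e j k (elemPoint K e x) = b e₀ j k (elemPoint K e₀ x))
    {v : ℝ[X]} (hv : v.natDegree ≤ D) :
    ∫ x in element K e, v.eval x * b e j k x = (K : ℝ)⁻¹ *
      ∫ s in (0 : ℝ)..1, (localPoly K e v).eval s * (localPoly K e₀ P₀).eval s := by
  -- Equal values at the Gauss points of the two elements mean that the difference of the local
  -- polynomials vanishes at the Legendre zeros.
  have h0 := integral_eq_zero_of_gauss hG hDr (natDegree_localPoly_le K e hv)
    (h := localPoly K e P - localPoly K e₀ P₀)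
    ((natDegree_sub_le _ _).trans (max_le (natDegree_localPoly_le K e hPr)
      (natDegree_localPoly_le K e₀ hP₀r))) (by
    intro s hs
    have hpt : ∀ e : Fin K, elemPoint K e (2 * s - 1) = ((e : ℕ) + s) / K := by
      intro e; rw [elemPoint]; congr 1; ring
    have h1 := hgauss _ (isGaussPoint_of_legendre hs)
    rw [hpt, hpt, hP _ (mem_interior_element hK e (mem_Ioo_of_legendre hs)),
      hP₀ _ (mem_interior_element hK e₀ (mem_Ioo_of_legendre hs))] at h1
    rw [eval_sub, localPoly_eval, localPoly_eval, h1, sub_self])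
  rw [setIntegral_element_congr (e : ℕ) (h := fun x => v.eval x * P.eval x)
    fun x hx => by rw [hP x hx], setIntegral_element hK]
  congr 1
  simp only [← localPoly_eval]
  have hi : ∀ u w : ℝ[X], IntervalIntegrable (fun s => u.eval s * w.eval s) volume 0 1 :=
    fun u w => (u.continuous.mul w.continuous).intervalIntegrable _ _
  rw [← sub_eq_zero, ← intervalIntegral.integral_sub (hi _ _) (hi _ _)]
  refine Eq.trans (intervalIntegral.integral_congr fun s _ => ?_) h0
  simp only [eval_sub]
  ring

/-- Coefficients and points which integrate polynomials against the functions `b e j k`, with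
absolute sum at most that of each element. -/
theorem exists_coefficients {A : Type} [Fintype A] {D r G : ℕ} (hK : 1 ≤ K) (hG : 1 ≤ G)
    (hDr : D + r ≤ 2 * G - 1) (hA : 2 * G ≤ Fintype.card A)
    (hb : ∀ (e : Fin K) (j k : Fin (p + 1)), ∃ P : ℝ[X], P.natDegree ≤ r ∧
      ∀ x ∈ interior (element K e), b e j k x = P.eval x)
    (hgauss : ∀ (e e' : Fin K) (j k : Fin (p + 1)) (x : ℝ), IsGaussPoint G x →
      b e j k (elemPoint K e x) = b e' j k (elemPoint K e' x))
    {S : ℝ} (hS : 0 ≤ S) (hβ : ∀ e : Fin K, 0 < S * ∑ j, ∑ k, elemAbs K b e j k)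
    {v : ℝ[X]} (hv : v.natDegree ≤ D) :
    ∃ (t : A → ℝ) (c : A → Fin (p + 1) → Fin (p + 1) → ℝ) (α : ℝ),
      (∀ i, t i ∈ Set.Icc (0 : ℝ) 1) ∧ 0 < α ∧
      (∀ e, α ≤ S * ∑ j, ∑ k, elemAbs K b e j k) ∧
      (∑ i, ∑ j, ∑ k, |c i j k| = α ∨ ∀ i j k, c i j k = 0) ∧
      ∀ (e : Fin K) j k, ∑ i, c i j k * v.eval ((e + t i) / K) =
        S * ∫ x in element K e, v.eval x * b e j k x := by
  choose P hPr hP using hb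
  have : Nonempty (Fin K) := ⟨⟨0, hK⟩⟩
  -- The reference element has the smallest bound, so that `α` satisfies the bounds of all elements
  -- at once.
  obtain ⟨e₀, he₀⟩ := Finite.exists_min fun e : Fin K => S * ∑ j, ∑ k, elemAbs K b e j k
  set L : Fin (p + 1) → Fin (p + 1) → ℝ[X] := fun j k => localPoly K e₀ (P e₀ j k) with hL
  -- Exactness below degree `2 * G` covers products of degree at most `D + r`, and this `Ψ` makes
  -- the absolute sum of the coefficients at most the bound of the reference element.
  obtain ⟨t, w, ht, hw, hex, hΨ⟩ := exists_quadrature (A := A) (N := 2 * G)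
    (Ψ := fun s => ∑ j, ∑ k, |(L j k).eval s|) (by omega) hA (by fun_prop)
  set c : A → Fin (p + 1) → Fin (p + 1) → ℝ :=
    fun i j k => S * (w i * (L j k).eval (t i)) * (K : ℝ)⁻¹ with hc
  have hcsum : ∑ i, ∑ j, ∑ k, |c i j k| ≤ S * ∑ j, ∑ k, elemAbs K b e₀ j k := by
    have h1 : ∑ i, ∑ j, ∑ k, |c i j k| =
        S * ((K : ℝ)⁻¹ * ∑ i, w i * ∑ j, ∑ k, |(L j k).eval (t i)|) := by
      simp only [hc, Finset.mul_sum, abs_mul, abs_of_nonneg hS, abs_of_nonneg (hw _)]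
      refine Finset.sum_congr rfl fun i _ => Finset.sum_congr rfl fun j _ =>
        Finset.sum_congr rfl fun k _ => ?_
      rw [abs_of_nonneg (by positivity : (0 : ℝ) ≤ (K : ℝ)⁻¹)]
      ring
    have h2 : ∑ j, ∑ k, elemAbs K b e₀ j k =
        (K : ℝ)⁻¹ * ∫ s in (0 : ℝ)..1, ∑ j, ∑ k, |(L j k).eval s| := by
      rw [intervalIntegral.integral_finsetSum fun j _ =>
        (by fun_prop : Continuous fun s : ℝ => ∑ k, |(L j k).eval s|).intervalIntegrable _ _,
        Finset.mul_sum]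
      refine Finset.sum_congr rfl fun j _ => ?_
      rw [intervalIntegral.integral_finsetSum fun k _ =>
        (by fun_prop : Continuous fun s : ℝ => |(L j k).eval s|).intervalIntegrable _ _,
        Finset.mul_sum]
      exact Finset.sum_congr rfl fun k _ => elemAbs_eq hK (hP e₀ j k)
    rw [h1, h2]
    gcongr
  have hval : ∀ (e : Fin K) j k, ∑ i, c i j k * v.eval ((e + t i) / K) =
      S * ∫ x in element K e, v.eval x * b e j k x := by
    intro e j k
    rw [integral_mul_element hK hG hDr (hPr e j k) (hPr e₀ j k) (hP e j k) (hP e₀ j k)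
      (hgauss e e₀ j k) hv]
    have h1 := hex (localPoly K e v * L j k) (natDegree_mul_le.trans_lt (by
      have h2 := natDegree_localPoly_le K e hv
      have h3 := natDegree_localPoly_le K e₀ (hPr e₀ j k)
      simp only [hL]
      omega))
    simp only [eval_mul] at h1
    rw [← h1, Finset.mul_sum, Finset.mul_sum]
    refine Finset.sum_congr rfl fun i _ => ?_
    rw [hc, ← localPoly_eval]
    ring
  by_cases h0 : ∑ i, ∑ j, ∑ k, |c i j k| = 0
  -- If all coefficients vanish their sum cannot serve as a positive `α`; the bound of the reference
  -- element is used instead.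
  · refine ⟨t, c, _, ht, hβ e₀, he₀, Or.inr fun i j k => ?_, hval⟩
    rw [Finset.sum_eq_zero_iff_of_nonneg fun i _ =>
      Finset.sum_nonneg fun j _ => Finset.sum_nonneg fun k _ => abs_nonneg _] at h0
    have h1 := h0 i (Finset.mem_univ _)
    rw [Finset.sum_eq_zero_iff_of_nonneg fun j _ =>
      Finset.sum_nonneg fun k _ => abs_nonneg _] at h1
    have h2 := h1 j (Finset.mem_univ _)
    rw [Finset.sum_eq_zero_iff_of_nonneg fun k _ => abs_nonneg _] at h2
    exact abs_eq_zero.1 (h2 k (Finset.mem_univ _))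
  · refine ⟨t, c, _, ht, lt_of_le_of_ne ?_ (Ne.symm h0), fun e => hcsum.trans (he₀ e),
      Or.inl rfl, hval⟩
    exact Finset.sum_nonneg fun i _ => Finset.sum_nonneg fun j _ =>
      Finset.sum_nonneg fun k _ => abs_nonneg _

theorem ae_abs_le_supNorm {f : ℝ → ℝ} (hf : MemLp f ⊤ unitVolume) :
    ∀ᵐ x ∂unitVolume, |f x| ≤ supNorm f := by
  filter_upwards [ae_le_eLpNormEssSup (f := f) (μ := unitVolume)] with x hx
  rw [← eLpNorm_exponent_top] at hx
  have := ENNReal.toReal_mono hf.2.ne hx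
  simpa [supNorm] using this

theorem memLp_eval (q : ℝ[X]) : MemLp (fun x => q.eval x) ⊤ unitVolume := by
  obtain ⟨c, hc⟩ := isCompact_Icc.exists_bound_of_continuousOn
    (q.continuous.continuousOn (s := Set.Icc (0 : ℝ) 1))
  refine memLp_top_of_bound q.continuous.aestronglyMeasurable c ?_
  filter_upwards [ae_restrict_mem measurableSet_Icc] with x hx
  exact hc x hx

/-- By continuity an almost everywhere bound holds everywhere on the interval. Signal processing
needs the bound pointwise. -/
theorem abs_eval_le_of_ae {q : ℝ[X]} {c : ℝ} (h : ∀ᵐ x ∂unitVolume, |q.eval x| ≤ c) {x : ℝ}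
    (hx : x ∈ Set.Icc (0 : ℝ) 1) : |q.eval x| ≤ c := by
  have h1 : (fun x => max |q.eval x| c) =ᵐ[unitVolume] fun _ => c := by
    filter_upwards [h] with x hx
    exact max_eq_right hx
  have h2 := Measure.eqOn_Icc_of_ae_eq volume zero_ne_one h1 (by fun_prop) (by fun_prop) hx
  exact max_eq_right_iff.1 h2

/-- Replacing the factor of an elemental array by another one. -/
theorem abs_elemArray_sub_le {e : Fin K} {j k : Fin (p + 1)} {P : ℝ[X]}
    (hP : ∀ x ∈ interior (element K e), b e j k x = P.eval x)
    {f g : ℝ → ℝ} (hf : MemLp f ⊤ unitVolume) (hg : MemLp g ⊤ unitVolume) {δ : ℝ}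
    (hfg : ∀ᵐ x ∂unitVolume, |f x - g x| ≤ δ) :
    |elemArray K f b e j k - ∫ x in element K e, g x * b e j k x| ≤ δ * elemAbs K b e j k := by
  have hPi : IntegrableOn (fun x => P.eval x) (element K e) :=
    P.continuous.continuousOn.integrableOn_compact isCompact_Icc
  have hle : volume.restrict (element K e) ≤ unitVolume :=
    Measure.restrict_mono (element_subset e.2) le_rfl
  have hi : ∀ {f : ℝ → ℝ}, MemLp f ⊤ unitVolume →
      IntegrableOn (fun x => f x * P.eval x) (element K e) := fun {f} hf =>
    hPi.smul_of_top_right (hf.mono_measure hle)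
  have hint : ∀ f : ℝ → ℝ, ∫ x in element K e, f x * b e j k x =
      ∫ x in element K e, f x * P.eval x := fun f =>
    setIntegral_element_congr (e : ℕ) fun x hx => by rw [hP x hx]
  rw [elemArray, hint, hint, elemAbs, setIntegral_element_congr (e : ℕ)
    (g := fun x => |b e j k x|) (h := fun x => |P.eval x|) fun x hx => by rw [hP x hx],
    ← integral_sub (hi hf) (hi hg), ← integral_const_mul, ← Real.norm_eq_abs]
  refine norm_integral_le_of_norm_le (hPi.abs.const_mul δ) ?_
  filter_upwards [ae_mono hle hfg] with x hx
  rw [← sub_mul, Real.norm_eq_abs, abs_mul]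
  gcongr

end Elements

end QuFEM
end

noncomputable section
namespace QuFEM

/-! ### Spectral norms of assembled matrices -/

section Assembly

/-- Injectivity of `R` and `C` leaves at most one nonzero entry in each row and column, so the
matrix permutes and scales some coordinates and drops the others. -/
theorem norm_toEuclideanCLM_matching_le {ι d : Type} [Fintype ι] [Fintype d] [DecidableEq d]
    {R C : ι → d} (hR : Function.Injective R) (hC : Function.Injective C) {c : ι → ℂ} {M : ℝ}
    (hM : 0 ≤ M) (hc : ∀ e, ‖c e‖ ≤ M) :
    ‖Matrix.toEuclideanCLM (n := d) (𝕜 := ℂ)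
      (Matrix.of fun x y => ∑ e, if x = R e ∧ y = C e then c e else 0)‖ ≤ M := by
  classical
  refine ContinuousLinearMap.opNorm_le_bound _ hM fun v => ?_
  have hval : ∀ x, (Matrix.toEuclideanCLM (n := d) (𝕜 := ℂ)
      (Matrix.of fun x y => ∑ e, if x = R e ∧ y = C e then c e else 0) v) x =
      ∑ e, if x = R e then c e * v (C e) else 0 := by
    intro x
    rw [Matrix.ofLp_toEuclideanCLM, Matrix.mulVec, dotProduct]
    simp only [Matrix.of_apply, Finset.sum_mul]
    rw [Finset.sum_comm]
    refine Finset.sum_congr rfl fun e _ => ?_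
    by_cases hx : x = R e <;> simp [hx]
  have hinj : ∑ e, ‖v (C e)‖ ^ 2 ≤ ∑ y, ‖v y‖ ^ 2 := by
    rw [← Finset.sum_image (f := fun y => ‖v y‖ ^ 2) (s := Finset.univ) (g := C)
      fun a _ b _ h => hC h]
    exact Finset.sum_le_sum_of_subset_of_nonneg (Finset.subset_univ _) fun _ _ _ => by positivity
  have hsq : ∀ x, ‖∑ e, if x = R e then c e * v (C e) else 0‖ ^ 2 =
      ∑ e, if x = R e then ‖c e * v (C e)‖ ^ 2 else 0 := by
    intro x
    by_cases hx : ∃ e, x = R e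
    · obtain ⟨e, rfl⟩ := hx
      simp [hR.eq_iff]
    · push Not at hx
      simp [hx]
  rw [← sq_le_sq₀ (norm_nonneg _) (by positivity), mul_pow, EuclideanSpace.norm_sq_eq,
    EuclideanSpace.norm_sq_eq]
  simp only [hval, hsq]
  rw [Finset.sum_comm]
  calc ∑ e, ∑ x, (if x = R e then ‖c e * v (C e)‖ ^ 2 else 0)
      = ∑ e, ‖c e * v (C e)‖ ^ 2 := by simp
    _ ≤ ∑ e, M ^ 2 * ‖v (C e)‖ ^ 2 := by
        refine Finset.sum_le_sum fun e _ => ?_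
        rw [norm_mul, mul_pow]
        gcongr
        exact hc e
    _ = M ^ 2 * ∑ e, ‖v (C e)‖ ^ 2 := by rw [Finset.mul_sum]
    _ ≤ _ := by gcongr

theorem IX_lt {n K p : ℕ} (hK : 2 ^ n = K * p + 1) (e : Fin K) (j : Fin (p + 1)) :
    IX p e j < 2 ^ n := by
  have h1 : ((e : ℕ) + 1) * p ≤ K * p := Nat.mul_le_mul_right _ e.2
  have h2 := j.2
  rw [IX, hK]
  rw [add_mul, one_mul] at h1
  omega

/-- The spectral norm of a matrix assembled from small elemental arrays. -/
theorem specNorm_assembled_sub_le {n K p : ℕ} (hp : 1 ≤ p) (hK : 2 ^ n = K * p + 1)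
    {A₁ A₂ : Fin K → Fin (p + 1) → Fin (p + 1) → ℝ} {M : Fin (p + 1) → Fin (p + 1) → ℝ}
    (hM : ∀ j k, 0 ≤ M j k) (hA : ∀ e j k, |A₁ e j k - A₂ e j k| ≤ M j k) :
    specNorm (toQubits (n := n) (fun I J => ∑ e : Fin K, ∑ j : Fin (p + 1), ∑ k : Fin (p + 1),
        if (I : ℕ) = IX p e j ∧ (J : ℕ) = IX p e k then A₁ e j k else 0) -
      toQubits (fun I J => ∑ e : Fin K, ∑ j : Fin (p + 1), ∑ k : Fin (p + 1),
        if (I : ℕ) = IX p e j ∧ (J : ℕ) = IX p e k then A₂ e j k else 0)) ≤ ∑ j, ∑ k, M j k := by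
  set R : Fin (p + 1) → Fin K → Basis (Fin n) :=
    fun j e => finFunctionFinEquiv.symm ⟨IX p e j, IX_lt hK e j⟩ with hR
  have hinj : ∀ j, Function.Injective (R j) := by
    intro j e e' h
    have h1 := congrArg Fin.val (finFunctionFinEquiv.symm.injective h)
    simp only [IX] at h1
    exact Fin.ext (Nat.eq_of_mul_eq_mul_right hp (by omega))
  have hiff : ∀ (x : Basis (Fin n)) (j : Fin (p + 1)) (e : Fin K),
      ((finFunctionFinEquiv x : Fin (2 ^ n)) : ℕ) = IX p e j ↔ x = R j e := by
    intro x j e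
    rw [hR, Equiv.eq_symm_apply, Fin.ext_iff]
  have hdiff : toQubits (n := n) (fun I J => ∑ e : Fin K, ∑ j : Fin (p + 1), ∑ k : Fin (p + 1),
        if (I : ℕ) = IX p e j ∧ (J : ℕ) = IX p e k then A₁ e j k else 0) -
      toQubits (fun I J => ∑ e : Fin K, ∑ j : Fin (p + 1), ∑ k : Fin (p + 1),
        if (I : ℕ) = IX p e j ∧ (J : ℕ) = IX p e k then A₂ e j k else 0) =
      ∑ j, ∑ k, Matrix.of fun x y => ∑ e, if x = R j e ∧ y = R k e then
        ((A₁ e j k - A₂ e j k : ℝ) : ℂ) else 0 := by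
    ext x y
    rw [Matrix.sub_apply]
    simp only [toQubits, hiff, Matrix.sum_apply, Matrix.of_apply]
    rw [← Complex.ofReal_sub, ← Finset.sum_sub_distrib]
    simp only [← Finset.sum_sub_distrib]
    rw [Finset.sum_comm]
    push_cast
    refine Finset.sum_congr rfl fun j _ => ?_
    rw [Finset.sum_comm]
    refine Finset.sum_congr rfl fun k _ => Finset.sum_congr rfl fun e _ => ?_
    split_ifs <;> simp
  rw [hdiff, specNorm, map_sum]
  refine (norm_sum_le _ _).trans (Finset.sum_le_sum fun j _ => ?_)
  rw [map_sum]
  refine (norm_sum_le _ _).trans (Finset.sum_le_sum fun k _ => ?_)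
  refine norm_toEuclideanCLM_matching_le (hinj j) (hinj k) (hM j k) fun e => ?_
  rw [Complex.norm_real]
  exact hA e j k

end Assembly

/-! ### The gate count -/

section Cost

/-- Rounding a register up to a power of two loses at most a factor 2, so `G` and `n` enter the cost
linearly. -/
theorem two_pow_clog_le {x : ℕ} (hx : 1 ≤ x) : 2 ^ Nat.clog 2 x ≤ 2 * x := by
  rcases hx.eq_or_lt with rfl | hx
  · simp
  · have h1 := Nat.pow_pred_clog_lt_self one_lt_two hx
    have h2 := Nat.clog_pos one_lt_two hx
    obtain ⟨c, hc⟩ := Nat.exists_eq_add_of_lt h2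
    rw [hc] at h1 ⊢
    simp only [zero_add, Nat.pred_eq_sub_one, Nat.add_sub_cancel] at h1
    rw [zero_add, pow_succ]
    omega

theorem cost_le {n m p D G : ℕ} (hn : 1 ≤ n) (hm : 1 ≤ m) (hp : 1 ≤ p) (hG : 1 ≤ G)
    (hDG : D ≤ 2 * G - 1) :
    3 * D * (16 * 2 ^ Nat.clog 2 (2 * G) * (2 ^ (Nat.clog 2 n + 1) - 1) + 400 * (n * p) + 451 +
      16 * 2 ^ Nat.clog 2 n + 8 * Nat.clog 2 n) + (400 * (n * p) + 200 * n + 801) ≤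
      4000 * (n * (D * G + p ^ 2 * m)) := by
  have h1 : 2 ^ Nat.clog 2 (2 * G) ≤ 4 * G := (two_pow_clog_le (by omega)).trans (by omega)
  have h2 : 2 ^ Nat.clog 2 n ≤ 2 * n := two_pow_clog_le hn
  have h3 : 2 ^ (Nat.clog 2 n + 1) - 1 ≤ 4 * n := by rw [pow_succ]; omega
  have h4 : Nat.clog 2 n ≤ 2 * n := Nat.lt_two_pow_self.le.trans h2
  -- The arithmetic in `3 * D` walks costs order `D * n * p`. If `p ≤ G` the term `D * G` absorbs
  -- it; otherwise `D < 2 * G < 2 * p`, and `p ^ 2` does.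
  have h5 : D * p ≤ D * G + 2 * p ^ 2 := by
    rcases le_or_gt p G with h | h
    · have := Nat.mul_le_mul_left D h
      omega
    · have := Nat.mul_le_mul_right p (show D ≤ 2 * p by omega)
      nlinarith
  have h6 : D ≤ D * G := Nat.le_mul_of_pos_right _ hG
  have h7 : p ^ 2 ≤ p ^ 2 * m := Nat.le_mul_of_pos_right _ hm
  have h8 : p ≤ p ^ 2 := Nat.le_self_pow two_ne_zero p
  calc _ ≤ 3 * D * (16 * (4 * G) * (4 * n) + 400 * (n * p) + 451 * n + 16 * (2 * n) +
        8 * (2 * n)) + (400 * (n * p) + 200 * n + 801 * n) := by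
        gcongr
        · omega
        · omega
    _ = n * (768 * (D * G) + 1200 * (D * p) + 1497 * D + 400 * p + 1001) := by ring
    _ ≤ n * (4000 * (D * G + p ^ 2 * m)) := by gcongr; omega
    _ = _ := by ring

end Cost

end QuFEM
end

/-! ### Assembly of the approximation, the quadrature and the circuit -/

theorem theorem4p1 :
    ∃ C : ℕ, ∀ (n m p K D G r : ℕ),
      -- the mesh: `2 ^ n` nodes, `K` elements, `p + 1 = 2 ^ m` nodes per element
      1 ≤ n → 1 ≤ m → p + 1 = 2 ^ m → 2 ^ n = K * p + 1 →
      -- the Gauss rule integrates polynomials of degree `D + r` exactly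
      D + r ≤ 2 * G - 1 → 1 ≤ G →
      ∀ (U : Submodule ℝ (ℝ → ℝ)) (B : U →ₗ[ℝ] U →ₗ[ℝ] (ℝ → ℝ))
        (hU : ∀ (e : Fin K) (j : Fin (p + 1)), QuFEM.elemBasis p K e j ∈ U),
      -- on each element the functions `B[N_j, N_k]` are polynomials of degree at most `r`
      (∀ (e : Fin K) (j k : Fin (p + 1)), ∃ P : Polynomial ℝ, P.natDegree ≤ r ∧
        ∀ x ∈ interior (QuFEM.element K e), QuFEM.pairing B hU e j k x = P.eval x) →
      -- the evaluations at the Gauss points do not depend on the element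
      (∀ (e e' : Fin K) (j k : Fin (p + 1)) (x : ℝ), QuFEM.IsGaussPoint G x →
        QuFEM.pairing B hU e j k (QuFEM.elemPoint K e x) =
          QuFEM.pairing B hU e' j k (QuFEM.elemPoint K e' x)) →
      ∀ (f : ℝ → ℝ), MeasureTheory.MemLp f ⊤ QuFEM.unitVolume →
      -- `f` is approximated up to `ε` by a polynomial of degree at most `D`
      ∀ (q : Polynomial ℝ) (ε : ℝ), q.natDegree ≤ D → 0 ≤ ε →
      QuFEM.supNorm (fun x => f x - q.eval x) ≤ ε →
      (∀ e : Fin K, 0 < QuFEM.supNorm f * ∑ j, ∑ k, QuFEM.elemAbs K (QuFEM.pairing B hU) e j k) →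
      ∃ (α : ℝ) (V : QuFEM.Op (Fin n ⊕ Fin (QuFEM.ancillas n p G))),
        (∀ e : Fin K,
          α ≤ QuFEM.supNorm f * ∑ j, ∑ k, QuFEM.elemAbs K (QuFEM.pairing B hU) e j k) ∧
        QuFEM.IsBlockEncoding α (QuFEM.ancillas n p G)
          (2 * ε * ∑ j, ∑ k, ⨆ e : Fin K, QuFEM.elemAbs K (QuFEM.pairing B hU) e j k)
          (QuFEM.toQubits (QuFEM.globalArray n K f (QuFEM.pairing B hU))) V ∧
        QuFEM.ImplementableWith n (QuFEM.ancillas n p G) (QuFEM.prepQubits p G)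
          (C * (n * (D * G + p ^ 2 * m))) V := by
  refine ⟨4000, fun n m p K D G r hn hm hpm hKn hDr hG U B hU hb hgauss f hf q ε hq hε hfq hβ => ?_⟩
  have hp : 1 ≤ p := by
    have := Nat.pow_le_pow_right two_pos hm
    omega
  have hK : 1 ≤ K := by
    rcases Nat.eq_zero_or_pos K with h | h
    · have := Nat.pow_le_pow_right two_pos hn
      rw [h, zero_mul] at hKn
      omega
    · exact h
  set S := QuFEM.supNorm f with hS
  -- Positivity of the element bound excludes `f = 0`; it is needed to divide by `S + ε` when `ε =
  -- 0`.
  have hS0 : 0 < S := by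
    refine lt_of_le_of_ne ENNReal.toReal_nonneg fun h => ?_
    have := hβ ⟨0, hK⟩
    rw [show S = 0 from h.symm, zero_mul] at this
    exact lt_irrefl _ this
  have hSε : 0 < S + ε := by linarith
  have hfae := QuFEM.ae_abs_le_supNorm hf
  have hfqae : ∀ᵐ x ∂QuFEM.unitVolume, |f x - q.eval x| ≤ ε := by
    filter_upwards [QuFEM.ae_abs_le_supNorm (hf.sub (QuFEM.memLp_eval q))] with x hx
    exact hx.trans hfq
  have hqle : ∀ x ∈ Set.Icc (0 : ℝ) 1, |q.eval x| ≤ S + ε := fun x hx => by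
    refine QuFEM.abs_eval_le_of_ae ?_ hx
    filter_upwards [hfae, hfqae] with x h1 h2
    have := abs_sub_abs_le_abs_sub (q.eval x) (f x)
    rw [abs_sub_comm] at this
    linarith
  -- The approximant may exceed `S` by `ε`. It is divided by `S + ε`, but the coefficients are
  -- scaled by `S` only, so that `α` keeps the bound with `S`; the mismatch costs the second `ε` in
  -- the error.
  set v : Polynomial ℝ := Polynomial.C (S + ε)⁻¹ * q with hv
  have hvD : v.natDegree ≤ D := (Polynomial.natDegree_C_mul_le _ _).trans hq
  have hv1 : ∀ x ∈ Set.Icc (0 : ℝ) 1, |v.eval x| ≤ 1 := fun x hx => by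
    rw [hv, Polynomial.eval_mul, Polynomial.eval_C, abs_mul, abs_of_pos (inv_pos.2 hSε),
      inv_mul_le_iff₀ hSε, mul_one]
    exact hqle x hx
  -- Transport from `[0, 1]` to `[-1, 1]`, the range of the walk eigenvalue `2 * x - 1` for a
  -- position `x`.
  set u : Polynomial ℝ := v.comp (Polynomial.C (1 / 2) * (Polynomial.X + Polynomial.C 1)) with hu
  have hueval : ∀ x : ℝ, u.eval x = v.eval ((x + 1) / 2) := fun x => by
    rw [hu, Polynomial.eval_comp]
    congr 1
    simp only [Polynomial.eval_mul, Polynomial.eval_C, Polynomial.eval_add, Polynomial.eval_X]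
    ring
  have huD : u.natDegree ≤ D := by
    rw [hu, Polynomial.natDegree_comp]
    have : (Polynomial.C (1 / 2 : ℝ) * (Polynomial.X + Polynomial.C 1)).natDegree ≤ 1 :=
      (Polynomial.natDegree_C_mul_le _ _).trans (Polynomial.natDegree_X_add_C _).le
    nlinarith
  have hu1 : ∀ x ∈ Set.Icc (-1 : ℝ) 1, |u.eval x| ≤ 1 := fun x hx => by
    rw [hueval]
    exact hv1 _ ⟨by linarith [hx.1], by linarith [hx.2]⟩
  -- One of the three additional ancillas doubles the number of points from `G` to `2 * G`; the
  -- other two are the control of signal processing and the flag.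
  have hclogG : Nat.clog 2 (2 * G) = Nat.clog 2 G + 1 := by
    rw [Nat.clog_of_two_le one_lt_two (by omega)]
    congr 2
    omega
  have hclogp : Nat.clog 2 ((p + 1) ^ 2) = m + m := by
    rw [hpm, ← pow_mul, Nat.clog_pow _ _ one_lt_two]
    ring
  obtain ⟨t, c, α, ht, hα, hαβ, hc, hval⟩ := QuFEM.exists_coefficients
    (A := QuFEM.Basis (Fin (Nat.clog 2 (2 * G)))) hK hG hDr
    (by simpa using Nat.le_pow_clog one_lt_two (2 * G)) hb hgauss hS0.le hβ hvD
  obtain ⟨V, hV, hVimp, hVeq⟩ := QuFEM.exists_meshEncoding (a := QuFEM.ancillas n p G)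
    (b := QuFEM.prepQubits p G) hn hp hpm hKn
    (Nat.le_pow_clog one_lt_two n) (by rw [QuFEM.prepQubits, hclogp])
    (by rw [QuFEM.prepQubits, QuFEM.ancillas, hclogG]; ring) (by omega) t ht huD hu1 c hα hc
  refine ⟨α, V, hαβ, ⟨hα, hV, ?_⟩, ?_⟩
  · rw [hVeq, Finset.mul_sum]
    simp only [Finset.mul_sum]
    refine QuFEM.specNorm_assembled_sub_le hp hKn (fun j k => ?_) fun e j k => ?_
    · refine mul_nonneg (by positivity) (Real.iSup_nonneg fun e => ?_)
      exact MeasureTheory.integral_nonneg fun x => abs_nonneg _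
    · obtain ⟨P, -, hP⟩ := hb e j k
      have hg : MeasureTheory.MemLp (fun x => S * v.eval x) ⊤ QuFEM.unitVolume :=
        (QuFEM.memLp_eval v).const_mul S
      have hsum : ∑ i, c i j k * u.eval (2 * (((e : ℕ) + t i) / K) - 1) =
          ∫ x in QuFEM.element K e, S * v.eval x * QuFEM.pairing B hU e j k x := by
        simp only [mul_assoc]
        rw [MeasureTheory.integral_const_mul, ← hval e j k]
        refine Finset.sum_congr rfl fun i _ => ?_
        rw [hueval]
        congr 2
        ring
      rw [hsum]
      refine (QuFEM.abs_elemArray_sub_le hP hf hg (δ := 2 * ε) ?_).trans ?_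
      · filter_upwards [hfqae, MeasureTheory.ae_restrict_mem measurableSet_Icc] with x h1 hx
        -- Since `q = (S + ε) v`, both parts are at most `ε`, whence `2 * ε`.
        have h2 : f x - S * v.eval x = (f x - q.eval x) + ε * v.eval x := by
          rw [hv, Polynomial.eval_mul, Polynomial.eval_C]
          field_simp
          ring
        rw [h2]
        refine (abs_add_le _ _).trans ?_
        rw [abs_mul, abs_of_nonneg hε]
        have := mul_le_mul_of_nonneg_left (hv1 x hx) hε
        linarith
      · gcongr
        exact le_ciSup (f := fun e : Fin K => QuFEM.elemAbs K (QuFEM.pairing B hU) e j k)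
          (Set.finite_range _).bddAbove e
  · obtain ⟨w, reg, PL, PR, gates, hlen, himp⟩ := hVimp
    exact ⟨w, reg, PL, PR, gates, hlen.trans (QuFEM.cost_le hn hm hp hG (by omega)), himp⟩
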